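/- **Setting.** Let $G=(V,E,w)$ be a finite simple undirected graph with $n=|V|$ vertices and positive edge weights, let $V\!C\subseteq V$ be a vertex cover of $G$, and let $X=V\setminus V\!C$. For a weighted multigraph $H$ on (a subset of) $V$ in which $V\!C$ is a vertex cover, and for $S\subseteq V\!C$, put $$\Delta_H(S)=\Delta_{H\setminus X}(S)+\sum_{x\in X}\min\{w_H(x,S),\,w_H(x,V\!C\setminus S)\},$$ where $\Delta_{H\setminus X}(S)$ is the weight of the cut $S$ in the sub-multigraph on $V\!C$ and $w_H(x,S)$ is the total weight of the edges between $x$ and $S$. Write $H\approx_\varepsilon^{V\!C}G$ if $(1-\varepsilon)\Delta_H(S)\le\Delta_G(S)\le(1+\varepsilon)\Delta_H(S)$ for all $S\subseteq V\!C$. $N_x$ denotes the star of the edges at $x$. **The procedure VertexSparsify**, for weights in $[\gamma,\gamma R]$, a degree bound $d$, an error $\varepsilon$, a natural number $t$ and constants $C_\xi,c$: 1. *Bucketing.* For $x\in X$ of positive degree let $u_x$ be a neighbour with $w(x,u_x)$ maximal. The multigraph $\widehat G_0$ on $V\!C$ consists of the edges of $G$ on $V\!C$ and, for every $x\in X$ and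 every neighbour $v$ of $x$ with $w(x,v)<\frac{\varepsilon}{2d}w(x,u_x)$, of a (parallel) edge $(u_x,v)_x$ of weight $w(x,v)$. For $0\le i\le\lfloor\log_2 R\rfloor$ the bipartite graph $\widehat G_i$ consists of the remaining edges at those $x\in X$ with $\gamma2^i\le w(x,u_x)<\gamma2^{i+1}$. 2. *Edge sampling.* $\widehat G_0$, with $m$ edges, is replaced by $H_0$ as follows, with $k=\lceil\log_2 m\rceil$. Starting from $\widehat G_0$, repeat at most $k$ times: in the current graph choose a bundle consisting of $\lceil 2C_\xi(c+1)(1+\log R)\log^2n/(\varepsilon/4k)^2\rceil$ successive layers, each layer being the union of spanning forests of the classes $2^j\le w<2^{j+1}$, $j\in\mathbb Z$, of the edges not in earlier layers; put the bundle into $H_0$; keep every other edge independently with probability $1/4$ and with weight multiplied by $4$, and continue with the kept edges, stopping as soon as fewer than $(c+2)\log n$ of them are left. At the end add the current graph to $H_0$. 3. *Vertex sampling.* Every $\widehat G_i$ is replaced by $H_i$ as follows, independently. Starting from $\widehat G_i$ and its non-cover vertices, repeat $\lceil\log_2 n\rceil$ times: build greedily $t$ successive maximal forests from edges $(u,v)_x$,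 where $x$ is a current non-cover vertex and $u\neq v$ are neighbours of $x$, discarding all edges with origin $x$ as soon as one of them has been used; call the vertices $x$ of the used edges light; put the stars of the light vertices, with their current weights, into $H_i$; keep the star of every other vertex independently with probability $1/2$ and with doubled weights, and continue with the kept stars. At the end add the current graph to $H_i$. 4. Return $H=H_0\,\dot\cup\,\dot\bigcup_iH_i$. **Theorem.** For all constants $c\ge1$, $a>0$, $A\ge0$, $B\in\mathbb N$ there are constants $C_\xi,C>0$ and $p\in\mathbb N$ and a choice of $t=t(n,d,\varepsilon)\in\mathbb N$ with $$t\le C\,d^2\log^3n\;\varepsilon^{-3}$$ such that the following holds. Let $G$, $V\!C$, $X$, $n$ be as above, let every vertex of $X$ have degree at most $d$, let all edge weights lie in $[\gamma,a\gamma W]$ with $\gamma>0$, $W\ge1$ and $\log W\le A\log^Bn$, and let $0<\varepsilon\le1$. Then, with probability at least $1-n^{-c}$, VertexSparsify (with $R=aW$) returns $H$ such that 1. $H\setminus X=H_0$ is a loopless multigraph on $V\!C$ with at most $C\,|V\!C|\,\log^pn\;\varepsilon^{-p}$ edges, and each $H_i$ is a bipartite graph between $V\!C$ and at most $C\,|V\!C|\,t\log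 n$ vertices of $X$; 2. $H\approx_\varepsilon^{V\!C}G$; 3. all edge weights of $H$ lie in $[\gamma,\,C\gamma nW]$. -/

import Mathlib

namespace VertexSparsification

/-- A labelled edge: `(none, s(u, v))` is an ordinary edge `uv`, and `(some x, s(u, v))` is a
parallel edge `(u, v)_x` which originates from the vertex `x`. -/
abbrev LEdge (V : Type*) := Option V × Sym2 V

/-- A weighted multigraph on (a part of) `V`, given by its weight function on labelled edges;
its edges are the labelled edges of non-zero weight. Addition is the union of edge-disjoint
multigraphs. -/
abbrev WGraph (V : Type*) := LEdge V → ℝ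

noncomputable section

open scoped Classical

/-! ### Multigraphs and their cuts -/

section Cuts

variable {V : Type*} [Fintype V]

/-- The set of edges of a weighted multigraph. -/
def edges (G : WGraph V) : Finset (LEdge V) := Finset.univ.filter fun e => G e ≠ 0

/-- The sub-multigraph consisting of the edges in `E`. -/
def restrict (G : WGraph V) (E : Finset (LEdge V)) : WGraph V := fun e => if e ∈ E then G e else 0

/-- Both end points of `e` lie in `S`. -/
def Inside (S : Finset V) (e : Sym2 V) : Prop := ∀ v ∈ e, v ∈ S

/-- Exactly one end point of `e` lies in `S`. -/
def Crosses (S : Finset V) (e : Sym2 V) : Prop := (∃ u ∈ e, u ∈ S) ∧ ∃ v ∈ e, v ∉ S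

/-- The multigraph induced on `VC`, i.e. `G \ X` with `X = V \ VC`. -/
def inner (VC : Finset V) (G : WGraph V) : WGraph V := fun e => if Inside VC e.2 then G e else 0

/-- The weight of the cut `S`. -/
def cutWeight (G : WGraph V) (S : Finset V) : ℝ :=
  ∑ e ∈ Finset.univ.filter (fun e : LEdge V => Crosses S e.2), G e

/-- `w(x, S)`, the total weight of the edges between `x` and `S`. -/
def weightTo (G : WGraph V) (x : V) (S : Finset V) : ℝ :=
  ∑ u ∈ S, ∑ o : Option V, G (o, s(x, u))

/-- The weight of the minimal extension of the cut `S ⊆ VC`, where `VC` is a vertex cover. -/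
def terminalCut (VC : Finset V) (G : WGraph V) (S : Finset V) : ℝ :=
  cutWeight (inner VC G) S +
    ∑ x ∈ Finset.univ \ VC, min (weightTo G x S) (weightTo G x (VC \ S))

/-- `H ≈_ε^{VC} G`. -/
def TerminalApprox (ε : ℝ) (VC : Finset V) (H G : WGraph V) : Prop :=
  ∀ S ⊆ VC, (1 - ε) * terminalCut VC H S ≤ terminalCut VC G S ∧
    terminalCut VC G S ≤ (1 + ε) * terminalCut VC H S

/-- The neighbours of `x` in a multigraph. -/
def neighbors (G : WGraph V) (x : V) : Finset V :=
  Finset.univ.filter fun v => ∃ o, G (o, s(x, v)) ≠ 0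

/-- The union of the stars `N_x`, `x ∈ X`. -/
def starUnion (G : WGraph V) (X : Finset V) : WGraph V :=
  fun e => if ∃ x ∈ X, x ∈ e.2 then G e else 0

/-- A simple graph with edge weights `w`, as a weighted multigraph. -/
def ofSimple (G : SimpleGraph V) (w : Sym2 V → ℝ) : WGraph V :=
  fun e => if e.1 = none ∧ e.2 ∈ G.edgeSet then w e.2 else 0

end Cuts

/-! ### Independent random choices -/

section Random

variable {α : Type*}

/-- Every entry of the list is kept, independently, with probability `1 / m`; the result is the
set of the entries that were kept. -/
def coins (m : ℕ) [NeZero m] : List α → PMF (Finset α)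
  | [] => PMF.pure ∅
  | a :: l => (PMF.uniformOfFintype (Fin m)).bind fun b =>
      (coins m l).map fun T => if b = 0 then insert a T else T

/-- Runs a list of random experiments independently. -/
def runAll : List (PMF α) → PMF (List α)
  | [] => PMF.pure []
  | p :: ps => p.bind fun a => (runAll ps).map fun as => a :: as

end Random

/-! ### Greedy forests -/

section Forests

variable {V : Type*} [Fintype V]

/-- The edge `e` can be added to the forest `F`: its end points are not connected in `F`. -/
def CanAdd (F : Finset (LEdge V)) (e : LEdge V) : Prop :=
  ∀ u v, e.2 = s(u, v) → ¬ (SimpleGraph.fromEdgeSet {p | ∃ o, (o, p) ∈ F}).Reachable u v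

/-- A spanning forest of the multigraph with the listed edges. -/
def greedyForest (E : List (LEdge V)) : Finset (LEdge V) :=
  E.foldl (fun F e => if CanAdd F e then insert e F else F) ∅

/-- A forest that is built greedily from the listed edges, where the insertion of an edge
`(u, v)_x` discards all the other edges that originate from `x`. -/
def greedyCliqueForest (E : List (LEdge V)) : Finset (LEdge V) :=
  E.foldl (fun F e => if CanAdd F e ∧ ∀ f ∈ F, f.1 ≠ e.1 then insert e F else F) ∅

/-- The origins of the edges in `t` successive greedy forests, where the edges that share their
origin with a previously inserted edge are discarded. -/
def forestOrigins : ℕ → List (LEdge V) → Finset (Option V)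
  | 0, _ => ∅
  | t + 1, E =>
      let O := (greedyCliqueForest E).image Prod.fst
      O ∪ forestOrigins t (E.filter fun e => e.1 ∉ O)

/-- The edges `(u, v)_x` of the cliques `K_x`, `x ∈ X`. -/
def cliqueEdges (G : WGraph V) (X : Finset V) : Finset (LEdge V) :=
  Finset.univ.filter fun e => ∃ x ∈ X, ∃ u ∈ neighbors G x, ∃ v ∈ neighbors G x,
    u ≠ v ∧ e = (some x, s(u, v))

/-- `LightVertices`: the vertices `x ∈ X` from whose cliques `K_x` the `t` forests are built. -/
def lightVertices (t : ℕ) (G : WGraph V) (X : Finset V) : Finset V :=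
  X.filter fun x => some x ∈ forestOrigins t (cliqueEdges G X).toList

end Forests

/-! ### Sampling of vertices -/

section VertexSampling

variable {V : Type*} [Fintype V]

/-- `Sample`: keeps every star `N_x`, `x ∈ X`, with probability `1/2`, with doubled weights. -/
def sample (G : WGraph V) (X : Finset V) : PMF (WGraph V × Finset V) :=
  (coins 2 X.toList).map fun XH => ((2 : ℝ) • starUnion G XH, XH)

/-- `BoundedVertexSparsify` with `l` rounds, for the bipartite graph `G` between a vertex cover
and the set `X`. -/
def boundedVertexSparsify (t : ℕ) : ℕ → WGraph V → Finset V → PMF (WGraph V)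
  | 0, G, _ => PMF.pure G
  | l + 1, G, X =>
      (sample G (X \ lightVertices t G X)).bind fun GX =>
        (boundedVertexSparsify t l GX.1 GX.2).map fun H =>
          starUnion G (lightVertices t G X) + H

end VertexSampling

/-! ### Cut sparsification by sampling of edges -/

section CutSparsification

variable {V : Type*} [Fintype V]

/-- A `2`-MST: the union of spanning forests of the classes of edges with
`2 ^ i ≤ w < 2 ^ (i + 1)`, `i ∈ ℤ`. -/
def twoMST (G : WGraph V) : Finset (LEdge V) :=
  (edges G).filter fun e => e ∈ greedyForest
    ((edges G).filter fun f => Int.log 2 (G f) = Int.log 2 (G e)).toList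

/-- A `t`-bundle `2`-MST. -/
def bundle : ℕ → WGraph V → Finset (LEdge V)
  | 0, _ => ∅
  | t + 1, G => twoMST G ∪ bundle t (restrict G (edges G \ twoMST G))

/-- `Light-Cut-Sparsify` with bundle size `t`: keeps the bundle, and keeps every other edge with
probability `1/4` and weight multiplied by `4`. Returns the bundle and the sampled part. -/
def lightCutSparsify (t : ℕ) (G : WGraph V) : PMF (WGraph V × WGraph V) :=
  (coins 4 (edges G \ bundle t G).toList).map fun T =>
    (restrict G (bundle t G), (4 : ℝ) • restrict G T)

/-- The iteration of `Cut-Sparsify`, with at most `k` rounds; it stops as soon as fewer than `r`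
sampled edges are left. -/
def cutSparsifyLoop (t : ℕ) (r : ℝ) : ℕ → WGraph V → PMF (WGraph V)
  | 0, G => PMF.pure G
  | k + 1, G => (lightCutSparsify t G).bind fun BG =>
      if ((edges BG.2).card : ℝ) < r then PMF.pure (BG.1 + BG.2)
      else (cutSparsifyLoop t r k BG.2).map fun H => BG.1 + H

/-- The bundle size `C_ξ c α (1 + log R) log² n / ε²` of `Light-Cut-Sparsify`, with `α = 2`; here
`R` bounds the ratio of the edge weights. -/
def cutBundleSize (Cξ : ℝ) (n : ℕ) (R c ε : ℝ) : ℕ :=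
  ⌈Cξ * c * 2 * (1 + Real.log R) * Real.log n ^ 2 / ε ^ 2⌉₊

/-- `Cut-Sparsify` with parameter `ρ = m`, the number of edges, i.e. with `k = ⌈log₂ m⌉` rounds;
the probability of success is measured in terms of `n = |V|`. -/
def cutSparsify (Cξ R c ε : ℝ) (G : WGraph V) : PMF (WGraph V) :=
  let k := Nat.clog 2 (edges G).card
  cutSparsifyLoop (cutBundleSize Cξ (Fintype.card V) R (c + 1) (ε / (2 * k)))
    ((c + 2) * Real.log (Fintype.card V)) k G

end CutSparsification

/-! ### Bucketing of vertices -/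

section Bucketing

variable {V : Type*} [Fintype V]

/-- The neighbours of `x` in a simple graph. -/
def nbrs (G : SimpleGraph V) (x : V) : Finset V := Finset.univ.filter fun v => G.Adj x v

/-- A neighbour of `x` whose edge has maximum weight in `N_x` (and `x` if there is none). -/
def top (G : SimpleGraph V) (w : Sym2 V → ℝ) (x : V) : V :=
  if h : (nbrs G x).Nonempty then
    Classical.choose (Finset.exists_max_image (nbrs G x) (fun v => w s(x, v)) h)
  else x

/-- The neighbours `v` of `x` with `w(x, v) < (η / d) max_u w(x, u)`. -/
def lowNbrs (G : SimpleGraph V) (w : Sym2 V → ℝ) (d : ℕ) (η : ℝ) (x : V) : Finset V :=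
  (nbrs G x).filter fun v => w s(x, v) < η / d * w s(x, top G w x)

/-- The multigraph `Ĝ \ X` on `VC`: the edges of `G` on `VC`, and an edge `(u, v)_x` of weight
`w(x, v)` for every `x ∉ VC` and every low neighbour `v` of `x`, where `u = top x`. -/
def hatCore (G : SimpleGraph V) (w : Sym2 V → ℝ) (VC : Finset V) (d : ℕ) (η : ℝ) : WGraph V
  | (none, e) => if e ∈ G.edgeSet ∧ Inside VC e then w e else 0
  | (some x, e) =>
      if x ∈ VC then 0
      else ∑ v ∈ lowNbrs G w d η x, if e = s(top G w x, v) then w s(x, v) else 0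

/-- The vertices of the `i`-th bucket: those `x ∉ VC` with
`γ 2 ^ i ≤ max_u w(x, u) < γ 2 ^ (i + 1)`. -/
def bucketVerts (G : SimpleGraph V) (w : Sym2 V → ℝ) (VC : Finset V) (γ : ℝ) (i : ℕ) : Finset V :=
  Finset.univ.filter fun x => x ∉ VC ∧ (nbrs G x).Nonempty ∧
    γ * 2 ^ i ≤ w s(x, top G w x) ∧ w s(x, top G w x) < γ * 2 ^ (i + 1)

/-- The bipartite graph `Ĝ_i`: the edges `xv` for `x` in the `i`-th bucket that are not low. -/
def hatBucket (G : SimpleGraph V) (w : Sym2 V → ℝ) (VC : Finset V) (d : ℕ) (η γ : ℝ) (i : ℕ) :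
    WGraph V :=
  fun e => if e.1 = none ∧ ∃ x ∈ bucketVerts G w VC γ i, ∃ v ∈ nbrs G x \ lowNbrs G w d η x,
    e.2 = s(x, v) then w e.2 else 0

end Bucketing

/-! ### The full procedure -/

section Main

variable {V : Type*} [Fintype V]

/-- An output of `VertexSparsify`: the multigraph `H \ X` on the vertex cover, and the graphs
`H_1, …, H_L` of the buckets. -/
structure Output (V : Type*) where
  core : WGraph V
  buckets : List (WGraph V)

/-- The graph `H`, the union of its parts. -/
def Output.graph (H : Output V) : WGraph V := H.core + H.buckets.sum

/-- `VertexSparsify` for a graph with edge weights in `[γ, γ R]`, with bundle size `t` for the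
vertex sampling and with the constants `Cξ` and `c` for the edge sampling. -/
def vertexSparsify (Cξ c γ R : ℝ) (t : ℕ) (G : SimpleGraph V) (w : Sym2 V → ℝ) (VC : Finset V)
    (d : ℕ) (ε : ℝ) : PMF (Output V) :=
  (cutSparsify Cξ R c (ε / 2) (hatCore G w VC d (ε / 2))).bind fun H₀ =>
    (runAll ((List.range (Nat.log 2 ⌊R⌋₊ + 1)).map fun i =>
      boundedVertexSparsify t (Nat.clog 2 (Fintype.card V))
        (hatBucket G w VC d (ε / 2) γ i) (bucketVerts G w VC γ i))).map fun Hs => ⟨H₀, Hs⟩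

/-- `M` is a multigraph without loops whose edges have both end points in `VC`. -/
def IsMultigraphOn (VC : Finset V) (M : WGraph V) : Prop :=
  ∀ e ∈ edges M, Inside VC e.2 ∧ ¬ e.2.IsDiag

/-- Every edge of `M` joins a vertex of `VC` to a vertex outside `VC`. -/
def IsBipartiteBetween (VC : Finset V) (M : WGraph V) : Prop :=
  ∀ e ∈ edges M, ∃ u ∈ VC, ∃ x, x ∉ VC ∧ e.2 = s(u, x)

/-- The non-cover vertices that occur in `M`. -/
def outerVerts (VC : Finset V) (M : WGraph V) : Finset V :=
  Finset.univ.filter fun x => x ∉ VC ∧ ∃ e ∈ edges M, x ∈ e.2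

end Main

end

end VertexSparsification

/-! Bucketing costs a factor 1 + ε/2. The low edges at x weigh together at most (ε/2) · w(x, u_x),
while the side of the cut that contains u_x carries at least w(x, u_x) in high edges. So low edges
on that side are negligible, and those on the other side are charged by the parallel edges (u_x,
v)_x (`min_add_comparison`, `star_comparison`). The weights left in one bucket agree up to a factor
4d/ε.

Both samplings rest on one principle, `fail_projection_le`. A union bound over all cuts S is too
expensive as it stands. Suppose that t forests are given, each of which connects all the vertices
touched by any one sampled item. The forest edges crossing S then determine the contribution of
every sampled item to S, so S may be replaced by a subset A of a forest with at most |VC| edges. If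
the allowed deviation contains a term proportional to t|A|, the Chernoff bound fails with
probability at most 2 exp(-κ|A|), and the sum over all nonempty A is small as soon as κ is a
multiple of log n. For a given S one uses the forest with the fewest crossing edges, so t|A| is at
most the number of crossing edges in all forests, and these are paid for by the part of the graph
that is kept unsampled.

For edges, the forests are the layers of the bundle in the weight class of the sampled edge, and the
bundle pays (`sum_layer_le`). For vertices, a forest edge (u, v)_x that crosses S shows that the
light vertex x is cut, and distinct forest edges have distinct origins, so the light vertices pay
(`sum_crossing_le_card`). Here an item contributes at most d · hi and a payer at least lo, so t has
to be of order (d · hi / lo) · log n / δ² with δ of order ε / log n; this is d² log³ n / ε³.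

The sizes are controlled by exponential moments: (1 + b^(-k))^(number of items), with k the number
of rounds left, does not grow in expectation under sampling with probability 1/b
(`fail_loop_card_le`, `fail_vertex_card_le`).

Sampling only increases weights, which gives the lower bound γ. In the buckets weights grow by at
most 2^⌈log₂ n⌉. In the core, an edge is at most the cut around one of its ends, and that cut is
already known to be approximately right (`output_properties`). All failure probabilities are added
in `fail_vertexSparsify_le`. -/

namespace VertexSparsification

open scoped Classical ENNReal

/-! ### Expectations and failure probabilities -/

section Probability

variable {α β : Type*}

/-- The expectation of a non-negative function. -/
noncomputable def expect (p : PMF α) (g : α → ℝ≥0∞) : ℝ≥0∞ := ∑' a, p a * g a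

/-- The probability that `Q` does not hold. -/
noncomputable def fail (p : PMF α) (Q : α → Prop) : ℝ≥0∞ := p.toOuterMeasure {a | ¬ Q a}

theorem expect_pure (a : α) (g : α → ℝ≥0∞) : expect (PMF.pure a) g = g a := by
  unfold expect
  rw [tsum_eq_single a]
  · simp
  · intro b hb; simp [PMF.pure_apply, hb]

theorem expect_bind (p : PMF α) (f : α → PMF β) (g : β → ℝ≥0∞) :
    expect (p.bind f) g = expect p fun a => expect (f a) g := by
  unfold expect
  simp only [PMF.bind_apply, ← ENNReal.tsum_mul_right, ← ENNReal.tsum_mul_left]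
  rw [ENNReal.tsum_comm]
  simp only [mul_assoc]

theorem expect_map (p : PMF α) (f : α → β) (g : β → ℝ≥0∞) :
    expect (p.map f) g = expect p fun a => g (f a) := by
  rw [PMF.map, expect_bind]
  simp [expect_pure]

theorem expect_mono {p : PMF α} {g h : α → ℝ≥0∞} (H : ∀ a ∈ p.support, g a ≤ h a) :
    expect p g ≤ expect p h := by
  refine ENNReal.tsum_le_tsum fun a => ?_
  by_cases ha : p a = 0
  · simp [ha]
  · exact mul_le_mul_right (H a ((PMF.mem_support_iff _ _).2 ha)) _

theorem expect_const_mul (p : PMF α) (c : ℝ≥0∞) (g : α → ℝ≥0∞) :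
    expect p (fun a => c * g a) = c * expect p g := by
  unfold expect
  rw [← ENNReal.tsum_mul_left]
  congr 1; ext a; ring

theorem expect_add (p : PMF α) (g h : α → ℝ≥0∞) :
    expect p (fun a => g a + h a) = expect p g + expect p h := by
  unfold expect
  rw [← ENNReal.tsum_add]
  congr 1; ext a; ring

theorem expect_const (p : PMF α) (c : ℝ≥0∞) : expect p (fun _ => c) = c := by
  unfold expect
  rw [ENNReal.tsum_mul_right, p.tsum_coe, one_mul]

theorem fail_eq_expect (p : PMF α) (Q : α → Prop) :
    fail p Q = expect p fun a => if Q a then 0 else 1 := by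
  unfold fail expect
  rw [PMF.toOuterMeasure_apply]
  congr 1; ext a
  by_cases h : Q a <;> simp [Set.indicator, h]

theorem fail_bind_eq (p : PMF α) (f : α → PMF β) (Q : β → Prop) :
    fail (p.bind f) Q = expect p fun a => fail (f a) Q := by
  simp only [fail_eq_expect, expect_bind]

theorem fail_map (p : PMF α) (f : α → β) (Q : β → Prop) :
    fail (p.map f) Q = fail p fun a => Q (f a) := by
  simp only [fail_eq_expect, expect_map]

theorem fail_pure {a : α} {Q : α → Prop} (h : Q a) : fail (PMF.pure a) Q = 0 := by
  simp [fail_eq_expect, expect_pure, h]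

theorem fail_le_expect {p : PMF α} {Q : α → Prop} {g : α → ℝ≥0∞}
    (h : ∀ a ∈ p.support, ¬ Q a → 1 ≤ g a) : fail p Q ≤ expect p g := by
  rw [fail_eq_expect]
  refine expect_mono fun a ha => ?_
  by_cases hQ : Q a
  · simp [hQ]
  · simpa [hQ] using h a ha hQ

theorem fail_le_one (p : PMF α) (Q : α → Prop) : fail p Q ≤ 1 := by
  refine (fail_le_expect (g := fun _ => 1) fun _ _ _ => le_rfl).trans (expect_const p 1).le

theorem fail_mono {p : PMF α} {Q R : α → Prop} (h : ∀ a ∈ p.support, Q a → R a) :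
    fail p R ≤ fail p Q := by
  rw [fail_eq_expect p Q]
  refine fail_le_expect fun a ha hR => ?_
  have : ¬ Q a := fun hQ => hR (h a ha hQ)
  simp [this]

theorem fail_eq_zero {p : PMF α} {Q : α → Prop} (h : ∀ a ∈ p.support, Q a) : fail p Q = 0 := by
  refine le_antisymm ?_ bot_le
  refine (fail_le_expect (g := fun _ => 0) fun a ha hQ => absurd (h a ha) hQ).trans ?_
  simp [expect_const]

theorem fail_and_le (p : PMF α) (Q R : α → Prop) :
    fail p (fun a => Q a ∧ R a) ≤ fail p Q + fail p R := by
  rw [fail_eq_expect p Q, fail_eq_expect p R, ← expect_add]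
  refine fail_le_expect fun a _ h => ?_
  by_cases hQ : Q a <;> by_cases hR : R a <;> simp_all

/-- Union bound for two consecutive experiments: either the first one fails, or the second one fails
after a good first outcome. -/
theorem fail_bind_le {p : PMF α} {f : α → PMF β} {Q : α → Prop} {R : β → Prop} {b c : ℝ≥0∞}
    (hp : fail p Q ≤ b) (hf : ∀ a ∈ p.support, Q a → fail (f a) R ≤ c) :
    fail (p.bind f) R ≤ b + c := by
  rw [fail_bind_eq]
  calc expect p (fun a => fail (f a) R)
      ≤ expect p fun a => (if Q a then 0 else 1) + c := by
        refine expect_mono fun a ha => ?_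
        by_cases hQ : Q a
        · simpa [hQ] using hf a ha hQ
        · simpa [hQ] using (fail_le_one _ _).trans le_self_add
    _ = fail p Q + c := by rw [expect_add, expect_const, fail_eq_expect]
    _ ≤ b + c := by gcongr

theorem fail_finset_le {ι : Type*} (p : PMF α) (s : Finset ι) (Q : ι → α → Prop) :
    fail p (fun a => ∀ i ∈ s, Q i a) ≤ ∑ i ∈ s, fail p (Q i) := by
  induction s using Finset.induction_on with
  | empty => simp [fail_eq_zero]
  | insert i s hi ih =>
    rw [Finset.sum_insert hi]
    refine le_trans (le_trans (fail_mono fun a _ h => ?_) (fail_and_le p (Q i) _))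
      (add_le_add_right ih _)
    simpa using h

theorem one_sub_fail_le (p : PMF α) (Q : α → Prop) {b : ℝ≥0∞} (h : fail p Q ≤ b) :
    1 - b ≤ p.toOuterMeasure {a | Q a} := by
  have h1 : fail p (fun a => ¬ Q a) + fail p Q = 1 := by
    rw [fail_eq_expect, fail_eq_expect, ← expect_add, ← expect_const p 1]
    congr 1; ext a
    by_cases hQ : Q a <;> simp [hQ, expect_const]
  have h2 : p.toOuterMeasure {a | Q a} = fail p (fun a => ¬ Q a) := by simp [fail]
  rw [h2, tsub_le_iff_right, ← h1]
  gcongr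

/-- The failure probabilities of independent experiments add up. -/
theorem fail_runAll_le {ι : Type*} (l : List ι) (p : ι → PMF α) (Q : ι → α → Prop) {b : ℝ≥0∞}
    (h : ∀ i ∈ l, fail (p i) (Q i) ≤ b) :
    fail (runAll (l.map p)) (fun as => List.Forall₂ Q l as) ≤ l.length * b := by
  induction l with
  | nil => simp [runAll, fail_pure]
  | cons i l ih =>
    have h1 : fail (runAll ((i :: l).map p)) (fun as => List.Forall₂ Q (i :: l) as) ≤
        b + l.length * b := by
      simp only [List.map_cons, runAll]
      refine fail_bind_le (h i (by simp)) fun a _ ha => ?_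
      rw [fail_map]
      refine (fail_mono fun as _ has => ?_).trans (ih fun j hj => h j (by simp [hj]))
      exact List.Forall₂.cons ha has
    refine h1.trans (le_of_eq ?_)
    push_cast [List.length_cons]
    ring

end Probability

/-! ### Independent coin flips -/

section Coins

variable {ι : Type*}

theorem subset_of_mem_support_coins {m : ℕ} [NeZero m] {l : List ι} {T : Finset ι}
    (hT : T ∈ (coins m l).support) : ∀ a ∈ T, a ∈ l := by
  induction l generalizing T with
  | nil => simp [coins] at hT; simp [hT]
  | cons i l ih =>
    simp only [coins, PMF.mem_support_bind_iff, PMF.support_map, Set.mem_image] at hT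
    obtain ⟨b, -, T', hT', rfl⟩ := hT
    intro a ha
    split_ifs at ha
    · rcases Finset.mem_insert.1 ha with rfl | h
      · simp
      · exact List.mem_cons_of_mem _ (ih hT' a h)
    · exact List.mem_cons_of_mem _ (ih hT' a ha)

theorem expect_uniform {m : ℕ} [NeZero m] (f g : ℝ≥0∞) :
    expect (PMF.uniformOfFintype (Fin m)) (fun b => if b = 0 then f else g) =
      (m : ℝ≥0∞)⁻¹ * (f + (m - 1 : ℕ) * g) := by
  unfold expect
  rw [tsum_fintype]
  simp only [PMF.uniformOfFintype_apply, Fintype.card_fin]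
  rw [← Finset.mul_sum, Finset.sum_ite]
  simp [Finset.filter_eq', Finset.filter_ne']

/-- Independence in the form needed for moment generating functions: the expectation of a product is
the product of the one-item averages (f + (m - 1) g) / m, each of which may be replaced by an upper
bound B. Without repetitions in the list, the coin of the head does not affect the other factors. -/
theorem expect_coins_prod_le {m : ℕ} [NeZero m] {l : List ι} (hl : l.Nodup)
    (f g B : ι → ℝ≥0∞) (h : ∀ a ∈ l, f a + (m - 1 : ℕ) * g a ≤ m * B a) :
    expect (coins m l) (fun T => (l.map fun a => if a ∈ T then f a else g a).prod) ≤
      (l.map B).prod := by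
  have hm : (m : ℝ≥0∞) ≠ 0 := by exact_mod_cast NeZero.ne m
  induction l with
  | nil => simp [coins, expect_pure]
  | cons i l ih =>
    simp only [coins, expect_bind, expect_map]
    obtain ⟨hi, hl⟩ := List.nodup_cons.1 hl
    have key : ∀ b : Fin m, expect (coins m l) (fun T => ((i :: l).map fun a =>
        if a ∈ (if b = 0 then insert i T else T) then f a else g a).prod) ≤
        (if b = 0 then f i else g i) * (l.map B).prod := by
      intro b
      refine le_trans ?_ (mul_le_mul_right (ih hl fun a ha => h a (by simp [ha])) _)
      rw [← expect_const_mul]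
      refine expect_mono fun T hT => le_of_eq ?_
      have hiT : i ∉ T := fun h => hi (subset_of_mem_support_coins hT i h)
      rw [List.map_cons, List.prod_cons]
      congr 1
      · by_cases hb : b = 0 <;> simp [hb, hiT]
      · congr 1
        refine List.map_congr_left fun a ha => ?_
        have : a ≠ i := fun h => hi (h ▸ ha)
        by_cases hb : b = 0 <;> simp [hb, this]
    refine (expect_mono fun b _ => key b).trans ?_
    simp only [mul_comm _ (l.map B).prod]
    rw [expect_const_mul, expect_uniform, List.map_cons, List.prod_cons, mul_comm]
    refine mul_le_mul_left ?_ _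
    calc (m : ℝ≥0∞)⁻¹ * (f i + (m - 1 : ℕ) * g i) ≤ (m : ℝ≥0∞)⁻¹ * (m * B i) := by
          gcongr; exact h i (by simp)
      _ = B i := by
          rw [← mul_assoc, ENNReal.inv_mul_cancel hm (by simp), one_mul]

theorem expect_coins_toList_prod_le {m : ℕ} [NeZero m] (Y : Finset ι)
    (f g B : ι → ℝ≥0∞) (h : ∀ a ∈ Y, f a + (m - 1 : ℕ) * g a ≤ m * B a) :
    expect (coins m Y.toList) (fun T => ∏ a ∈ Y, if a ∈ T then f a else g a) ≤
      ∏ a ∈ Y, B a := by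
  have := expect_coins_prod_le (m := m) Y.nodup_toList f g B (fun a ha => h a (by simpa using ha))
  simpa [Finset.prod_map_toList] using this

/-- The exponential moment of the number of kept elements. -/
theorem expect_coins_pow_card_le {m : ℕ} [NeZero m] (Y : Finset ι) (y : ℝ≥0∞) :
    expect (coins m Y.toList) (fun T => (1 + y) ^ T.card) ≤ (1 + y / m) ^ Y.card := by
  have hm : (m : ℝ≥0∞) ≠ 0 := by exact_mod_cast NeZero.ne m
  have hm1 : 1 ≤ m := Nat.one_le_iff_ne_zero.2 (NeZero.ne m)
  have := expect_coins_toList_prod_le (m := m) Y (fun _ => 1 + y) (fun _ => 1)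
    (fun _ => 1 + y / m) (fun a _ => by
      rw [mul_add, mul_one, mul_one, ENNReal.mul_div_cancel hm (by simp)]
      apply le_of_eq
      have : (m : ℝ≥0∞) = 1 + (m - 1 : ℕ) := by
        rw [← Nat.cast_one, ← Nat.cast_add]; congr 1; omega
      rw [this]
      simp
      ring)
  rw [Finset.prod_const] at this
  refine le_trans (expect_mono fun T hT => le_of_eq ?_) this
  have hTY : T ⊆ Y := fun a ha => by simpa using subset_of_mem_support_coins hT a ha
  rw [Finset.prod_ite, Finset.prod_const, Finset.prod_const_one, mul_one]
  congr 2
  ext a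
  simp only [Finset.mem_filter]
  exact ⟨fun h => ⟨hTY h, h⟩, fun h => h.2⟩

theorem exp_le_one_add_add_sq {y : ℝ} (hy : |y| ≤ 1) : Real.exp y ≤ 1 + y + y ^ 2 := by
  have := Real.abs_exp_sub_one_sub_id_le hy
  have := abs_le.1 this
  linarith [this.2]

/-- The moment generating function of one sampled item of size `x`. -/
theorem exp_add_mul_exp_neg_le {m : ℕ} (hm : 2 ≤ m) {x : ℝ} (hx : |x| * (m - 1) ≤ 1) :
    Real.exp (x * (m - 1)) + (m - 1 : ℕ) * Real.exp (-x) ≤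
      m * Real.exp ((m - 1) * x ^ 2) := by
  have hm' : (2 : ℝ) ≤ m := by exact_mod_cast hm
  have hc : ((m - 1 : ℕ) : ℝ) = m - 1 := by rw [Nat.cast_sub (by omega)]; simp
  rw [hc]
  have h1 : Real.exp (x * (m - 1)) ≤ 1 + x * (m - 1) + (x * (m - 1)) ^ 2 := by
    apply exp_le_one_add_add_sq
    rw [abs_mul, abs_of_nonneg (by linarith : (0 : ℝ) ≤ m - 1)]
    exact hx
  have h2 : Real.exp (-x) ≤ 1 + -x + (-x) ^ 2 := by
    apply exp_le_one_add_add_sq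
    rw [abs_neg]
    nlinarith [abs_nonneg x]
  have h3 := Real.add_one_le_exp ((m - 1) * x ^ 2)
  -- The linear terms x (m - 1) and -(m - 1) x cancel, and the quadratic ones add up to ((m - 1)² +
  -- (m - 1)) x² = m (m - 1) x².
  nlinarith [mul_le_mul_of_nonneg_left h2 (by linarith : (0 : ℝ) ≤ m - 1),
    mul_le_mul_of_nonneg_left h3 (by linarith : (0 : ℝ) ≤ m)]

/-- Exponential Markov inequality. The sign s = ±1 covers both tails, and 0 ≤ b ≤ M bounds ∑ b² by M
μ. -/
theorem fail_upper_tail_le {m : ℕ} [NeZero m] (hm : 2 ≤ m) (Y : Finset ι) (b : ι → ℝ)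
    {M s θ μ Λ : ℝ} (hs : s ^ 2 = 1) (hM : 0 ≤ M) (hb : ∀ y ∈ Y, 0 ≤ b y ∧ b y ≤ M) (hθ : 0 ≤ θ)
    (hθM : θ * M * (m - 1) ≤ 1) (hμ : ∑ y ∈ Y, b y ≤ μ) :
    fail (coins m Y.toList)
      (fun T => s * ∑ y ∈ Y, ((if y ∈ T then (m : ℝ) else 0) - 1) * b y ≤ Λ) ≤
      ENNReal.ofReal (Real.exp ((m - 1) * θ ^ 2 * M * μ - θ * Λ)) := by
  have hm' : (2 : ℝ) ≤ m := by exact_mod_cast hm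
  have hs1 : |s| = 1 := by rw [← sq_abs] at hs; nlinarith [abs_nonneg s]
  have hmgf := expect_coins_toList_prod_le (m := m) Y
    (fun y => ENNReal.ofReal (Real.exp ((s * θ * b y) * (m - 1))))
    (fun y => ENNReal.ofReal (Real.exp (-(s * θ * b y))))
    (fun y => ENNReal.ofReal (Real.exp ((m - 1) * (s * θ * b y) ^ 2)))
    (fun y hy => by
      have h := exp_add_mul_exp_neg_le hm (x := s * θ * b y) (by
        rw [abs_mul, abs_mul, hs1, one_mul, abs_of_nonneg hθ, abs_of_nonneg (hb y hy).1]
        refine le_trans ?_ hθM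
        have := (hb y hy).2
        have : 0 ≤ (m : ℝ) - 1 := by linarith
        gcongr)
      rw [← ENNReal.ofReal_natCast (m - 1), ← ENNReal.ofReal_natCast m,
        ← ENNReal.ofReal_mul (by positivity), ← ENNReal.ofReal_mul (by positivity),
        ← ENNReal.ofReal_add (by positivity) (by positivity)]
      exact ENNReal.ofReal_le_ofReal h)
  have hB : ∏ y ∈ Y, ENNReal.ofReal (Real.exp ((m - 1) * (s * θ * b y) ^ 2)) ≤
      ENNReal.ofReal (Real.exp ((m - 1) * θ ^ 2 * M * μ)) := by
    rw [← ENNReal.ofReal_prod_of_nonneg (fun _ _ => (Real.exp_pos _).le), ← Real.exp_sum]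
    apply ENNReal.ofReal_le_ofReal
    apply Real.exp_le_exp.2
    calc ∑ y ∈ Y, (m - 1) * (s * θ * b y) ^ 2 ≤ ∑ y ∈ Y, (m - 1) * θ ^ 2 * M * b y := by
          refine Finset.sum_le_sum fun y hy => ?_
          have h1 : b y * b y ≤ M * b y := mul_le_mul_of_nonneg_right (hb y hy).2 (hb y hy).1
          have h2 : 0 ≤ ((m : ℝ) - 1) * θ ^ 2 := by
            have : 0 ≤ (m : ℝ) - 1 := by linarith
            positivity
          calc (m - 1) * (s * θ * b y) ^ 2 = ((m - 1) * θ ^ 2) * (b y * b y) := by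
                rw [mul_pow, mul_pow, hs]; ring
            _ ≤ ((m - 1) * θ ^ 2) * (M * b y) := mul_le_mul_of_nonneg_left h1 h2
            _ = _ := by ring
      _ = (m - 1) * θ ^ 2 * M * ∑ y ∈ Y, b y := by rw [Finset.mul_sum]
      _ ≤ _ := by
          have : 0 ≤ (m : ℝ) - 1 := by linarith
          gcongr
  have hexp : expect (coins m Y.toList) (fun T => ENNReal.ofReal
      (Real.exp (θ * (s * ∑ y ∈ Y, ((if y ∈ T then (m : ℝ) else 0) - 1) * b y - Λ)))) ≤
      ENNReal.ofReal (Real.exp (-(θ * Λ))) *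
        ENNReal.ofReal (Real.exp ((m - 1) * θ ^ 2 * M * μ)) := by
    refine le_trans ?_ (mul_le_mul_right (hmgf.trans hB) _)
    rw [← expect_const_mul]
    refine expect_mono fun T _ => le_of_eq ?_
    have : ∏ y ∈ Y, (if y ∈ T then ENNReal.ofReal (Real.exp ((s * θ * b y) * (m - 1)))
        else ENNReal.ofReal (Real.exp (-(s * θ * b y)))) =
        ENNReal.ofReal (Real.exp (∑ y ∈ Y, θ * s * (((if y ∈ T then (m : ℝ) else 0) - 1) * b y))) := by
      rw [Real.exp_sum, ENNReal.ofReal_prod_of_nonneg (fun _ _ => (Real.exp_pos _).le)]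
      refine Finset.prod_congr rfl fun y _ => ?_
      split_ifs <;> congr 2 <;> ring
    rw [this, ← ENNReal.ofReal_mul (Real.exp_pos _).le, ← Real.exp_add, ← Finset.mul_sum]
    congr 2; ring
  refine (fail_le_expect fun T _ hT => ?_).trans (hexp.trans (le_of_eq ?_))
  · rw [← ENNReal.ofReal_one]
    apply ENNReal.ofReal_le_ofReal
    apply Real.one_le_exp
    have := not_le.1 hT
    exact mul_nonneg hθ (by linarith)
  · rw [← ENNReal.ofReal_mul (Real.exp_pos _).le, ← Real.exp_add]
    congr 2; ring

/-- A Chernoff bound for the sampling of items with sizes in `[0, M]`. -/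
theorem fail_deviation_le {m : ℕ} [NeZero m] (hm : 2 ≤ m) (Y : Finset ι) (b : ι → ℝ)
    {M δ Λ : ℝ} (hM : 0 < M) (hb : ∀ y ∈ Y, 0 ≤ b y ∧ b y ≤ M) (hδ : 0 ≤ δ) (hδ1 : δ ≤ 1)
    (hΛ : ∑ y ∈ Y, b y ≤ Λ) :
    fail (coins m Y.toList)
      (fun T => |∑ y ∈ Y, ((if y ∈ T then (m : ℝ) else 0) - 1) * b y| ≤ δ * Λ) ≤
      ENNReal.ofReal (2 * Real.exp (-(δ ^ 2 * Λ / (4 * (m - 1) * M)))) := by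
  have hm' : (2 : ℝ) ≤ m := by exact_mod_cast hm
  have hm1 : 0 < (m : ℝ) - 1 := by linarith
  -- This θ = δ / (2 (m - 1) M) minimises the exponent for μ = Λ. Since Λ may exceed ∑ b, payments
  -- by unsampled items can be added to it later.
  have hθM : δ / (2 * (m - 1) * M) * M * (m - 1) ≤ 1 := by
    have : δ / (2 * (m - 1) * M) * M * (m - 1) = δ / 2 := by field_simp
    linarith
  have hexp : ((m : ℝ) - 1) * (δ / (2 * (m - 1) * M)) ^ 2 * M * Λ -
      δ / (2 * (m - 1) * M) * (δ * Λ) = -(δ ^ 2 * Λ / (4 * (m - 1) * M)) := by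
    field_simp; ring
  have hup := fail_upper_tail_le hm Y b (s := 1) (by norm_num) hM.le hb (by positivity) hθM hΛ
    (Λ := δ * Λ)
  have hlo := fail_upper_tail_le hm Y b (s := -1) (by norm_num) hM.le hb (by positivity) hθM hΛ
    (Λ := δ * Λ)
  rw [hexp] at hup hlo
  refine (fail_mono fun T _ h => ?_).trans ((fail_and_le _ _ _).trans ((add_le_add hup hlo).trans ?_))
  · rw [abs_le]
    constructor <;> linarith [h.1, h.2]
  · rw [two_mul, ENNReal.ofReal_add (Real.exp_pos _).le (Real.exp_pos _).le]

/-- The left side is the sum of x ^ |A| over the nonempty subsets A of a k-element set. -/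
theorem one_add_pow_sub_one_le {x : ℝ} (hx : 0 ≤ x) {k N : ℕ} (hk : k ≤ N) (h : N * x ≤ 1) :
    (1 + x) ^ k - 1 ≤ 2 * (N * x) := by
  have h0 : (0 : ℝ) ≤ N * x := by positivity
  have h1 : (1 + x) ^ k ≤ (1 + x) ^ N := pow_le_pow_right₀ (by linarith) hk
  have h2 : (1 + x) ^ N ≤ Real.exp (N * x) := by
    rw [Real.exp_nat_mul]
    exact pow_le_pow_left₀ (by linarith) (by linarith [Real.add_one_le_exp x]) _
  have h3 := exp_le_one_add_add_sq (y := N * x) (by rwa [abs_of_nonneg h0])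
  nlinarith

/-- Simultaneous concentration for all cuts `S`, provided that the cut `S` of the sampled items is
determined by the edges of `F i` which cross `S`, for each of `t` forests `F i`. -/
theorem fail_projection_le {σ ε : Type*} {m : ℕ} [NeZero m] (hm : 2 ≤ m) (Y : Finset ι)
    (a : ι → σ → ℝ) (F : ℕ → Finset ε) (cr : ℕ → σ → Finset ε) {t N : ℕ} {M u δ κ : ℝ}
    (ht : 0 < t) (hM : 0 < M) (hu : 0 ≤ u) (hδ : 0 ≤ δ) (hδ1 : δ ≤ 1)
    (ha : ∀ y ∈ Y, ∀ S, 0 ≤ a y S ∧ a y S ≤ M)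
    (hcr : ∀ i < t, ∀ S, cr i S ⊆ F i) (hF : ∀ i < t, (F i).card ≤ N)
    (heq : ∀ y ∈ Y, ∀ i < t, ∀ S S', cr i S = cr i S' → a y S = a y S')
    (hne : ∀ y ∈ Y, ∀ i < t, ∀ S, a y S ≠ 0 → (cr i S).Nonempty)
    (hκ : κ ≤ δ ^ 2 * (t * u) / (4 * (m - 1) * M)) :
    fail (coins m Y.toList) (fun T => ∀ S,
      |∑ y ∈ Y, ((if y ∈ T then (m : ℝ) else 0) - 1) * a y S| ≤
        δ * (∑ y ∈ Y, a y S + u * ∑ i ∈ Finset.range t, ((cr i S).card : ℝ))) ≤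
      ENNReal.ofReal (4 * t * N * Real.exp (-κ)) := by
  have hm' : (2 : ℝ) ≤ m := by exact_mod_cast hm
  have hm1 : 0 < (m : ℝ) - 1 := by linarith
  -- Otherwise the claimed bound exceeds 1.
  by_cases hN : (N : ℝ) * Real.exp (-κ) ≤ 1
  swap
  · refine (fail_le_one _ _).trans ?_
    rw [← ENNReal.ofReal_one]
    apply ENNReal.ofReal_le_ofReal
    have : (1 : ℝ) ≤ t := by exact_mod_cast ht
    nlinarith
  -- One event for each subset A of a forest instead of one for each cut.
  let Q : ℕ → Finset ε → Finset ι → Prop := fun i A T => ∀ S, cr i S = A →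
    |∑ y ∈ Y, ((if y ∈ T then (m : ℝ) else 0) - 1) * a y S| ≤
      δ * (∑ y ∈ Y, a y S + u * (t * A.card))
  have hQ : ∀ i < t, ∀ A : Finset ε, fail (coins m Y.toList) (Q i A) ≤
      ENNReal.ofReal (2 * Real.exp (-κ) ^ A.card) := by
    intro i hi A
    by_cases hS : ∃ S, cr i S = A
    swap
    · rw [fail_eq_zero]
      · exact bot_le
      · exact fun T _ S h => absurd ⟨S, h⟩ hS
    -- All cuts with projection A give the same shares to the sampled items, so the Chernoff bound
    -- for one of them serves all.
    obtain ⟨S, hS⟩ := hS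
    have h1 := fail_deviation_le hm Y (fun y => a y S) hM (fun y hy => ha y hy S) hδ hδ1
      (Λ := ∑ y ∈ Y, a y S + u * (t * A.card)) (le_add_of_nonneg_right (by positivity))
    refine (fail_mono fun T _ hT S' hS' => ?_).trans (h1.trans (ENNReal.ofReal_le_ofReal ?_))
    · have : ∀ y ∈ Y, a y S' = a y S := fun y hy => heq y hy i hi _ _ (hS'.trans hS.symm)
      rw [Finset.sum_congr rfl this, Finset.sum_congr rfl fun y hy => by rw [this y hy]]
      exact hT
    · rw [← Real.exp_nat_mul]
      gcongr
      have h0 : 0 ≤ ∑ y ∈ Y, a y S := Finset.sum_nonneg fun y hy => (ha y hy S).1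
      calc (A.card : ℝ) * -κ = -(A.card * κ) := by ring
        _ ≥ -(A.card * (δ ^ 2 * (t * u) / (4 * (m - 1) * M))) := by gcongr
        _ = -(δ ^ 2 * (0 + u * (t * A.card)) / (4 * (m - 1) * M)) := by ring
        _ ≥ _ := by gcongr
  -- The empty A must be left out, since its term would be of order 1. It is not needed: by `hne`, a
  -- cut with empty projection cuts no sampled item.
  have hsum : ∀ i < t, fail (coins m Y.toList)
      (fun T => ∀ A ∈ (F i).powerset.erase ∅, Q i A T) ≤
      ENNReal.ofReal (4 * N * Real.exp (-κ)) := by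
    intro i hi
    refine (fail_finset_le _ _ _).trans ((Finset.sum_le_sum fun A _ => hQ i hi A).trans ?_)
    rw [← ENNReal.ofReal_sum_of_nonneg (fun _ _ => by positivity)]
    apply ENNReal.ofReal_le_ofReal
    have h1 : ∑ A ∈ (F i).powerset, Real.exp (-κ) ^ A.card = (1 + Real.exp (-κ)) ^ (F i).card := by
      have := Finset.sum_pow_mul_eq_add_pow (Real.exp (-κ)) 1 (F i)
      simpa [add_comm] using this
    have h2 := Finset.add_sum_erase (F i).powerset (fun A => Real.exp (-κ) ^ A.card)
      (Finset.empty_mem_powerset _)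
    rw [h1] at h2
    simp only [Finset.card_empty, pow_zero] at h2
    have h3 := one_add_pow_sub_one_le (Real.exp_pos (-κ)).le (hF i hi) hN
    rw [← Finset.mul_sum]
    linarith
  have htot : fail (coins m Y.toList)
      (fun T => ∀ i ∈ Finset.range t, ∀ A ∈ (F i).powerset.erase ∅, Q i A T) ≤
      ENNReal.ofReal (4 * t * N * Real.exp (-κ)) := by
    refine (fail_finset_le _ _ _).trans
      ((Finset.sum_le_sum fun i hi => hsum i (Finset.mem_range.1 hi)).trans (le_of_eq ?_))
    rw [Finset.sum_const, Finset.card_range, nsmul_eq_mul, ← ENNReal.ofReal_natCast,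
      ← ENNReal.ofReal_mul (by positivity)]
    congr 1; ring
  refine (fail_mono fun T _ hT S => ?_).trans htot
  by_cases hS : ∀ y ∈ Y, a y S = 0
  · rw [Finset.sum_eq_zero fun y hy => by rw [hS y hy, mul_zero], abs_zero]
    have h0 : 0 ≤ ∑ y ∈ Y, a y S := Finset.sum_nonneg fun y hy => (ha y hy S).1
    exact mul_nonneg hδ (add_nonneg h0 (mul_nonneg hu (Finset.sum_nonneg fun _ _ =>
      Nat.cast_nonneg _)))
  push Not at hS
  obtain ⟨y, hy, hyS⟩ := hS
  -- For the forest with the fewest crossing edges, t times their number is at most the total over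
  -- all forests.
  obtain ⟨i, hi, hmin⟩ := Finset.exists_min_image (Finset.range t) (fun i => (cr i S).card)
    ⟨0, by simpa using ht⟩
  have hi' := Finset.mem_range.1 hi
  have h1 := hT i hi (cr i S) (by
    rw [Finset.mem_erase, Finset.mem_powerset]
    exact ⟨(hne y hy i hi' S hyS).ne_empty, hcr i hi' S⟩) S rfl
  refine h1.trans ?_
  gcongr
  have : (Finset.range t).card • ((cr i S).card : ℝ) ≤ ∑ j ∈ Finset.range t, ((cr j S).card : ℝ) :=
    Finset.card_nsmul_le_sum _ _ _ fun j hj => by exact_mod_cast hmin j hj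
  rw [Finset.card_range, nsmul_eq_mul] at this
  exact this

end Coins

/-! ### Forests and cuts -/

section ForestLemmas

variable {V : Type*}

theorem restrict_apply {G : WGraph V} {E : Finset (LEdge V)} {e : LEdge V} (he : e ∈ E) :
    restrict G E e = G e := if_pos he

/-- The simple graph underlying a set of labelled edges. -/
def forestGraph (F : Finset (LEdge V)) : SimpleGraph V := SimpleGraph.fromEdgeSet {p | ∃ o, (o, p) ∈ F}

theorem crosses_mk {S : Finset V} {u v : V} : Crosses S s(u, v) ↔ ¬ (u ∈ S ↔ v ∈ S) := by
  simp only [Crosses, Sym2.mem_iff, exists_eq_or_imp, exists_eq_left]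
  tauto

theorem inside_mk {S : Finset V} {u v : V} : Inside S s(u, v) ↔ u ∈ S ∧ v ∈ S := by
  simp [Inside]

/-- The edges of `F` that cross `S`. -/
noncomputable def crossing (F : Finset (LEdge V)) (S : Finset V) : Finset (LEdge V) :=
  F.filter fun e => Crosses S e.2

theorem mem_crossing {F : Finset (LEdge V)} {S : Finset V} {e : LEdge V} :
    e ∈ crossing F S ↔ e ∈ F ∧ Crosses S e.2 := Finset.mem_filter

theorem forestGraph_mono {F F' : Finset (LEdge V)} (h : F ⊆ F') : forestGraph F ≤ forestGraph F' :=
  SimpleGraph.fromEdgeSet_mono fun _ ⟨o, ho⟩ => ⟨o, h ho⟩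

/-- Along a path in F the side changes exactly at the crossing edges. Hence these edges alone decide
which connected vertices are separated. -/
theorem same_side_iff {F : Finset (LEdge V)} {S S' : Finset V} (h : crossing F S = crossing F S')
    {u v : V} (huv : (forestGraph F).Reachable u v) : (u ∈ S ↔ v ∈ S) ↔ (u ∈ S' ↔ v ∈ S') := by
  obtain ⟨p⟩ := huv
  induction p with
  | nil => simp
  | @cons a b c hab p ih =>
    obtain ⟨⟨o, ho⟩, -⟩ := (SimpleGraph.fromEdgeSet_adj _).1 hab
    have h1 : Crosses S s(a, b) ↔ Crosses S' s(a, b) := by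
      have := Finset.ext_iff.1 h (o, s(a, b))
      simpa [mem_crossing, ho] using this
    rw [crosses_mk, crosses_mk] at h1
    tauto

/-- Otherwise S meets F like the empty cut, which separates nothing. -/
theorem crossing_nonempty {F : Finset (LEdge V)} {S : Finset V} {u v : V}
    (huv : (forestGraph F).Reachable u v) (hS : ¬ (u ∈ S ↔ v ∈ S)) : (crossing F S).Nonempty := by
  by_contra h
  rw [Finset.not_nonempty_iff_eq_empty] at h
  have h0 : crossing F (∅ : Finset V) = ∅ := by
    ext e
    simp [mem_crossing, Crosses]
  have := same_side_iff (h.trans h0.symm) huv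
  simp at this
  tauto

theorem not_canAdd_iff {F : Finset (LEdge V)} {o : Option V} {u v : V} :
    ¬ CanAdd F (o, s(u, v)) ↔ (forestGraph F).Reachable u v := by
  constructor
  · intro h
    unfold CanAdd at h
    push Not at h
    obtain ⟨a, b, hab, hr⟩ := h
    rcases Sym2.eq_iff.1 hab with ⟨rfl, rfl⟩ | ⟨rfl, rfl⟩
    · exact hr
    · exact hr.symm
  · exact fun h hc => hc u v rfl h

theorem CanAdd.anti {F F' : Finset (LEdge V)} (h : F ⊆ F') {e : LEdge V} (he : CanAdd F' e) :
    CanAdd F e :=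
  fun u v huv hr => he u v huv (hr.mono (forestGraph_mono h))

/-- A greedy construction of a forest where only the edges that satisfy `P` are inserted. -/
noncomputable def greedy (P : Finset (LEdge V) → LEdge V → Prop) (F : Finset (LEdge V))
    (E : List (LEdge V)) : Finset (LEdge V) :=
  E.foldl (fun F e => if CanAdd F e ∧ P F e then insert e F else F) F

variable {P : Finset (LEdge V) → LEdge V → Prop}

theorem subset_greedy (F : Finset (LEdge V)) (E : List (LEdge V)) : F ⊆ greedy P F E := by
  induction E generalizing F with
  | nil => exact subset_rfl
  | cons e E ih =>
    refine subset_trans ?_ (ih _)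
    dsimp only
    split_ifs
    · exact Finset.subset_insert _ _
    · exact subset_rfl

theorem greedy_subset (F : Finset (LEdge V)) (E : List (LEdge V)) :
    ∀ e ∈ greedy P F E, e ∈ F ∨ e ∈ E := by
  induction E generalizing F with
  | nil => exact fun e he => Or.inl he
  | cons e E ih =>
    intro f hf
    rcases ih _ f hf with h | h
    · dsimp only at h
      split_ifs at h
      · rcases Finset.mem_insert.1 h with rfl | h
        · exact Or.inr (by simp)
        · exact Or.inl h
      · exact Or.inl h
    · exact Or.inr (List.mem_cons_of_mem _ h)

/-- Maximality of the greedy construction. An edge is refused because its ends are already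
connected, which persists, or because P fails at some intermediate stage. Knowing that this stage is
contained in the result is enough: an edge that blocks an origin there still does so at the end. -/
theorem mem_greedy_or (F : Finset (LEdge V)) (E : List (LEdge V)) :
    ∀ e ∈ E, e ∈ greedy P F E ∨ ¬ CanAdd (greedy P F E) e ∨ ∃ F' ⊆ greedy P F E, ¬ P F' e := by
  induction E generalizing F with
  | nil => simp
  | cons e E ih =>
    intro f hf
    rcases List.mem_cons.1 hf with rfl | hf
    · have hsub := subset_greedy (P := P) (if CanAdd F f ∧ P F f then insert f F else F) E
      by_cases h : CanAdd F f ∧ P F f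
      · left
        rw [if_pos h] at hsub
        simp only [greedy, List.foldl_cons, if_pos h]
        exact hsub (Finset.mem_insert_self _ _)
      · rw [if_neg h] at hsub
        simp only [greedy, List.foldl_cons, if_neg h]
        by_cases h' : CanAdd F f
        · exact Or.inr (Or.inr ⟨F, hsub, fun hP => h ⟨h', hP⟩⟩)
        · exact Or.inr (Or.inl fun hc => h' (hc.anti hsub))
    · exact ih _ f hf

theorem greedy_induction {I : Finset (LEdge V) → Prop} (E : List (LEdge V))
    (step : ∀ F, I F → ∀ e ∈ E, CanAdd F e → P F e → I (insert e F)) :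
    ∀ F, I F → I (greedy P F E) := by
  induction E with
  | nil => exact fun F h => h
  | cons e E ih =>
    intro F hF
    refine ih (fun F hF f hf => step F hF f (List.mem_cons_of_mem _ hf)) _ ?_
    dsimp only
    split_ifs with h
    · exact step F hF e (by simp) h.1 h.2
    · exact hF

/-- The number of components of a forest that meet `VC`. -/
noncomputable def componentCount (VC : Finset V) (F : Finset (LEdge V)) : ℕ :=
  (VC.image (forestGraph F).connectedComponentMk).card

/-- The new edge merges two components that both meet VC. Counting only such components bounds
forests by |VC| rather than by |V|. -/
theorem componentCount_insert {VC : Finset V} {F : Finset (LEdge V)} {e : LEdge V}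
    (he : Inside VC e.2) (hF : CanAdd F e) :
    componentCount VC (insert e F) + 1 ≤ componentCount VC F := by
  obtain ⟨o, p⟩ := e
  induction p using Sym2.ind with
  | _ u v =>
    obtain ⟨hu, hv⟩ := inside_mk.1 he
    have huv : ¬ (forestGraph F).Reachable u v := hF u v rfl
    have hle := forestGraph_mono (Finset.subset_insert (o, s(u, v)) F)
    let φ := SimpleGraph.ConnectedComponent.map (SimpleGraph.Hom.ofLE hle)
    have himg : VC.image (forestGraph (insert (o, s(u, v)) F)).connectedComponentMk =
        (VC.image (forestGraph F).connectedComponentMk).image φ := by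
      rw [Finset.image_image]
      rfl
    have hne : u ≠ v := fun h => huv (h ▸ SimpleGraph.Reachable.refl _)
    have hadj : (forestGraph (insert (o, s(u, v)) F)).Adj u v :=
      (SimpleGraph.fromEdgeSet_adj _).2 ⟨⟨o, by simp⟩, hne⟩
    unfold componentCount
    rw [himg, Nat.add_one_le_iff]
    refine lt_of_le_of_ne Finset.card_image_le fun h => huv ?_
    have hinj := Finset.card_image_iff.1 h
    have := @hinj ((forestGraph F).connectedComponentMk u) (by simpa using ⟨u, hu, .rfl⟩)
      ((forestGraph F).connectedComponentMk v) (by simpa using ⟨v, hv, .rfl⟩)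
      (SimpleGraph.ConnectedComponent.eq.2 hadj.reachable)
    exact SimpleGraph.ConnectedComponent.eq.1 this

theorem card_greedy_le {VC : Finset V} {E : List (LEdge V)} (hE : ∀ e ∈ E, Inside VC e.2) :
    (greedy P ∅ E).card ≤ VC.card := by
  have := greedy_induction (P := P) (I := fun F => F.card + componentCount VC F ≤ VC.card) E
    (fun F hF e he hc _ => by
      have := componentCount_insert (hE e he) hc
      have := Finset.card_insert_le e F
      omega) ∅ (by simpa [componentCount] using Finset.card_image_le)
  omega

theorem greedyForest_eq [Fintype V] (E : List (LEdge V)) :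
    greedyForest E = greedy (fun _ _ => True) ∅ E := by
  simp [greedyForest, greedy]

theorem greedyCliqueForest_eq [Fintype V] (E : List (LEdge V)) :
    greedyCliqueForest E = greedy (fun F e => ∀ f ∈ F, f.1 ≠ e.1) ∅ E := by
  unfold greedyCliqueForest greedy
  congr!

end ForestLemmas

/-! ### The forests of cliques -/

section CliqueForests

variable {V : Type*} [Fintype V]

theorem mem_of_mem_greedyCliqueForest {E : List (LEdge V)} {e : LEdge V}
    (he : e ∈ greedyCliqueForest E) : e ∈ E := by
  rw [greedyCliqueForest_eq] at he
  simpa using greedy_subset _ _ e he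

theorem greedyCliqueForest_injOn {E : List (LEdge V)} {e f : LEdge V}
    (he : e ∈ greedyCliqueForest E) (hf : f ∈ greedyCliqueForest E) (h : e.1 = f.1) : e = f := by
  rw [greedyCliqueForest_eq] at he hf
  refine greedy_induction (P := fun F e => ∀ f ∈ F, f.1 ≠ e.1)
    (I := fun F => ∀ e ∈ F, ∀ f ∈ F, e.1 = f.1 → e = f) E ?_ ∅ (by simp) e he f hf h
  intro F hF g _ _ hg e he f hf hef
  rcases Finset.mem_insert.1 he with rfl | he <;> rcases Finset.mem_insert.1 hf with h | hf
  · exact h.symm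
  · exact absurd hef.symm (hg f hf)
  · exact absurd (h ▸ hef) (hg e he)
  · exact hF e he f hf hef

/-- The `i`-th of the successive greedy forests of `forestOrigins`. -/
noncomputable def cliqueForest : ℕ → List (LEdge V) → Finset (LEdge V)
  | 0, E => greedyCliqueForest E
  | i + 1, E => cliqueForest i (E.filter fun e => e.1 ∉ (greedyCliqueForest E).image Prod.fst)

theorem mem_forestOrigins {t : ℕ} {E : List (LEdge V)} {o : Option V} :
    o ∈ forestOrigins t E ↔ ∃ i < t, ∃ e ∈ cliqueForest i E, e.1 = o := by
  induction t generalizing E with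
  | zero => simp [forestOrigins]
  | succ t ih =>
    simp only [forestOrigins, Finset.mem_union, ih]
    constructor
    · rintro (h | ⟨i, hi, e, he, rfl⟩)
      · obtain ⟨e, he, rfl⟩ := Finset.mem_image.1 h
        exact ⟨0, by omega, e, he, rfl⟩
      · exact ⟨i + 1, by omega, e, he, rfl⟩
    · rintro ⟨_ | i, hi, e, he, rfl⟩
      · exact Or.inl (Finset.mem_image_of_mem _ he)
      · exact Or.inr ⟨i, by omega, e, he, rfl⟩

theorem mem_of_mem_cliqueForest {i : ℕ} {E : List (LEdge V)} {e : LEdge V}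
    (he : e ∈ cliqueForest i E) : e ∈ E := by
  induction i generalizing E with
  | zero => exact mem_of_mem_greedyCliqueForest he
  | succ i ih => exact (List.mem_filter.1 (ih he)).1

/-- No origin is used twice, neither within a forest nor in two of them. So every forest edge has a
light vertex of its own that can pay for it. -/
theorem cliqueForest_injOn {i j : ℕ} {E : List (LEdge V)} {e f : LEdge V}
    (he : e ∈ cliqueForest i E) (hf : f ∈ cliqueForest j E) (h : e.1 = f.1) : i = j ∧ e = f := by
  have aux : ∀ (j : ℕ) (E : List (LEdge V)) (e f : LEdge V), e ∈ cliqueForest 0 E →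
      f ∈ cliqueForest (j + 1) E → e.1 ≠ f.1 := by
    intro j E e f he hf hef
    have := (List.mem_filter.1 (mem_of_mem_cliqueForest hf)).2
    simp only [decide_eq_true_eq] at this
    exact this (hef ▸ Finset.mem_image_of_mem _ he)
  induction i generalizing j E with
  | zero =>
    cases j with
    | zero => exact ⟨rfl, greedyCliqueForest_injOn he hf h⟩
    | succ j => exact absurd h (aux j E e f he hf)
  | succ i ih =>
    cases j with
    | zero => exact absurd h.symm (aux i E f e hf he)
    | succ j =>
      obtain ⟨rfl, rfl⟩ := ih he hf
      exact ⟨rfl, rfl⟩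

theorem card_cliqueForest_le {VC : Finset V} {E : List (LEdge V)} (hE : ∀ e ∈ E, Inside VC e.2)
    (i : ℕ) : (cliqueForest i E).card ≤ VC.card := by
  induction i generalizing E with
  | zero => rw [cliqueForest, greedyCliqueForest_eq]; exact card_greedy_le hE
  | succ i ih => exact ih fun e he => hE e (List.mem_filter.1 he).1

/-- An origin that is never used is never discarded, so its clique edges can only be refused because
their ends are already connected. This happens in each of the t forests. -/
theorem not_canAdd_cliqueForest {t i : ℕ} (hi : i < t) {E : List (LEdge V)} {e : LEdge V}
    (he : e ∈ E) (hO : e.1 ∉ forestOrigins t E) : ¬ CanAdd (cliqueForest i E) e := by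
  induction i generalizing t E with
  | zero =>
    have hO' : ∀ f ∈ greedyCliqueForest E, f.1 ≠ e.1 := fun f hf h =>
      hO (mem_forestOrigins.2 ⟨0, hi, f, hf, h⟩)
    rw [greedyCliqueForest_eq] at hO'
    rw [cliqueForest, greedyCliqueForest_eq]
    rcases mem_greedy_or (P := fun F e => ∀ f ∈ F, f.1 ≠ e.1) ∅ E e he with h | h | ⟨F, hF, h⟩
    · exact absurd rfl (hO' e h)
    · exact h
    · exact absurd (fun f hf => hO' f (hF hf)) h
  | succ i ih =>
    obtain ⟨t, rfl⟩ : ∃ t', t = t' + 1 := ⟨t - 1, by omega⟩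
    simp only [forestOrigins, Finset.mem_union, not_or] at hO
    refine ih (t := t) (by omega) (List.mem_filter.2 ⟨he, by simpa using hO.1⟩) ?_
    exact hO.2

theorem card_forestOrigins_le {VC : Finset V} {t : ℕ} {E : List (LEdge V)}
    (hE : ∀ e ∈ E, Inside VC e.2) : (forestOrigins t E).card ≤ t * VC.card := by
  have : forestOrigins t E ⊆ (Finset.range t).biUnion fun i => (cliqueForest i E).image Prod.fst := by
    intro o ho
    obtain ⟨i, hi, e, he, rfl⟩ := mem_forestOrigins.1 ho
    exact Finset.mem_biUnion.2 ⟨i, Finset.mem_range.2 hi, Finset.mem_image_of_mem _ he⟩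
  refine (Finset.card_le_card this).trans (Finset.card_biUnion_le.trans ?_)
  refine (Finset.sum_le_sum fun i _ => Finset.card_image_le.trans (card_cliqueForest_le hE i)).trans ?_
  simp

theorem lightVertices_subset (t : ℕ) (G : WGraph V) (X : Finset V) : lightVertices t G X ⊆ X :=
  Finset.filter_subset _ _

theorem card_lightVertices_le {VC : Finset V} {t : ℕ} {G : WGraph V} {X : Finset V}
    (hG : ∀ x ∈ X, neighbors G x ⊆ VC) : (lightVertices t G X).card ≤ t * VC.card := by
  have hE : ∀ e ∈ (cliqueEdges G X).toList, Inside VC e.2 := by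
    intro e he
    simp only [Finset.mem_toList, cliqueEdges, Finset.mem_filter, Finset.mem_univ, true_and] at he
    obtain ⟨x, hx, u, hu, v, hv, -, rfl⟩ := he
    exact inside_mk.2 ⟨hG x hx hu, hG x hx hv⟩
  refine le_trans ?_ (card_forestOrigins_le (t := t) hE)
  refine Finset.card_le_card_of_injOn some (fun x hx => ?_) (Option.some_injective _).injOn
  simp only [lightVertices, Finset.coe_filter, Set.mem_ofPred_eq] at hx
  exact hx.2

end CliqueForests

/-! ### The layers of a bundle -/

section Layers

variable {V : Type*} [Fintype V]

theorem mem_edges {G : WGraph V} {e : LEdge V} : e ∈ edges G ↔ G e ≠ 0 := by simp [edges]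

theorem edges_restrict (G : WGraph V) (E : Finset (LEdge V)) :
    edges (restrict G E) = edges G ∩ E := by
  ext e
  simp only [mem_edges, restrict, Finset.mem_inter]
  split_ifs <;> simp_all

/-- The edges in the weight class `j`. -/
noncomputable def weightClass (G : WGraph V) (j : ℤ) : Finset (LEdge V) :=
  (edges G).filter fun e => Int.log 2 (G e) = j

/-- The edges of the `i`-th layer of a bundle that lie in the weight class `j`. -/
noncomputable def layer : ℕ → ℤ → WGraph V → Finset (LEdge V)
  | 0, j, G => greedyForest (weightClass G j).toList
  | i + 1, j, G => layer i j (restrict G (edges G \ twoMST G))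

theorem layer_zero_subset (j : ℤ) (G : WGraph V) : layer 0 j G ⊆ weightClass G j := by
  intro e he
  rw [layer, greedyForest_eq] at he
  simpa using greedy_subset _ _ e he

theorem mem_twoMST {G : WGraph V} {e : LEdge V} :
    e ∈ twoMST G ↔ e ∈ layer 0 (Int.log 2 (G e)) G := by
  simp only [twoMST, Finset.mem_filter]
  refine ⟨fun h => h.2, fun h => ⟨?_, h⟩⟩
  exact (Finset.mem_filter.1 (layer_zero_subset _ _ h)).1

theorem weightClass_restrict (G : WGraph V) (E : Finset (LEdge V)) (j : ℤ) :
    weightClass (restrict G E) j = weightClass G j ∩ E := by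
  ext e
  simp only [weightClass, Finset.mem_filter, edges_restrict, Finset.mem_inter]
  constructor
  · rintro ⟨⟨h1, h2⟩, h3⟩
    rw [restrict_apply h2] at h3
    exact ⟨⟨h1, h3⟩, h2⟩
  · rintro ⟨⟨h1, h3⟩, h2⟩
    rw [restrict_apply h2]
    exact ⟨⟨h1, h2⟩, h3⟩

theorem layer_subset (i : ℕ) (j : ℤ) (G : WGraph V) : layer i j G ⊆ weightClass G j := by
  induction i generalizing G with
  | zero => exact layer_zero_subset j G
  | succ i ih =>
    refine (ih _).trans ?_
    rw [weightClass_restrict]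
    exact Finset.inter_subset_left

theorem mem_bundle {t : ℕ} {G : WGraph V} {e : LEdge V} :
    e ∈ bundle t G ↔ ∃ i < t, e ∈ layer i (Int.log 2 (G e)) G := by
  induction t generalizing G with
  | zero => simp [bundle]
  | succ t ih =>
    simp only [bundle, Finset.mem_union, ih]
    have key : ∀ i, e ∈ layer i (Int.log 2 (restrict G (edges G \ twoMST G) e))
          (restrict G (edges G \ twoMST G)) ↔ e ∈ layer (i + 1) (Int.log 2 (G e)) G := by
      intro i
      by_cases he : e ∈ edges G \ twoMST G
      · rw [restrict_apply he]; rfl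
      · have h1 : ∀ j, e ∉ weightClass (restrict G (edges G \ twoMST G)) j := by
          intro j; rw [weightClass_restrict]; simp_all
        exact iff_of_false (fun h => h1 _ (layer_subset _ _ _ h))
          (fun h => h1 _ (layer_subset i _ _ h))
    constructor
    · rintro (h | ⟨i, hi, h⟩)
      · exact ⟨0, by omega, mem_twoMST.1 h⟩
      · exact ⟨i + 1, by omega, (key i).1 h⟩
    · rintro ⟨_ | i, hi, h⟩
      · exact Or.inl (mem_twoMST.2 h)
      · exact Or.inr ⟨i, by omega, (key i).2 h⟩

theorem layer_disjoint {i i' : ℕ} {j : ℤ} {G : WGraph V} {e : LEdge V} (h : e ∈ layer i j G)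
    (h' : e ∈ layer i' j G) : i = i' := by
  have aux : ∀ (i : ℕ) (G : WGraph V), e ∈ layer 0 j G → e ∉ layer (i + 1) j G := by
    intro i G h h'
    have h1 := layer_subset _ _ _ (show e ∈ layer i j (restrict G (edges G \ twoMST G)) from h')
    rw [weightClass_restrict, Finset.mem_inter, Finset.mem_sdiff] at h1
    refine h1.2.2 (mem_twoMST.2 ?_)
    rwa [(Finset.mem_filter.1 h1.1).2]
  induction i generalizing i' G with
  | zero =>
    cases i' with
    | zero => rfl
    | succ i' => exact absurd h' (aux i' G h)
  | succ i ih =>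
    cases i' with
    | zero => exact absurd h (aux i G h')
    | succ i' => rw [ih h h']

theorem card_layer_le {VC : Finset V} {G : WGraph V} (hG : ∀ e ∈ edges G, Inside VC e.2) (i : ℕ)
    (j : ℤ) : (layer i j G).card ≤ VC.card := by
  induction i generalizing G with
  | zero =>
    rw [layer, greedyForest_eq]
    refine card_greedy_le fun e he => hG e ?_
    rw [Finset.mem_toList] at he
    exact (Finset.mem_filter.1 he).1
  | succ i ih =>
    refine ih fun e he => hG e ?_
    rw [edges_restrict] at he
    exact (Finset.mem_inter.1 he).1

/-- Every layer is a maximal forest in each weight class, so an edge outside the bundle is spanned t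
times by edges of comparable weight. -/
theorem not_canAdd_layer {t i : ℕ} (hi : i < t) {G : WGraph V} {e : LEdge V} (he : e ∈ edges G)
    (hb : e ∉ bundle t G) : ¬ CanAdd (layer i (Int.log 2 (G e)) G) e := by
  induction i generalizing t G with
  | zero =>
    have h0 : e ∉ layer 0 (Int.log 2 (G e)) G := fun h => hb (mem_bundle.2 ⟨0, hi, h⟩)
    rw [layer, greedyForest_eq] at h0 ⊢
    rcases mem_greedy_or (P := fun _ _ => True) ∅ (weightClass G (Int.log 2 (G e))).toList e
      (by simp [weightClass, he]) with h | h | ⟨_, _, h⟩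
    · exact absurd h h0
    · exact h
    · exact absurd trivial h
  | succ i ih =>
    obtain ⟨t, rfl⟩ : ∃ t', t = t' + 1 := ⟨t - 1, by omega⟩
    simp only [bundle, Finset.mem_union, not_or] at hb
    have he' : e ∈ edges G \ twoMST G := Finset.mem_sdiff.2 ⟨he, hb.1⟩
    have := ih (t := t) (G := restrict G (edges G \ twoMST G)) (by omega)
      (by rw [edges_restrict]; simp_all) hb.2
    rwa [restrict_apply he'] at this

theorem bundle_subset (t : ℕ) (G : WGraph V) : bundle t G ⊆ edges G := by
  intro e he
  obtain ⟨i, -, h⟩ := mem_bundle.1 he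
  exact (Finset.mem_filter.1 (layer_subset _ _ _ h)).1

theorem card_bundle_le {VC : Finset V} {G : WGraph V} (hG : ∀ e ∈ edges G, Inside VC e.2) (t : ℕ)
    (J : Finset ℤ) (hJ : ∀ e ∈ edges G, Int.log 2 (G e) ∈ J) :
    (bundle t G).card ≤ t * J.card * VC.card := by
  have : bundle t G ⊆ (Finset.range t ×ˢ J).biUnion fun p => layer p.1 p.2 G := by
    intro e he
    obtain ⟨i, hi, h⟩ := mem_bundle.1 he
    exact Finset.mem_biUnion.2 ⟨(i, Int.log 2 (G e)), Finset.mem_product.2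
      ⟨Finset.mem_range.2 hi, hJ e (bundle_subset t G he)⟩, h⟩
  refine (Finset.card_le_card this).trans (Finset.card_biUnion_le.trans ?_)
  refine (Finset.sum_le_sum fun p _ => card_layer_le hG p.1 p.2).trans ?_
  simp

end Layers

/-! ### Sampling of edges -/

section WeightedOn

variable {V : Type*}

/-- `G` is a loopless multigraph on `VC` whose edges have weight at least `lo`. -/
def IsWeightedOn (VC : Finset V) (lo : ℝ) (G : WGraph V) : Prop :=
  ∀ e, G e = 0 ∨ ((Inside VC e.2 ∧ ¬ e.2.IsDiag) ∧ lo ≤ G e)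

theorem IsWeightedOn.nonneg {VC : Finset V} {lo : ℝ} {G : WGraph V} (h : IsWeightedOn VC lo G)
    (hlo : 0 ≤ lo) (e : LEdge V) : 0 ≤ G e := by
  rcases h e with h | h
  · exact h.ge
  · exact hlo.trans h.2

theorem IsWeightedOn.add {VC : Finset V} {lo : ℝ} {G H : WGraph V} (hG : IsWeightedOn VC lo G)
    (hH : IsWeightedOn VC lo H) (hlo : 0 ≤ lo) : IsWeightedOn VC lo (G + H) := by
  intro e
  have h1 := hG.nonneg hlo e
  have h2 := hH.nonneg hlo e
  rcases hG e with hg | ⟨hg, hg'⟩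
  · rcases hH e with hh | ⟨hh, hh'⟩
    · left; simp [hg, hh]
    · exact Or.inr ⟨hh, by simp only [Pi.add_apply]; linarith⟩
  · exact Or.inr ⟨hg, by simp only [Pi.add_apply]; linarith⟩

theorem IsWeightedOn.restrict {VC : Finset V} {lo : ℝ} {G : WGraph V} (hG : IsWeightedOn VC lo G)
    (E : Finset (LEdge V)) : IsWeightedOn VC lo (restrict G E) := by
  intro e
  by_cases he : e ∈ E
  · rw [restrict_apply he]; exact hG e
  · left; simp [VertexSparsification.restrict, he]

theorem IsWeightedOn.four_smul {VC : Finset V} {lo : ℝ} {G : WGraph V} (hG : IsWeightedOn VC lo G)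
    (hlo : 0 ≤ lo) : IsWeightedOn VC lo ((4 : ℝ) • G) := by
  intro e
  rcases hG e with h | ⟨h, h'⟩
  · left; simp [h]
  · exact Or.inr ⟨h, by simp only [Pi.smul_apply, smul_eq_mul]; linarith⟩

theorem two_zpow_log_le {x : ℝ} (h : 0 < x) : (2 : ℝ) ^ Int.log 2 x ≤ x := by
  simpa using Int.zpow_log_le_self (b := 2) (by norm_num) h

end WeightedOn

/-! ### Cuts and sizes under repeated edge sampling. -/

section EdgeSampling

variable {V : Type*} [Fintype V]

theorem cutWeight_add (G H : WGraph V) (S : Finset V) :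
    cutWeight (G + H) S = cutWeight G S + cutWeight H S := Finset.sum_add_distrib

theorem cutWeight_nonneg {G : WGraph V} (hG : ∀ e, 0 ≤ G e) (S : Finset V) :
    0 ≤ cutWeight G S := Finset.sum_nonneg fun e _ => hG e

/-- The contribution of the edge `e` to the cut `S`. -/
noncomputable def cutShare (G : WGraph V) (e : LEdge V) (S : Finset V) : ℝ :=
  if Crosses S e.2 then G e else 0

theorem cutWeight_eq_sum {G : WGraph V} {E : Finset (LEdge V)} (hE : edges G ⊆ E)
    (S : Finset V) : cutWeight G S = ∑ e ∈ E, cutShare G e S := by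
  rw [cutWeight, Finset.sum_filter]
  refine (Finset.sum_subset (Finset.subset_univ E) fun e _ he => ?_).symm
  have : G e = 0 := by
    by_contra h
    exact he (hE (mem_edges.2 h))
  simp [this]

theorem cutWeight_restrict (G : WGraph V) (E : Finset (LEdge V)) (S : Finset V) :
    cutWeight (restrict G E) S = ∑ e ∈ E, cutShare G e S := by
  rw [cutWeight_eq_sum (E := E) (by rw [edges_restrict]; exact Finset.inter_subset_right)]
  refine Finset.sum_congr rfl fun e he => ?_
  rw [cutShare, restrict_apply he, cutShare]

theorem cutWeight_smul (c : ℝ) (G : WGraph V) (S : Finset V) :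
    cutWeight (c • G) S = c * cutWeight G S := by
  simp [cutWeight, Finset.mul_sum]

theorem cutWeight_split (G : WGraph V) {E : Finset (LEdge V)} (hE : E ⊆ edges G) (S : Finset V) :
    cutWeight (restrict G E) S + cutWeight (restrict G (edges G \ E)) S = cutWeight G S := by
  rw [cutWeight_restrict, cutWeight_restrict, cutWeight_eq_sum subset_rfl, add_comm,
    Finset.sum_sdiff hE]

theorem IsWeightedOn.inside {VC : Finset V} {lo : ℝ} {G : WGraph V} (hG : IsWeightedOn VC lo G) :
    ∀ e ∈ edges G, Inside VC e.2 :=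
  fun e he => ((hG e).resolve_left (mem_edges.1 he)).1.1

theorem crosses_congr_of_layer {t i : ℕ} {G : WGraph V} {e : LEdge V} (he : e ∈ edges G \ bundle t G)
    (hi : i < t) {S S' : Finset V} (h : crossing (layer i (Int.log 2 (G e)) G) S =
      crossing (layer i (Int.log 2 (G e)) G) S') : Crosses S e.2 ↔ Crosses S' e.2 := by
  have h1 := not_canAdd_layer hi (Finset.mem_sdiff.1 he).1 (Finset.mem_sdiff.1 he).2
  obtain ⟨o, p⟩ := e
  induction p using Sym2.ind with
  | _ u v =>
    rw [not_canAdd_iff] at h1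
    rw [crosses_mk, crosses_mk, same_side_iff h h1]

theorem crossing_layer_nonempty {t i : ℕ} {G : WGraph V} {e : LEdge V}
    (he : e ∈ edges G \ bundle t G) (hi : i < t) {S : Finset V} (h : Crosses S e.2) :
    (crossing (layer i (Int.log 2 (G e)) G) S).Nonempty := by
  have h1 := not_canAdd_layer hi (Finset.mem_sdiff.1 he).1 (Finset.mem_sdiff.1 he).2
  obtain ⟨o, p⟩ := e
  induction p using Sym2.ind with
  | _ u v =>
    rw [not_canAdd_iff] at h1
    exact crossing_nonempty h1 (crosses_mk.1 h)

/-- An edge outside the bundle is spanned by t disjoint nonempty layers. Hence, whenever anything is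
sampled at all, the factor t in the union bound is at most the number of edges. -/
theorem bundleSize_le_card {VC : Finset V} {lo : ℝ} {t : ℕ} {G : WGraph V}
    (hG : IsWeightedOn VC lo G) (hne : (edges G \ bundle t G).Nonempty) : t ≤ (edges G).card := by
  obtain ⟨e, he⟩ := hne
  have hS : ∃ S, Crosses S e.2 := by
    have hd := ((hG e).resolve_left (mem_edges.1 (Finset.mem_sdiff.1 he).1)).1.2
    obtain ⟨o, p⟩ := e
    induction p using Sym2.ind with
    | _ u v =>
      refine ⟨{u}, crosses_mk.2 ?_⟩
      simp only [Sym2.mk_isDiag_iff] at hd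
      simpa using fun h => hd h.symm
  obtain ⟨S, hS⟩ := hS
  set j := Int.log 2 (G e)
  calc t = ∑ i ∈ Finset.range t, 1 := by simp
    _ ≤ ∑ i ∈ Finset.range t, (layer i j G).card := Finset.sum_le_sum fun i hi =>
        Finset.card_pos.2 ((crossing_layer_nonempty he (Finset.mem_range.1 hi) hS).mono
          (Finset.filter_subset _ _))
    _ = ((Finset.range t).biUnion fun i => layer i j G).card := by
        refine (Finset.card_biUnion fun i _ i' _ hii => ?_).symm
        exact Finset.disjoint_left.2 fun f hf hf' => hii (layer_disjoint hf hf')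
    _ ≤ (edges G).card := Finset.card_le_card (Finset.biUnion_subset.2 fun i _ =>
        (layer_subset i j G).trans (Finset.filter_subset _ _))

/-- Edges of class j weigh at least 2 ^ j and the layers are disjoint, so the unsampled bundle pays
for the crossing edges of all forests. -/
theorem sum_layer_le {t : ℕ} {G : WGraph V} (hG : ∀ e, 0 ≤ G e) (J : Finset ℤ) (S : Finset V) :
    ∑ j ∈ J, (2 : ℝ) ^ j * ∑ i ∈ Finset.range t, ((crossing (layer i j G) S).card : ℝ) ≤
      ∑ e ∈ bundle t G, cutShare G e S := by
  have h0 : ∀ e, 0 ≤ cutShare G e S := fun e => by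
    unfold cutShare; split_ifs; exacts [hG e, le_rfl]
  have h1 : ∀ i j, (2 : ℝ) ^ j * ((crossing (layer i j G) S).card : ℝ) ≤
      ∑ e ∈ layer i j G, cutShare G e S := by
    intro i j
    calc (2 : ℝ) ^ j * ((crossing (layer i j G) S).card : ℝ)
        = ∑ e ∈ crossing (layer i j G) S, (2 : ℝ) ^ j := by
          rw [Finset.sum_const, nsmul_eq_mul, mul_comm]
      _ ≤ ∑ e ∈ crossing (layer i j G) S, cutShare G e S := by
          refine Finset.sum_le_sum fun e he => ?_
          rw [mem_crossing] at he
          have h2 := Finset.mem_filter.1 (layer_subset i j G he.1)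
          rw [cutShare, if_pos he.2, ← h2.2]
          exact two_zpow_log_le (lt_of_le_of_ne (hG e) (mem_edges.1 h2.1).symm)
      _ ≤ _ := Finset.sum_le_sum_of_subset_of_nonneg (Finset.filter_subset _ _) fun e _ _ => h0 e
  calc ∑ j ∈ J, (2 : ℝ) ^ j * ∑ i ∈ Finset.range t, ((crossing (layer i j G) S).card : ℝ)
      ≤ ∑ j ∈ J, ∑ i ∈ Finset.range t, ∑ e ∈ layer i j G, cutShare G e S := by
        refine Finset.sum_le_sum fun j _ => ?_
        rw [Finset.mul_sum]
        exact Finset.sum_le_sum fun i _ => h1 i j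
    _ = ∑ p ∈ J ×ˢ Finset.range t, ∑ e ∈ layer p.2 p.1 G, cutShare G e S := by
        rw [Finset.sum_product]
    _ = ∑ e ∈ (J ×ˢ Finset.range t).biUnion fun p => layer p.2 p.1 G, cutShare G e S := by
        refine (Finset.sum_biUnion fun p _ p' _ hpp => ?_).symm
        refine Finset.disjoint_left.2 fun f hf hf' => hpp ?_
        have e1 := (Finset.mem_filter.1 (layer_subset _ _ _ hf)).2
        have e2 := (Finset.mem_filter.1 (layer_subset _ _ _ hf')).2
        have e3 : p.1 = p'.1 := e1.symm.trans e2
        simp only [e3] at hf hf'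
        exact Prod.ext e3 (layer_disjoint hf hf')
    _ ≤ _ := by
        refine Finset.sum_le_sum_of_subset_of_nonneg (fun e he => ?_) fun e _ _ => h0 e
        obtain ⟨p, hp, he⟩ := Finset.mem_biUnion.1 he
        refine mem_bundle.2 ⟨p.2, Finset.mem_range.1 (Finset.mem_product.1 hp).2, ?_⟩
        rwa [(Finset.mem_filter.1 (layer_subset _ _ _ he)).2]

/-- An instance of `fail_projection_le` with m = 4, shares at most M = 2 ^ (j + 1) and payment u = 2
^ j. The weight scale cancels, and 24 = 4 · (4 - 1) · 2. -/
theorem fail_edge_class_le {VC : Finset V} {lo δ : ℝ} {t : ℕ} {G : WGraph V}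
    (hG : IsWeightedOn VC lo G) (hlo : 0 < lo) (ht : 0 < t) (hδ : 0 ≤ δ) (hδ1 : δ ≤ 1) (j : ℤ) :
    fail (coins 4 (edges G \ bundle t G).toList) (fun T => ∀ S,
      |∑ y ∈ edges G \ bundle t G, ((if y ∈ T then (4 : ℝ) else 0) - 1) *
          (if Int.log 2 (G y) = j then cutShare G y S else 0)| ≤
        δ * (∑ y ∈ edges G \ bundle t G, (if Int.log 2 (G y) = j then cutShare G y S else 0) +
          (2 : ℝ) ^ j * ∑ i ∈ Finset.range t, ((crossing (layer i j G) S).card : ℝ))) ≤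
      ENNReal.ofReal (4 * t * VC.card * Real.exp (-(δ ^ 2 * t / 24))) := by
  set Y := edges G \ bundle t G with hY
  have hpos := hG.nonneg hlo.le
  have hshare : ∀ e S, 0 ≤ cutShare G e S := fun e S => by
    unfold cutShare; split_ifs; exacts [hpos e, le_rfl]
  have h2j : (0 : ℝ) < 2 ^ j := by positivity
  have key := fail_projection_le (m := 4) (by norm_num) Y
    (fun y S => if Int.log 2 (G y) = j then cutShare G y S else 0)
    (fun i => layer i j G) (fun i S => crossing (layer i j G) S) (M := (2 : ℝ) ^ (j + 1))
    (N := VC.card) (κ := δ ^ 2 * t / 24) ht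
    (by positivity) h2j.le hδ hδ1 ?_ ?_ ?_ ?_ ?_ ?_
  · simpa only [Nat.cast_ofNat] using key
  · intro y _ S
    split_ifs with h
    · refine ⟨hshare y S, ?_⟩
      rw [cutShare]
      split_ifs
      · rw [← h]
        exact (Int.lt_zpow_succ_log_self (b := 2) (by norm_num) (G y)).le.trans (by norm_num)
      · positivity
    · exact ⟨le_rfl, by positivity⟩
  · exact fun i _ S => Finset.filter_subset _ _
  · exact fun i _ => card_layer_le hG.inside i j
  · intro y hy i hi S S' h
    split_ifs with hj
    · subst hj
      simp only [cutShare, crosses_congr_of_layer hy hi h]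
    · rfl
  · intro y hy i hi S h
    split_ifs at h with hj
    · subst hj
      refine crossing_layer_nonempty hy hi ?_
      by_contra hc
      exact h (if_neg hc)
    · exact absurd rfl h
  · rw [zpow_add_one₀ (by norm_num)]
    apply le_of_eq
    push_cast
    field_simp
    norm_num
    ring

/-- One round of edge sampling preserves all cuts. -/
theorem fail_edge_round_le {VC : Finset V} {lo δ : ℝ} {t N : ℕ} {G : WGraph V}
    (hG : IsWeightedOn VC lo G) (hlo : 0 < lo) (ht : 0 < t) (hδ : 0 ≤ δ) (hδ1 : δ ≤ 1)
    (hN : (edges G).card ≤ N) :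
    fail (coins 4 (edges G \ bundle t G).toList) (fun T => ∀ S,
      |cutWeight ((4 : ℝ) • restrict G T) S - cutWeight (restrict G (edges G \ bundle t G)) S| ≤
        δ * cutWeight G S) ≤
      ENNReal.ofReal (4 * N ^ 2 * VC.card * Real.exp (-(δ ^ 2 * t / 24))) := by
  set Y := edges G \ bundle t G with hY
  have hpos := hG.nonneg hlo.le
  have hshare : ∀ e S, 0 ≤ cutShare G e S := fun e S => by
    unfold cutShare; split_ifs; exacts [hpos e, le_rfl]
  have hrw : ∀ T ⊆ Y, ∀ S, cutWeight ((4 : ℝ) • restrict G T) S - cutWeight (restrict G Y) S =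
      ∑ y ∈ Y, ((if y ∈ T then (4 : ℝ) else 0) - 1) * cutShare G y S := by
    intro T hT S
    rw [cutWeight_smul, cutWeight_restrict, cutWeight_restrict]
    simp only [sub_mul, one_mul, Finset.sum_sub_distrib, ite_mul, zero_mul]
    rw [← Finset.sum_filter, Finset.mul_sum, Finset.filter_mem_eq_inter,
      Finset.inter_eq_right.2 hT]
  by_cases hYe : Y.Nonempty
  swap
  · rw [Finset.not_nonempty_iff_eq_empty] at hYe
    rw [fail_eq_zero]
    · exact bot_le
    intro T hT S
    have hT' : T ⊆ Y := fun a ha => by simpa using subset_of_mem_support_coins hT a ha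
    rw [hrw T hT', hYe, Finset.sum_empty, abs_zero]
    exact mul_nonneg hδ (cutWeight_nonneg hpos S)
  have htN : t ≤ N := (bundleSize_le_card hG hYe).trans hN
  -- At most N weight classes occur, and each costs a factor t ≤ N; hence N² in the bound.
  let J := (edges G).image fun e => Int.log 2 (G e)
  have hJN : J.card ≤ N := Finset.card_image_le.trans hN
  have hclass := fun j (_ : j ∈ J) => fail_edge_class_le hG hlo ht hδ hδ1 j
  rw [← hY] at hclass
  refine (fail_mono fun T hT hall S => ?_).trans ((fail_finset_le _ J _).trans
    ((Finset.sum_le_sum hclass).trans ?_))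
  · have hT' : T ⊆ Y := fun a ha => by simpa using subset_of_mem_support_coins hT a ha
    rw [hrw T hT']
    have hsplit : ∀ y ∈ Y, cutShare G y S =
        ∑ j ∈ J, if Int.log 2 (G y) = j then cutShare G y S else 0 := by
      intro y hy
      rw [Finset.sum_ite_eq, if_pos]
      exact Finset.mem_image_of_mem _ (Finset.mem_sdiff.1 hy).1
    calc |∑ y ∈ Y, ((if y ∈ T then (4 : ℝ) else 0) - 1) * cutShare G y S|
        = |∑ j ∈ J, ∑ y ∈ Y, ((if y ∈ T then (4 : ℝ) else 0) - 1) *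
            (if Int.log 2 (G y) = j then cutShare G y S else 0)| := by
          rw [Finset.sum_comm]
          congr 1
          refine Finset.sum_congr rfl fun y hy => ?_
          rw [← Finset.mul_sum, ← hsplit y hy]
      _ ≤ ∑ j ∈ J, δ * (∑ y ∈ Y, (if Int.log 2 (G y) = j then cutShare G y S else 0) +
          (2 : ℝ) ^ j * ∑ i ∈ Finset.range t, ((crossing (layer i j G) S).card : ℝ)) :=
          (Finset.abs_sum_le_sum_abs _ _).trans (Finset.sum_le_sum fun j hj => hall j hj S)
      _ ≤ δ * (∑ y ∈ Y, cutShare G y S + ∑ e ∈ bundle t G, cutShare G e S) := by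
          rw [← Finset.mul_sum, Finset.sum_add_distrib, Finset.sum_comm (s := J),
            ← Finset.sum_congr rfl hsplit]
          gcongr
          exact sum_layer_le hpos J S
      _ = δ * cutWeight G S := by
          rw [cutWeight_eq_sum subset_rfl, hY, Finset.sum_sdiff (bundle_subset t G)]
  · rw [Finset.sum_const, nsmul_eq_mul, ← ENNReal.ofReal_natCast, ← ENNReal.ofReal_mul (by positivity)]
    apply ENNReal.ofReal_le_ofReal
    have h1 : (J.card : ℝ) ≤ N := by exact_mod_cast hJN
    have h2 : (t : ℝ) ≤ N := by exact_mod_cast htN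
    calc (J.card : ℝ) * (4 * t * VC.card * Real.exp (-(δ ^ 2 * t / 24)))
        ≤ N * (4 * N * VC.card * Real.exp (-(δ ^ 2 * t / 24))) := by gcongr
      _ = _ := by ring

theorem edges_four_smul_restrict {G : WGraph V} {T : Finset (LEdge V)} (hT : T ⊆ edges G) :
    edges ((4 : ℝ) • restrict G T) = T := by
  ext e
  simp only [mem_edges, Pi.smul_apply, smul_eq_mul, restrict]
  constructor
  · intro h
    by_contra he
    simp [he] at h
  · intro he
    simpa [he] using mem_edges.1 (hT he)

theorem isWeightedOn_of_mem_support_loop {VC : Finset V} {lo r : ℝ} (hlo : 0 ≤ lo) {t : ℕ} :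
    ∀ {k : ℕ} {G : WGraph V}, IsWeightedOn VC lo G → ∀ H ∈ (cutSparsifyLoop t r k G).support,
      IsWeightedOn VC lo H := by
  intro k
  induction k with
  | zero =>
    intro G hG H hH
    simp only [cutSparsifyLoop, PMF.mem_support_pure_iff] at hH
    exact hH ▸ hG
  | succ k ih =>
    intro G hG H hH
    simp only [cutSparsifyLoop, lightCutSparsify, PMF.mem_support_bind_iff, PMF.support_map,
      Set.mem_image] at hH
    obtain ⟨BG, ⟨T, -, rfl⟩, hH⟩ := hH
    have hS := (hG.restrict T).four_smul hlo
    split_ifs at hH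
    · rw [PMF.mem_support_pure_iff] at hH
      exact hH ▸ (hG.restrict _).add hS hlo
    · rw [PMF.support_map] at hH
      obtain ⟨H', hH', rfl⟩ := hH
      exact (hG.restrict _).add (ih hS H' hH') hlo

/-- The relative errors of the rounds multiply. The bundle is kept exactly, which is compatible
because (1 - δ) ^ k ≤ 1 ≤ (1 + δ) ^ k. -/
theorem fail_loop_cut_le {VC : Finset V} {lo δ r : ℝ} {t N : ℕ} (hlo : 0 < lo) (ht : 0 < t)
    (hδ : 0 ≤ δ) (hδ1 : δ ≤ 1) : ∀ {k : ℕ} {G : WGraph V}, IsWeightedOn VC lo G →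
      (edges G).card ≤ N →
      fail (cutSparsifyLoop t r k G) (fun H => ∀ S, (1 - δ) ^ k * cutWeight G S ≤ cutWeight H S ∧
        cutWeight H S ≤ (1 + δ) ^ k * cutWeight G S) ≤
      k * ENNReal.ofReal (4 * N ^ 2 * VC.card * Real.exp (-(δ ^ 2 * t / 24))) := by
  intro k
  induction k with
  | zero =>
    intro G _ _
    rw [cutSparsifyLoop, fail_pure]
    · exact bot_le
    · simp
  | succ k ih =>
    intro G hG hN
    rw [cutSparsifyLoop, lightCutSparsify]
    have hround := fail_edge_round_le hG hlo ht hδ hδ1 hN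
    rw [PMF.bind_map]
    refine (fail_bind_le hround (c := k * ENNReal.ofReal
      (4 * N ^ 2 * VC.card * Real.exp (-(δ ^ 2 * t / 24)))) fun T hT hcut => ?_).trans (le_of_eq ?_)
    · have hT' : T ⊆ edges G \ bundle t G := fun a ha => by
        simpa using subset_of_mem_support_coins hT a ha
      have hTe := edges_four_smul_restrict (hT'.trans Finset.sdiff_subset)
      have hpos := hG.nonneg hlo.le
      have h0 : ∀ S, 0 ≤ cutWeight G S := cutWeight_nonneg hpos
      have hB : ∀ S, 0 ≤ cutWeight (restrict G (bundle t G)) S :=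
        cutWeight_nonneg ((hG.restrict _).nonneg hlo.le)
      have hsplit := cutWeight_split G (bundle_subset t G)
      have hlow : (1 - δ) ^ k ≤ 1 := pow_le_one₀ (by linarith) (by linarith)
      have hlow0 : 0 ≤ (1 - δ) ^ k := pow_nonneg (by linarith) _
      have hhigh : 1 ≤ (1 + δ) ^ k := one_le_pow₀ (by linarith)
      simp only [Function.comp_apply]
      split_ifs with hr
      · rw [fail_pure]
        · exact bot_le
        intro S
        rw [cutWeight_add]
        have hc := abs_le.1 (hcut S)
        have e1 := hsplit S
        constructor
        · calc (1 - δ) ^ (k + 1) * cutWeight G S = (1 - δ) ^ k * ((1 - δ) * cutWeight G S) := by ring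
            _ ≤ 1 * ((1 - δ) * cutWeight G S) := by
                have := mul_nonneg (by linarith : 0 ≤ 1 - δ) (h0 S)
                gcongr
            _ ≤ _ := by linarith [hc.1]
        · calc cutWeight (restrict G (bundle t G)) S + cutWeight ((4 : ℝ) • restrict G T) S
              ≤ 1 * ((1 + δ) * cutWeight G S) := by linarith [hc.2]
            _ ≤ (1 + δ) ^ k * ((1 + δ) * cutWeight G S) := by
                have := mul_nonneg (by linarith : 0 ≤ 1 + δ) (h0 S)
                gcongr
            _ = _ := by ring
      · rw [fail_map]
        refine (fail_mono fun H _ hH S => ?_).trans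
          (ih ((hG.restrict T).four_smul hlo.le)
            ((Finset.card_le_card (hTe.trans_subset (hT'.trans Finset.sdiff_subset))).trans hN))
        rw [cutWeight_add]
        have hc := abs_le.1 (hcut S)
        have e1 := hsplit S
        obtain ⟨hH1, hH2⟩ := hH S
        constructor
        · have h2 := mul_le_mul_of_nonneg_right hlow (hB S)
          have h3 := mul_le_mul_of_nonneg_left
            (by linarith [hc.1] : (1 - δ) * cutWeight G S - cutWeight (restrict G (bundle t G)) S ≤
              cutWeight ((4 : ℝ) • restrict G T) S) hlow0
          calc (1 - δ) ^ (k + 1) * cutWeight G S = (1 - δ) ^ k * ((1 - δ) * cutWeight G S) := by ring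
            _ ≤ _ := by linarith
        · have h2 := mul_le_mul_of_nonneg_right hhigh (hB S)
          have h3 := mul_le_mul_of_nonneg_left
            (by linarith [hc.2] : cutWeight ((4 : ℝ) • restrict G T) S ≤
              (1 + δ) * cutWeight G S - cutWeight (restrict G (bundle t G)) S)
              (zero_le_one.trans hhigh)
          calc _ ≤ (1 + δ) ^ k * ((1 + δ) * cutWeight G S) := by linarith
            _ = _ := by ring
    · push_cast; ring

theorem log_four_mul {x : ℝ} (hx : 0 < x) : Int.log 2 (4 * x) = Int.log 2 x + 2 := by
  have h1 := Int.zpow_log_le_self (b := 2) (by norm_num) hx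
  have h2 := Int.lt_zpow_succ_log_self (b := 2) (by norm_num) x
  have e : ∀ z : ℤ, ((2 : ℕ) : ℝ) ^ (z + 2) = 4 * ((2 : ℕ) : ℝ) ^ z := fun z => by
    rw [zpow_add₀ (by norm_num)]; norm_num; ring
  apply le_antisymm
  · rw [← Int.lt_add_one_iff, ← Int.lt_zpow_iff_log_lt (by norm_num) (by linarith),
      add_right_comm, e]
    linarith
  · rw [← Int.zpow_le_iff_le_log (by norm_num) (by linarith), e]
    linarith

theorem edges_add_subset (G H : WGraph V) : edges (G + H) ⊆ edges G ∪ edges H := by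
  intro e he
  simp only [Finset.mem_union, mem_edges, Pi.add_apply] at he ⊢
  by_contra h
  push Not at h
  simp [h] at he

/-- Each round contributes a bundle of at most t (q + 1) |VC| edges, and r pays for an early stop.
The edges that are still sampled are controlled by the moment (1 + 4⁻¹ ^ k) ^ |E|: its mean after
keeping edges with probability 1/4 is at most (1 + 4⁻¹ ^ (k + 1)) ^ |E|. After the last round it is
2 ^ |E|, and 2⁻¹ ^ s * 2 ^ |E| is at least 1 if more than s edges are left. -/
theorem fail_loop_card_le {VC : Finset V} {lo r : ℝ} {t q s : ℕ} (hlo : 0 < lo) (hr : 0 ≤ r) :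
    ∀ {k : ℕ} {G : WGraph V} {z : ℤ}, IsWeightedOn VC lo G →
      (∀ e ∈ edges G, Int.log 2 (G e) ∈ Finset.Icc z (z + q)) →
      fail (cutSparsifyLoop t r k G)
        (fun H => ((edges H).card : ℝ) ≤ k * (t * (q + 1) * VC.card) + r + s) ≤
      2⁻¹ ^ s * (1 + 4⁻¹ ^ k) ^ (edges G).card := by
  intro k
  induction k with
  | zero =>
    intro G z _ _
    by_cases h : ((edges G).card : ℝ) ≤ ((0 : ℕ) : ℝ) * (t * (q + 1) * VC.card) + r + s
    · rw [cutSparsifyLoop, fail_pure (by exact h)]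
      exact bot_le
    · refine (fail_le_one _ _).trans ?_
      have hs : s ≤ (edges G).card := by
        have : (s : ℝ) ≤ (edges G).card := by
          push_cast at h
          linarith
        exact_mod_cast this
      calc (1 : ℝ≥0∞) = 2⁻¹ ^ s * 2 ^ s := by
            rw [← mul_pow, ENNReal.inv_mul_cancel (by simp) (by simp), one_pow]
        _ ≤ 2⁻¹ ^ s * 2 ^ (edges G).card := by gcongr; norm_num
        _ = _ := by norm_num
  | succ k ih =>
    intro G z hG hq
    have hb : ((bundle t G).card : ℝ) ≤ t * (q + 1) * VC.card := by
      have := card_bundle_le hG.inside t _ hq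
      rw [Int.card_Icc] at this
      have e : (z + q + 1 - z).toNat = q + 1 := by omega
      rw [e] at this
      exact_mod_cast this
    have hBe : (edges (restrict G (bundle t G))).card ≤ (bundle t G).card := by
      rw [edges_restrict]; exact Finset.card_le_card Finset.inter_subset_right
    have hb' : ((edges (restrict G (bundle t G))).card : ℝ) ≤ t * (q + 1) * VC.card :=
      le_trans (by exact_mod_cast hBe) hb
    rw [cutSparsifyLoop, lightCutSparsify, PMF.bind_map, fail_bind_eq]
    calc _ ≤ expect (coins 4 (edges G \ bundle t G).toList)
          (fun T => 2⁻¹ ^ s * (1 + 4⁻¹ ^ k) ^ T.card) := by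
          refine expect_mono fun T hT => ?_
          have hT' : T ⊆ edges G := fun a ha => by
            have := subset_of_mem_support_coins hT a ha
            simp only [Finset.mem_toList, Finset.mem_sdiff] at this
            exact this.1
          have hTe := edges_four_smul_restrict hT'
          simp only [Function.comp_apply]
          split_ifs with hr'
          · rw [fail_pure]
            · exact bot_le
            have h1 := Finset.card_le_card (edges_add_subset (restrict G (bundle t G))
              ((4 : ℝ) • restrict G T))
            have h2 := h1.trans (Finset.card_union_le _ _)
            have h3 : ((edges (restrict G (bundle t G) + (4 : ℝ) • restrict G T)).card : ℝ) ≤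
              (edges (restrict G (bundle t G))).card + (edges ((4 : ℝ) • restrict G T)).card := by
              exact_mod_cast h2
            have h4 : 0 ≤ (k : ℝ) * (t * (q + 1) * VC.card) := by positivity
            have h5 : (0 : ℝ) ≤ s := by positivity
            push_cast
            linarith
          · rw [fail_map]
            -- Multiplication by 4 shifts every class by 2, so q + 1 consecutive classes still
            -- suffice.
            have hih := ih (z := z + 2) ((hG.restrict T).four_smul hlo.le) (by
              intro e he
              rw [hTe] at he
              have h1 := hq e (hT' he)
              have h2 : 0 < G e :=
                lt_of_le_of_ne (hG.nonneg hlo.le e) (mem_edges.1 (hT' he)).symm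
              rw [Pi.smul_apply, smul_eq_mul, restrict_apply he, log_four_mul h2]
              rw [Finset.mem_Icc] at h1 ⊢
              omega)
            rw [hTe] at hih
            refine (fail_mono fun H _ hH => ?_).trans hih
            have h1 := Finset.card_le_card (edges_add_subset (restrict G (bundle t G)) H)
            have h2 := h1.trans (Finset.card_union_le _ _)
            have h3 : ((edges (restrict G (bundle t G) + H)).card : ℝ) ≤
              (edges (restrict G (bundle t G))).card + (edges H).card := by
              exact_mod_cast h2
            push_cast
            linarith
      _ ≤ 2⁻¹ ^ s * (1 + 4⁻¹ ^ k / (4 : ℕ)) ^ (edges G \ bundle t G).card := by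
          rw [expect_const_mul]
          gcongr
          exact expect_coins_pow_card_le (m := 4) _ _
      _ ≤ _ := by
          have : (4⁻¹ : ℝ≥0∞) ^ k / (4 : ℕ) = 4⁻¹ ^ (k + 1) := by
            rw [pow_succ, ENNReal.div_eq_inv_mul, mul_comm]; rfl
          rw [this]
          gcongr
          · exact le_self_add
          · exact Finset.sdiff_subset

end EdgeSampling

/-! ### Sampling of vertices -/

section IsStars

variable {V : Type*}

/-- `G` is a bipartite graph between `X` and `VC` with edge weights in `[lo, hi]`. -/
structure IsStars (VC X : Finset V) (lo hi : ℝ) (G : WGraph V) : Prop where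
  disj : ∀ x ∈ X, x ∉ VC
  supp : ∀ e, G e ≠ 0 → e.1 = none ∧ ∃ x ∈ X, ∃ v ∈ VC, e.2 = s(x, v)
  bound : ∀ e, G e ≠ 0 → lo ≤ G e ∧ G e ≤ hi

variable {VC X : Finset V} {lo hi : ℝ} {G : WGraph V}

theorem IsStars.nonneg (hG : IsStars VC X lo hi G) (hlo : 0 ≤ lo) (e : LEdge V) : 0 ≤ G e := by
  by_cases h : G e = 0
  · exact h.ge
  · exact hlo.trans (hG.bound e h).1

theorem IsStars.mono (hG : IsStars VC X lo hi G) {X' : Finset V} {lo' hi' : ℝ}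
    (hX : X ⊆ X') (hX' : ∀ x ∈ X', x ∉ VC) (hlo : lo' ≤ lo) (hhi : hi ≤ hi') :
    IsStars VC X' lo' hi' G where
  disj := hX'
  supp e he := by
    obtain ⟨h1, x, hx, h2⟩ := hG.supp e he
    exact ⟨h1, x, hX hx, h2⟩
  bound e he := ⟨hlo.trans (hG.bound e he).1, (hG.bound e he).2.trans hhi⟩

theorem IsStars.starUnion (hG : IsStars VC X lo hi G) {T : Finset V} (hT : T ⊆ X) :
    IsStars VC T lo hi (starUnion G T) where
  disj x hx := hG.disj x (hT hx)
  supp e he := by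
    by_cases h : ∃ x ∈ T, x ∈ e.2
    · rw [VertexSparsification.starUnion, if_pos h] at he
      obtain ⟨h1, x, hx, v, hv, h2⟩ := hG.supp e he
      obtain ⟨y, hy, hye⟩ := h
      rw [h2, Sym2.mem_iff] at hye
      rcases hye with rfl | rfl
      · exact ⟨h1, y, hy, v, hv, h2⟩
      · exact absurd hv (hG.disj _ (hT hy))
    · exact absurd (if_neg h) he
  bound e he := by
    by_cases h : ∃ x ∈ T, x ∈ e.2
    · rw [VertexSparsification.starUnion, if_pos h] at he ⊢
      exact hG.bound e he
    · exact absurd (if_neg h) he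

theorem IsStars.two_smul (hG : IsStars VC X lo hi G) :
    IsStars VC X (2 * lo) (2 * hi) ((2 : ℝ) • G) where
  disj := hG.disj
  supp e he := hG.supp e fun h => he (by simp [h])
  bound e he := by
    obtain ⟨h1, h2⟩ := hG.bound e fun h => he (by simp [h])
    simp only [Pi.smul_apply, smul_eq_mul]
    constructor <;> linarith

theorem IsStars.eq_zero_or (hG : IsStars VC X lo hi G) {X' : Finset V} {lo' hi' : ℝ} {H : WGraph V}
    (hH : IsStars VC X' lo' hi' H) (hd : Disjoint X X') (e : LEdge V) : G e = 0 ∨ H e = 0 := by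
  by_contra! h
  obtain ⟨-, x, hx, v, hv, h1⟩ := hG.supp e h.1
  obtain ⟨-, y, hy, w, hw, h2⟩ := hH.supp e h.2
  rcases Sym2.eq_iff.1 (h1.symm.trans h2) with ⟨rfl, -⟩ | ⟨rfl, -⟩
  · exact Finset.disjoint_left.1 hd hx hy
  · exact hG.disj _ hx hw

theorem IsStars.add (hG : IsStars VC X lo hi G) {X' : Finset V} {H : WGraph V}
    (hH : IsStars VC X' lo hi H) (hd : Disjoint X X') : IsStars VC (X ∪ X') lo hi (G + H) where
  disj x hx := (Finset.mem_union.1 hx).elim (hG.disj x) (hH.disj x)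
  supp e he := by
    rcases hG.eq_zero_or hH hd e with h | h
    · rw [Pi.add_apply, h, zero_add] at he
      exact (hH.mono Finset.subset_union_right (fun x hx => (Finset.mem_union.1 hx).elim (hG.disj x)
        (hH.disj x)) le_rfl le_rfl).supp e he
    · rw [Pi.add_apply, h, add_zero] at he
      exact (hG.mono Finset.subset_union_left (fun x hx => (Finset.mem_union.1 hx).elim (hG.disj x)
        (hH.disj x)) le_rfl le_rfl).supp e he
  bound e he := by
    rw [Pi.add_apply] at he ⊢
    rcases hG.eq_zero_or hH hd e with h | h
    · rw [h, zero_add] at he ⊢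
      exact hH.bound e he
    · rw [h, add_zero] at he ⊢
      exact hG.bound e he

end IsStars

/-! ### Contributions of single stars to terminal cuts. -/

section Stars

variable {V : Type*} [Fintype V]

/-- The contribution of the vertex `x` to the terminal cut `S`. -/
noncomputable def minStar (VC : Finset V) (G : WGraph V) (x : V) (S : Finset V) : ℝ :=
  min (weightTo G x S) (weightTo G x (VC \ S))

/-- The contribution of the vertices outside the cover to the terminal cut `S`. -/
noncomputable def outerCut (VC : Finset V) (G : WGraph V) (S : Finset V) : ℝ :=
  ∑ x ∈ Finset.univ \ VC, minStar VC G x S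

theorem terminalCut_eq (VC : Finset V) (G : WGraph V) (S : Finset V) :
    terminalCut VC G S = cutWeight (inner VC G) S + outerCut VC G S := rfl

theorem weightTo_add (G H : WGraph V) (x : V) (S : Finset V) :
    weightTo (G + H) x S = weightTo G x S + weightTo H x S := by
  simp [weightTo, Finset.sum_add_distrib]

theorem weightTo_smul (c : ℝ) (G : WGraph V) (x : V) (S : Finset V) :
    weightTo (c • G) x S = c * weightTo G x S := by
  simp only [weightTo, Finset.mul_sum, Pi.smul_apply, smul_eq_mul]

theorem weightTo_nonneg {G : WGraph V} (hG : ∀ e, 0 ≤ G e) (x : V) (S : Finset V) :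
    0 ≤ weightTo G x S :=
  Finset.sum_nonneg fun _ _ => Finset.sum_nonneg fun _ _ => hG _

theorem minStar_nonneg {G : WGraph V} (hG : ∀ e, 0 ≤ G e) (VC : Finset V) (x : V) (S : Finset V) :
    0 ≤ minStar VC G x S :=
  le_min (weightTo_nonneg hG _ _) (weightTo_nonneg hG _ _)

theorem outerCut_nonneg {G : WGraph V} (hG : ∀ e, 0 ≤ G e) (VC : Finset V) (S : Finset V) :
    0 ≤ outerCut VC G S :=
  Finset.sum_nonneg fun _ _ => minStar_nonneg hG _ _ _

theorem minStar_smul {c : ℝ} (hc : 0 ≤ c) (VC : Finset V) (G : WGraph V) (x : V) (S : Finset V) :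
    minStar VC (c • G) x S = c * minStar VC G x S := by
  rw [minStar, weightTo_smul, weightTo_smul, minStar, mul_min_of_nonneg _ _ hc]

theorem weightTo_eq_sum_neighbors (G : WGraph V) (x : V) (S : Finset V) :
    weightTo G x S = ∑ u ∈ neighbors G x ∩ S, ∑ o : Option V, G (o, s(x, u)) := by
  refine (Finset.sum_subset Finset.inter_subset_right fun u hu hn => ?_).symm
  refine Finset.sum_eq_zero fun o _ => ?_
  by_contra h
  exact hn (Finset.mem_inter.2 ⟨by simpa [neighbors] using ⟨o, h⟩, hu⟩)

theorem minStar_eq {VC : Finset V} {G : WGraph V} {x : V} (hx : neighbors G x ⊆ VC)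
    (S : Finset V) : minStar VC G x S =
      min (∑ u ∈ neighbors G x ∩ S, ∑ o : Option V, G (o, s(x, u)))
        (∑ u ∈ neighbors G x \ S, ∑ o : Option V, G (o, s(x, u))) := by
  have : neighbors G x ∩ (VC \ S) = neighbors G x \ S := by
    ext u
    simp only [Finset.mem_inter, Finset.mem_sdiff]
    exact ⟨fun h => ⟨h.1, h.2.2⟩, fun h => ⟨h.1, hx h.1, h.2⟩⟩
  rw [minStar, weightTo_eq_sum_neighbors, weightTo_eq_sum_neighbors, this]

/-- The minimum is symmetric in the two sides, so it depends only on how S partitions the neighbours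
of x. Such partitions are all that the forests determine. -/
theorem minStar_congr {VC : Finset V} {G : WGraph V} {x : V} (hx : neighbors G x ⊆ VC)
    {S S' : Finset V} (h : ∀ u ∈ neighbors G x, ∀ v ∈ neighbors G x,
      (u ∈ S ↔ v ∈ S) ↔ (u ∈ S' ↔ v ∈ S')) : minStar VC G x S = minStar VC G x S' := by
  rw [minStar_eq hx, minStar_eq hx]
  rcases (neighbors G x).eq_empty_or_nonempty with h0 | ⟨u, hu⟩
  · simp [h0]
  · by_cases huS : u ∈ S ↔ u ∈ S'
    · have h1 : neighbors G x ∩ S = neighbors G x ∩ S' := by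
        ext v
        simp only [Finset.mem_inter]
        refine and_congr_right fun hv => ?_
        have := h u hu v hv
        tauto
      have h2 : neighbors G x \ S = neighbors G x \ S' := by
        ext v
        simp only [Finset.mem_sdiff]
        refine and_congr_right fun hv => ?_
        have := h u hu v hv
        tauto
      rw [h1, h2]
    · have h1 : neighbors G x ∩ S = neighbors G x \ S' := by
        ext v
        simp only [Finset.mem_inter, Finset.mem_sdiff]
        refine and_congr_right fun hv => ?_
        have := h u hu v hv
        tauto
      have h2 : neighbors G x \ S = neighbors G x ∩ S' := by
        ext v
        simp only [Finset.mem_inter, Finset.mem_sdiff]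
        refine and_congr_right fun hv => ?_
        have := h u hu v hv
        tauto
      rw [h1, h2, min_comm]

theorem weightTo_starUnion {VC : Finset V} {X : Finset V} (hX : ∀ x ∈ X, x ∉ VC) (G : WGraph V)
    {S : Finset V} (hS : S ⊆ VC) (x : V) :
    weightTo (starUnion G X) x S = if x ∈ X then weightTo G x S else 0 := by
  have h1 : ∀ u ∈ S, (∃ y ∈ X, y ∈ s(x, u)) ↔ x ∈ X := by
    intro u hu
    simp only [Sym2.mem_iff]
    constructor
    · rintro ⟨y, hy, rfl | rfl⟩
      · exact hy
      · exact absurd (hS hu) (hX _ hy)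
    · exact fun h => ⟨x, h, Or.inl rfl⟩
  unfold weightTo
  by_cases hx : x ∈ X
  · rw [if_pos hx]
    refine Finset.sum_congr rfl fun u hu => Finset.sum_congr rfl fun o _ => ?_
    rw [starUnion, if_pos ((h1 u hu).2 hx)]
  · rw [if_neg hx]
    refine Finset.sum_eq_zero fun u hu => Finset.sum_eq_zero fun o _ => ?_
    rw [starUnion, if_neg fun h => hx ((h1 u hu).1 h)]

theorem minStar_starUnion {VC : Finset V} {X : Finset V} (hX : ∀ x ∈ X, x ∉ VC) (G : WGraph V)
    {S : Finset V} (hS : S ⊆ VC) (x : V) :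
    minStar VC (starUnion G X) x S = if x ∈ X then minStar VC G x S else 0 := by
  rw [minStar, weightTo_starUnion hX G hS, weightTo_starUnion hX G Finset.sdiff_subset]
  split_ifs
  · rfl
  · simp

theorem outerCut_starUnion {VC : Finset V} {X : Finset V} (hX : ∀ x ∈ X, x ∉ VC) (G : WGraph V)
    {S : Finset V} (hS : S ⊆ VC) :
    outerCut VC (starUnion G X) S = ∑ x ∈ X, minStar VC G x S := by
  have hsub : X ⊆ Finset.univ \ VC := fun x hx => by simpa using hX x hx
  rw [outerCut, Finset.sum_congr rfl fun x _ => minStar_starUnion hX G hS x, ← Finset.sum_filter,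
    Finset.filter_mem_eq_inter, Finset.inter_eq_right.2 hsub]

theorem outerCut_smul {c : ℝ} (hc : 0 ≤ c) (VC : Finset V) (G : WGraph V) (S : Finset V) :
    outerCut VC (c • G) S = c * outerCut VC G S := by
  simp only [outerCut, minStar_smul hc, Finset.mul_sum]

variable {VC X : Finset V} {lo hi : ℝ} {G : WGraph V}

theorem IsStars.weightTo_eq_zero (hG : IsStars VC X lo hi G) {x : V} (hx : x ∉ X) {S : Finset V}
    (hS : S ⊆ VC) : weightTo G x S = 0 := by
  refine Finset.sum_eq_zero fun u hu => Finset.sum_eq_zero fun o _ => ?_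
  by_contra h
  obtain ⟨-, y, hy, v, hv, h2⟩ := hG.supp _ h
  rcases Sym2.eq_iff.1 h2 with ⟨rfl, -⟩ | ⟨-, rfl⟩
  · exact hx hy
  · exact hG.disj _ hy (hS hu)

theorem IsStars.minStar_eq_zero (hG : IsStars VC X lo hi G) {x : V} (hx : x ∉ X) {S : Finset V}
    (hS : S ⊆ VC) : minStar VC G x S = 0 := by
  rw [minStar, hG.weightTo_eq_zero hx hS, hG.weightTo_eq_zero hx Finset.sdiff_subset, min_self]

theorem IsStars.outerCut_eq (hG : IsStars VC X lo hi G) {S : Finset V} (hS : S ⊆ VC) :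
    outerCut VC G S = ∑ x ∈ X, minStar VC G x S := by
  refine (Finset.sum_subset (fun x hx => by simpa using hG.disj x hx) fun x _ hx => ?_).symm
  exact hG.minStar_eq_zero hx hS

theorem IsStars.outerCut_add (hG : IsStars VC X lo hi G) {X' : Finset V} {lo' hi' : ℝ}
    {H : WGraph V} (hH : IsStars VC X' lo' hi' H) (hd : Disjoint X X') {S : Finset V}
    (hS : S ⊆ VC) : outerCut VC (G + H) S = outerCut VC G S + outerCut VC H S := by
  rw [outerCut, outerCut, outerCut, ← Finset.sum_add_distrib]
  refine Finset.sum_congr rfl fun x _ => ?_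
  by_cases hx : x ∈ X
  · have hx' := Finset.disjoint_left.1 hd hx
    rw [hH.minStar_eq_zero hx' hS, add_zero, minStar, weightTo_add, weightTo_add,
      hH.weightTo_eq_zero hx' hS, hH.weightTo_eq_zero hx' Finset.sdiff_subset, add_zero, add_zero]
    rfl
  · rw [hG.minStar_eq_zero hx hS, zero_add, minStar, weightTo_add, weightTo_add,
      hG.weightTo_eq_zero hx hS, hG.weightTo_eq_zero hx Finset.sdiff_subset, zero_add, zero_add]
    rfl

theorem IsStars.neighbors_subset (hG : IsStars VC X lo hi G) {x : V} (hx : x ∈ X) :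
    neighbors G x ⊆ VC := by
  intro u hu
  obtain ⟨o, ho⟩ : ∃ o, G (o, s(x, u)) ≠ 0 := by simpa [neighbors] using hu
  obtain ⟨-, y, hy, v, hv, h2⟩ := hG.supp _ ho
  rcases Sym2.eq_iff.1 h2 with ⟨-, rfl⟩ | ⟨rfl, -⟩
  · exact hv
  · exact absurd hv (hG.disj _ hx)

theorem IsStars.sum_option (hG : IsStars VC X lo hi G) (p : Sym2 V) :
    ∑ o : Option V, G (o, p) = G (none, p) := by
  refine Finset.sum_eq_single _ (fun o _ ho => ?_) (by simp)
  by_contra h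
  exact ho (hG.supp _ h).1

theorem IsStars.neighbor_ne_zero (hG : IsStars VC X lo hi G) {x u : V} (hu : u ∈ neighbors G x) :
    G (none, s(x, u)) ≠ 0 := by
  obtain ⟨o, ho⟩ : ∃ o, G (o, s(x, u)) ≠ 0 := by simpa [neighbors] using hu
  have : o = none := (hG.supp _ ho).1
  rwa [this] at ho

theorem IsStars.minStar_le (hG : IsStars VC X lo hi G) (hhi : 0 ≤ hi) {d : ℕ} {x : V} (hx : x ∈ X)
    (hd : (neighbors G x).card ≤ d) (S : Finset V) : minStar VC G x S ≤ d * hi := by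
  rw [minStar_eq (hG.neighbors_subset hx)]
  refine (min_le_left _ _).trans ?_
  calc ∑ u ∈ neighbors G x ∩ S, ∑ o : Option V, G (o, s(x, u))
      ≤ ∑ u ∈ neighbors G x ∩ S, hi := by
        refine Finset.sum_le_sum fun u hu => ?_
        rw [hG.sum_option]
        exact (hG.bound _ (hG.neighbor_ne_zero (Finset.mem_inter.1 hu).1)).2
    _ = (neighbors G x ∩ S).card * hi := by rw [Finset.sum_const, nsmul_eq_mul]
    _ ≤ d * hi := by
        gcongr
        exact (Finset.card_le_card Finset.inter_subset_left).trans hd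

/-- Each side then contains an edge at x of weight at least lo. This is why the low edges had to be
removed from the buckets. -/
theorem IsStars.le_minStar (hG : IsStars VC X lo hi G) (hlo : 0 ≤ lo) {x : V} (hx : x ∈ X)
    {S : Finset V} {u v : V} (hu : u ∈ neighbors G x) (hv : v ∈ neighbors G x)
    (h : ¬ (u ∈ S ↔ v ∈ S)) : lo ≤ minStar VC G x S := by
  have hpos := hG.nonneg hlo
  have aux : ∀ (A : Finset V) (w : V), w ∈ neighbors G x → w ∈ A →
      lo ≤ ∑ u ∈ A, ∑ o : Option V, G (o, s(x, u)) := by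
    intro A w hw hwA
    refine le_trans ?_ (Finset.single_le_sum (f := fun u => ∑ o : Option V, G (o, s(x, u)))
      (fun _ _ => Finset.sum_nonneg fun _ _ => hpos _) hwA)
    rw [hG.sum_option]
    exact (hG.bound _ (hG.neighbor_ne_zero hw)).1
  rw [minStar_eq (hG.neighbors_subset hx)]
  by_cases huS : u ∈ S
  · have hvS : v ∉ S := fun hvS => h (by tauto)
    exact le_min (aux _ u hu (by simp [hu, huS])) (aux _ v hv (by simp [hv, hvS]))
  · have hvS : v ∈ S := by tauto
    exact le_min (aux _ v hv (by simp [hv, hvS])) (aux _ u hu (by simp [hu, huS]))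

theorem exists_cut_of_minStar_ne_zero {x : V} (hx : neighbors G x ⊆ VC) {S : Finset V}
    (h : minStar VC G x S ≠ 0) (hG : ∀ e, 0 ≤ G e) :
    ∃ u ∈ neighbors G x, ∃ v ∈ neighbors G x, u ≠ v ∧ ¬ (u ∈ S ↔ v ∈ S) := by
  have hpos := lt_of_le_of_ne (minStar_nonneg hG VC x S) h.symm
  rw [minStar_eq hx, lt_min_iff] at hpos
  have h1 : (neighbors G x ∩ S).Nonempty := by
    by_contra h0
    rw [Finset.not_nonempty_iff_eq_empty.1 h0] at hpos
    simp at hpos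
  have h2 : (neighbors G x \ S).Nonempty := by
    by_contra h0
    rw [Finset.not_nonempty_iff_eq_empty.1 h0] at hpos
    simp at hpos
  obtain ⟨u, hu⟩ := h1
  obtain ⟨v, hv⟩ := h2
  rw [Finset.mem_inter] at hu
  rw [Finset.mem_sdiff] at hv
  refine ⟨u, hu.1, v, hv.1, ?_, by tauto⟩
  rintro rfl
  exact hv.2 hu.2

end Stars

/-! ### Terminal cuts and sizes under repeated vertex sampling. -/

section VertexRounds

variable {V : Type*} [Fintype V] {VC X : Finset V} {lo hi : ℝ} {G : WGraph V}

theorem mem_cliqueEdges {e : LEdge V} : e ∈ (cliqueEdges G X).toList ↔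
    ∃ x ∈ X, ∃ u ∈ neighbors G x, ∃ v ∈ neighbors G x, u ≠ v ∧ e = (some x, s(u, v)) := by
  simp [cliqueEdges]

theorem inside_of_mem_cliqueEdges (hG : IsStars VC X lo hi G) :
    ∀ e ∈ (cliqueEdges G X).toList, Inside VC e.2 := by
  intro e he
  obtain ⟨x, hx, u, hu, v, hv, -, rfl⟩ := mem_cliqueEdges.1 he
  exact inside_mk.2 ⟨hG.neighbors_subset hx hu, hG.neighbors_subset hx hv⟩

theorem reachable_of_not_light {t i : ℕ} (hi : i < t) {x u v : V}
    (hx : x ∈ X \ lightVertices t G X) (hu : u ∈ neighbors G x) (hv : v ∈ neighbors G x) :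
    (forestGraph (cliqueForest i (cliqueEdges G X).toList)).Reachable u v := by
  by_cases huv : u = v
  · rw [huv]
  obtain ⟨hxX, hxl⟩ := Finset.mem_sdiff.1 hx
  have hO : some x ∉ forestOrigins t (cliqueEdges G X).toList := fun h =>
    hxl (Finset.mem_filter.2 ⟨hxX, h⟩)
  exact not_canAdd_iff.1 (not_canAdd_cliqueForest hi
    (mem_cliqueEdges.2 ⟨x, hxX, u, hu, v, hv, huv, rfl⟩) hO)

/-- Every forest edge that crosses a cut witnesses its own light vertex that is cut. -/
theorem sum_crossing_le_card (hG : IsStars VC X lo hi G) (hlo : 0 ≤ lo) (t : ℕ) (S : Finset V) :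
    ∑ i ∈ Finset.range t, (crossing (cliqueForest i (cliqueEdges G X).toList) S).card ≤
      ((lightVertices t G X).filter fun x => lo ≤ minStar VC G x S).card := by
  have hdisj : ∀ i ∈ Finset.range t, ∀ j ∈ Finset.range t, i ≠ j →
      Disjoint (crossing (cliqueForest i (cliqueEdges G X).toList) S)
        (crossing (cliqueForest j (cliqueEdges G X).toList) S) := by
    intro i _ j _ hij
    refine Finset.disjoint_left.2 fun e he he' => hij ?_
    exact (cliqueForest_injOn (mem_crossing.1 he).1 (mem_crossing.1 he').1 rfl).1
  rw [← Finset.card_biUnion hdisj]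
  refine (Finset.card_le_card_of_injOn (t := ((lightVertices t G X).filter
    fun x => lo ≤ minStar VC G x S).image some) Prod.fst ?_ ?_).trans Finset.card_image_le
  · intro e he
    obtain ⟨i, hi, he⟩ := Finset.mem_biUnion.1 he
    obtain ⟨he, hc⟩ := mem_crossing.1 he
    obtain ⟨x, hx, u, hu, v, hv, -, rfl⟩ := mem_cliqueEdges.1 (mem_of_mem_cliqueForest he)
    refine Finset.mem_image_of_mem _ (Finset.mem_filter.2 ⟨Finset.mem_filter.2 ⟨hx, ?_⟩, ?_⟩)
    · exact mem_forestOrigins.2 ⟨i, Finset.mem_range.1 hi, _, he, rfl⟩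
    · exact hG.le_minStar hlo hx hu hv (crosses_mk.1 hc)
  · intro e he f hf hef
    obtain ⟨i, hi, he⟩ := Finset.mem_biUnion.1 he
    obtain ⟨j, hj, hf⟩ := Finset.mem_biUnion.1 hf
    exact (cliqueForest_injOn (mem_crossing.1 he).1 (mem_crossing.1 hf).1 hef).2

theorem sum_crossing_le (hG : IsStars VC X lo hi G) (hlo : 0 ≤ lo) (t : ℕ) (S : Finset V) :
    lo * ∑ i ∈ Finset.range t, ((crossing (cliqueForest i (cliqueEdges G X).toList) S).card : ℝ) ≤
      ∑ x ∈ lightVertices t G X, minStar VC G x S := by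
  have h1 : ∑ i ∈ Finset.range t, ((crossing (cliqueForest i (cliqueEdges G X).toList) S).card : ℝ) ≤
      ((lightVertices t G X).filter fun x => lo ≤ minStar VC G x S).card := by
    exact_mod_cast sum_crossing_le_card hG hlo t S
  calc _ ≤ lo * ((lightVertices t G X).filter fun x => lo ≤ minStar VC G x S).card := by gcongr
    _ = ∑ x ∈ (lightVertices t G X).filter fun x => lo ≤ minStar VC G x S, lo := by
        rw [Finset.sum_const, nsmul_eq_mul, mul_comm]
    _ ≤ ∑ x ∈ (lightVertices t G X).filter fun x => lo ≤ minStar VC G x S, minStar VC G x S :=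
        Finset.sum_le_sum fun x hx => (Finset.mem_filter.1 hx).2
    _ ≤ _ := Finset.sum_le_sum_of_subset_of_nonneg (Finset.filter_subset _ _) fun x _ _ =>
        minStar_nonneg (hG.nonneg hlo) _ _ _

theorem crossing_cliqueForest_nonempty (hG : IsStars VC X lo hi G) (hlo : 0 ≤ lo) {t i : ℕ}
    (hit : i < t) {x : V} (hx : x ∈ X \ lightVertices t G X) {S : Finset V}
    (h : minStar VC G x S ≠ 0) :
    (crossing (cliqueForest i (cliqueEdges G X).toList) S).Nonempty := by
  obtain ⟨u, hu, v, hv, -, huv⟩ := exists_cut_of_minStar_ne_zero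
    (hG.neighbors_subset (Finset.mem_sdiff.1 hx).1) h (hG.nonneg hlo)
  exact crossing_nonempty (reachable_of_not_light hit hx hu hv) huv

theorem outerCut_sample {T : Finset V} (hT : ∀ x ∈ T, x ∉ VC) {S : Finset V} (hS : S ⊆ VC) :
    outerCut VC ((2 : ℝ) • starUnion G T) S = ∑ x ∈ T, 2 * minStar VC G x S := by
  rw [outerCut_smul (by norm_num), outerCut_starUnion hT G hS, Finset.mul_sum]

/-- One round of vertex sampling preserves all terminal cuts. -/
theorem fail_vertex_round_le (hG : IsStars VC X lo hi G) (hlo : 0 < lo) (hlh : lo ≤ hi)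
    {t d N : ℕ} {δ κ : ℝ} (ht : 0 < t) (hd : 0 < d) (hdeg : ∀ x ∈ X, (neighbors G x).card ≤ d)
    (hδ : 0 ≤ δ) (hδ1 : δ ≤ 1) (hN : X.card ≤ N) (hκ : κ ≤ δ ^ 2 * (t * lo) / (4 * (d * hi))) :
    fail (coins 2 (X \ lightVertices t G X).toList) (fun T => ∀ S ⊆ VC,
      |outerCut VC ((2 : ℝ) • starUnion G T) S -
        outerCut VC (starUnion G (X \ lightVertices t G X)) S| ≤ δ * outerCut VC G S) ≤
      ENNReal.ofReal (4 * N * VC.card * Real.exp (-κ)) := by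
  set Y := X \ lightVertices t G X with hY
  have hYX : Y ⊆ X := Finset.sdiff_subset
  have hpos := hG.nonneg hlo.le
  have hhi : 0 < hi := hlo.trans_le hlh
  have hrw : ∀ T ⊆ Y, ∀ S ⊆ VC, outerCut VC ((2 : ℝ) • starUnion G T) S -
      outerCut VC (starUnion G Y) S =
      ∑ y ∈ Y, ((if y ∈ T then (2 : ℝ) else 0) - 1) * minStar VC G y S := by
    intro T hT S hS
    rw [outerCut_sample (fun x hx => hG.disj x (hYX (hT hx))) hS,
      outerCut_starUnion (fun x hx => hG.disj x (hYX hx)) G hS]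
    simp only [sub_mul, one_mul, Finset.sum_sub_distrib, ite_mul, zero_mul]
    rw [← Finset.sum_filter, Finset.filter_mem_eq_inter, Finset.inter_eq_right.2 hT]
  have hsplit : ∀ S ⊆ VC, outerCut VC G S = ∑ y ∈ Y, minStar VC G y S +
      ∑ x ∈ lightVertices t G X, minStar VC G x S := by
    intro S hS
    rw [hG.outerCut_eq hS, hY, Finset.sum_sdiff (lightVertices_subset t G X)]
  -- If t > N, no sampled vertex is ever cut: it would force a crossing edge in each of the t
  -- forests and hence t distinct light vertices. So the factor t in the union bound may be replaced
  -- by N.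
  by_cases htN : t ≤ N
  swap
  · rw [fail_eq_zero]
    · exact bot_le
    intro T hT S hS
    have hT' : T ⊆ Y := fun a ha => by simpa using subset_of_mem_support_coins hT a ha
    rw [hrw T hT' S hS, Finset.sum_eq_zero, abs_zero]
    · exact mul_nonneg hδ (outerCut_nonneg hpos _ _)
    intro y hy
    by_contra h
    refine htN ?_
    calc t = ∑ i ∈ Finset.range t, 1 := by simp
      _ ≤ ∑ i ∈ Finset.range t, (crossing (cliqueForest i (cliqueEdges G X).toList) S).card :=
          Finset.sum_le_sum fun i hi => Finset.card_pos.2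
            (crossing_cliqueForest_nonempty hG hlo.le (Finset.mem_range.1 hi) hy
              (right_ne_zero_of_mul h))
      _ ≤ _ := sum_crossing_le_card hG hlo.le t S
      _ ≤ X.card := Finset.card_le_card
          ((Finset.filter_subset _ _).trans (lightVertices_subset t G X))
      _ ≤ N := hN
  -- A star contributes at most d * hi and a light vertex that is cut pays at least lo, so t has to
  -- beat the ratio of the two.
  have key := fail_projection_le (m := 2) le_rfl Y (fun y S => minStar VC G y S)
    (fun i => cliqueForest i (cliqueEdges G X).toList)
    (fun i S => crossing (cliqueForest i (cliqueEdges G X).toList) S) (M := d * hi)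
    (N := VC.card) (u := lo) (κ := κ) ht (by positivity) hlo.le hδ hδ1 ?_ ?_ ?_ ?_ ?_ ?_
  · refine (fail_mono fun T hT hall S hS => ?_).trans (key.trans (ENNReal.ofReal_le_ofReal ?_))
    · have hT' : T ⊆ Y := fun a ha => by simpa using subset_of_mem_support_coins hT a ha
      rw [hrw T hT' S hS, hsplit S hS]
      have h1 := hall S
      simp only [Nat.cast_ofNat] at h1
      refine h1.trans ?_
      have := sum_crossing_le hG hlo.le t S
      gcongr
    · gcongr
  · intro y hy S
    exact ⟨minStar_nonneg hpos _ _ _, hG.minStar_le hhi.le (hYX hy) (hdeg y (hYX hy)) S⟩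
  · exact fun i _ S => Finset.filter_subset _ _
  · exact fun i _ => card_cliqueForest_le (inside_of_mem_cliqueEdges hG) i
  · intro y hy i hi S S' h
    refine minStar_congr (hG.neighbors_subset (hYX hy)) fun u hu v hv => ?_
    exact same_side_iff h (reachable_of_not_light hi hy hu hv)
  · exact fun y hy i hi S h => crossing_cliqueForest_nonempty hG hlo.le hi hy h
  · refine hκ.trans (le_of_eq ?_)
    push_cast
    ring

theorem neighbors_sample_subset (T : Finset V) (x : V) :
    neighbors ((2 : ℝ) • starUnion G T) x ⊆ neighbors G x := by
  intro u hu
  obtain ⟨o, ho⟩ := (Finset.mem_filter.1 hu).2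
  refine Finset.mem_filter.2 ⟨Finset.mem_univ _, o, fun h => ho ?_⟩
  simp [starUnion, h]

theorem isStars_of_mem_support {t : ℕ} : ∀ {l : ℕ} {G : WGraph V} {X : Finset V} {lo hi : ℝ},
    0 ≤ lo → 0 ≤ hi → IsStars VC X lo hi G → ∀ H ∈ (boundedVertexSparsify t l G X).support,
      IsStars VC X lo (2 ^ l * hi) H := by
  intro l
  induction l with
  | zero =>
    intro G X lo hi _ _ hG H hH
    simp only [boundedVertexSparsify, PMF.mem_support_pure_iff] at hH
    simpa [hH] using hG
  | succ l ih =>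
    intro G X lo hi hlo hhi hG H hH
    simp only [boundedVertexSparsify, sample, PMF.mem_support_bind_iff, PMF.support_map,
      Set.mem_image] at hH
    obtain ⟨GX, ⟨T, hT, rfl⟩, H', hH', rfl⟩ := hH
    have hT' : T ⊆ X \ lightVertices t G X := fun a ha => by
      simpa using subset_of_mem_support_coins hT a ha
    have h1 := (hG.starUnion (hT'.trans Finset.sdiff_subset)).two_smul
    have h2 := ih (by linarith) (by linarith) h1 H' hH'
    have hl := lightVertices_subset t G X
    have h3 : IsStars VC T lo (2 ^ (l + 1) * hi) H' :=
      h2.mono subset_rfl h2.disj (by linarith) (by rw [pow_succ]; linarith)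
    have h4 : IsStars VC (lightVertices t G X) lo (2 ^ (l + 1) * hi)
        (starUnion G (lightVertices t G X)) :=
      (hG.starUnion hl).mono subset_rfl (fun x hx => hG.disj x (hl hx)) le_rfl
        (le_mul_of_one_le_left hhi (one_le_pow₀ (by norm_num)))
    refine (h4.add h3 (Finset.disjoint_of_subset_right hT' Finset.disjoint_sdiff)).mono
      (Finset.union_subset hl (hT'.trans Finset.sdiff_subset)) hG.disj le_rfl le_rfl

/-- The errors multiply as for edges. A round doubles both lo and hi, so only their ratio matters
and the same κ works in all rounds. -/
theorem fail_vertex_cut_le {t d N : ℕ} {δ κ : ℝ} (ht : 0 < t) (hd : 0 < d) (hδ : 0 ≤ δ)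
    (hδ1 : δ ≤ 1) : ∀ {l : ℕ} {G : WGraph V} {X : Finset V} {lo hi : ℝ}, 0 < lo → lo ≤ hi →
      IsStars VC X lo hi G → (∀ x ∈ X, (neighbors G x).card ≤ d) → X.card ≤ N →
      κ ≤ δ ^ 2 * (t * lo) / (4 * (d * hi)) →
      fail (boundedVertexSparsify t l G X) (fun H => ∀ S ⊆ VC,
        (1 - δ) ^ l * outerCut VC G S ≤ outerCut VC H S ∧
          outerCut VC H S ≤ (1 + δ) ^ l * outerCut VC G S) ≤
      l * ENNReal.ofReal (4 * N * VC.card * Real.exp (-κ)) := by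
  intro l
  induction l with
  | zero =>
    intro G X lo hi _ _ _ _ _ _
    rw [boundedVertexSparsify, fail_pure]
    · exact bot_le
    · simp
  | succ l ih =>
    intro G X lo hi hlo hlh hG hdeg hN hκ
    rw [boundedVertexSparsify, sample, PMF.bind_map]
    refine (fail_bind_le (fail_vertex_round_le hG hlo hlh ht hd hdeg hδ hδ1 hN hκ)
      (c := l * ENNReal.ofReal (4 * N * VC.card * Real.exp (-κ))) fun T hT hcut => ?_).trans
      (le_of_eq (by push_cast; ring))
    have hT' : T ⊆ X \ lightVertices t G X := fun a ha => by
      simpa using subset_of_mem_support_coins hT a ha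
    have hTX : T ⊆ X := hT'.trans Finset.sdiff_subset
    have hl := lightVertices_subset t G X
    have h1 := (hG.starUnion hTX).two_smul
    have h4 := hG.starUnion hl
    simp only [Function.comp_apply]
    rw [fail_map]
    have hih := ih (G := (2 : ℝ) • starUnion G T) (X := T) (by linarith : 0 < 2 * lo)
      (by linarith : 2 * lo ≤ 2 * hi) h1
      (fun x hx => (Finset.card_le_card (neighbors_sample_subset T x)).trans (hdeg x (hTX hx)))
      ((Finset.card_le_card hTX).trans hN) (hκ.trans (le_of_eq (by
        have hhi := hlo.trans_le hlh
        field_simp)))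
    refine (fail_mono fun H hH hHc S hS => ?_).trans hih
    have hHs := isStars_of_mem_support (by linarith) (by linarith) h1 H hH
    rw [h4.outerCut_add hHs (Finset.disjoint_of_subset_right hT' Finset.disjoint_sdiff) hS]
    have hsplit : outerCut VC (starUnion G (lightVertices t G X)) S +
        outerCut VC (starUnion G (X \ lightVertices t G X)) S = outerCut VC G S := by
      rw [outerCut_starUnion (fun x hx => hG.disj x (hl hx)) G hS,
        outerCut_starUnion (fun x hx => hG.disj x (Finset.sdiff_subset hx)) G hS,
        hG.outerCut_eq hS, add_comm, Finset.sum_sdiff hl]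
    have hB : 0 ≤ outerCut VC (starUnion G (lightVertices t G X)) S :=
      outerCut_nonneg (h4.nonneg hlo.le) _ _
    have hlow : (1 - δ) ^ l ≤ 1 := pow_le_one₀ (by linarith) (by linarith)
    have hlow0 : 0 ≤ (1 - δ) ^ l := pow_nonneg (by linarith) _
    have hhigh : 1 ≤ (1 + δ) ^ l := one_le_pow₀ (by linarith)
    have hc := abs_le.1 (hcut S hS)
    obtain ⟨hH1, hH2⟩ := hHc S hS
    constructor
    · have h2 := mul_le_mul_of_nonneg_right hlow hB
      have h3 := mul_le_mul_of_nonneg_left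
        (by linarith [hc.1] : (1 - δ) * outerCut VC G S -
          outerCut VC (starUnion G (lightVertices t G X)) S ≤
          outerCut VC ((2 : ℝ) • starUnion G T) S) hlow0
      calc (1 - δ) ^ (l + 1) * outerCut VC G S = (1 - δ) ^ l * ((1 - δ) * outerCut VC G S) := by ring
        _ ≤ _ := by linarith
    · have h2 := mul_le_mul_of_nonneg_right hhigh hB
      have h3 := mul_le_mul_of_nonneg_left
        (by linarith [hc.2] : outerCut VC ((2 : ℝ) • starUnion G T) S ≤
          (1 + δ) * outerCut VC G S - outerCut VC (starUnion G (lightVertices t G X)) S)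
          (zero_le_one.trans hhigh)
      calc _ ≤ (1 + δ) ^ l * ((1 + δ) * outerCut VC G S) := by linarith
        _ = _ := by ring

theorem IsStars.outerVerts_subset (hG : IsStars VC X lo hi G) : outerVerts VC G ⊆ X := by
  intro x hx
  simp only [outerVerts, Finset.mem_filter, Finset.mem_univ, true_and, mem_edges] at hx
  obtain ⟨hxV, e, he, hxe⟩ := hx
  obtain ⟨-, y, hy, v, hv, h2⟩ := hG.supp e he
  rw [h2, Sym2.mem_iff] at hxe
  rcases hxe with rfl | rfl
  · exact hy
  · exact absurd hv hxV

theorem outerVerts_add_subset (VC : Finset V) (G H : WGraph V) :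
    outerVerts VC (G + H) ⊆ outerVerts VC G ∪ outerVerts VC H := by
  intro x hx
  simp only [outerVerts, Finset.mem_union, Finset.mem_filter, Finset.mem_univ, true_and] at hx ⊢
  obtain ⟨hxV, e, he, hxe⟩ := hx
  rcases Finset.mem_union.1 (edges_add_subset G H he) with h | h
  · exact Or.inl ⟨hxV, e, h, hxe⟩
  · exact Or.inr ⟨hxV, e, h, hxe⟩

/-- The same induction on exponential moments as for edges, with probability 1/2 and at most t |VC|
light vertices in each round. -/
theorem fail_vertex_card_le {t s : ℕ} : ∀ {l : ℕ} {G : WGraph V} {X : Finset V} {lo hi : ℝ},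
      IsStars VC X lo hi G →
      fail (boundedVertexSparsify t l G X)
        (fun H => (outerVerts VC H).card ≤ l * (t * VC.card) + s) ≤
      2⁻¹ ^ s * (1 + 2⁻¹ ^ l) ^ X.card := by
  intro l
  induction l with
  | zero =>
    intro G X lo hi hG
    by_cases h : (outerVerts VC G).card ≤ 0 * (t * VC.card) + s
    · rw [boundedVertexSparsify, fail_pure (by exact h)]
      exact bot_le
    · refine (fail_le_one _ _).trans ?_
      have hs : s ≤ X.card := by
        have := Finset.card_le_card hG.outerVerts_subset
        omega
      calc (1 : ℝ≥0∞) = 2⁻¹ ^ s * 2 ^ s := by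
            rw [← mul_pow, ENNReal.inv_mul_cancel (by simp) (by simp), one_pow]
        _ ≤ 2⁻¹ ^ s * 2 ^ X.card := by gcongr; norm_num
        _ = _ := by norm_num
  | succ l ih =>
    intro G X lo hi hG
    have hl := lightVertices_subset t G X
    have hlc : (outerVerts VC (starUnion G (lightVertices t G X))).card ≤ t * VC.card :=
      (Finset.card_le_card (hG.starUnion hl).outerVerts_subset).trans
        (card_lightVertices_le fun x hx => hG.neighbors_subset hx)
    rw [boundedVertexSparsify, sample, PMF.bind_map, fail_bind_eq]
    calc _ ≤ expect (coins 2 (X \ lightVertices t G X).toList)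
          (fun T => 2⁻¹ ^ s * (1 + 2⁻¹ ^ l) ^ T.card) := by
          refine expect_mono fun T hT => ?_
          have hT' : T ⊆ X := fun a ha => by
            have := subset_of_mem_support_coins hT a ha
            simp only [Finset.mem_toList, Finset.mem_sdiff] at this
            exact this.1
          simp only [Function.comp_apply]
          rw [fail_map]
          refine (fail_mono fun H _ hH => ?_).trans (ih (hG.starUnion hT').two_smul)
          have h1 := Finset.card_le_card (outerVerts_add_subset VC
            (starUnion G (lightVertices t G X)) H)
          have h2 := h1.trans (Finset.card_union_le _ _)
          rw [Nat.succ_mul]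
          omega
      _ ≤ 2⁻¹ ^ s * (1 + 2⁻¹ ^ l / (2 : ℕ)) ^ (X \ lightVertices t G X).card := by
          rw [expect_const_mul]
          gcongr
          exact expect_coins_pow_card_le (m := 2) _ _
      _ ≤ _ := by
          have : (2⁻¹ : ℝ≥0∞) ^ l / (2 : ℕ) = 2⁻¹ ^ (l + 1) := by
            rw [pow_succ, ENNReal.div_eq_inv_mul, mul_comm]; rfl
          rw [this]
          gcongr
          · exact le_self_add
          · exact Finset.sdiff_subset

end VertexRounds

/-! ### Analysis of the bucketing -/

section Bucketing

variable {V : Type*} [Fintype V]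

/-- The assumptions on the input graph: `VC` is a vertex cover, the other vertices have degree at
most `d`, and the edge weights lie in `[γ, M]`. -/
structure Admissible (G : SimpleGraph V) (w : Sym2 V → ℝ) (VC : Finset V) (d : ℕ) (γ M : ℝ) :
    Prop where
  cover : G.IsVertexCover (VC : Set V)
  deg : ∀ x ∉ VC, (nbrs G x).card ≤ d
  pos : 0 < γ
  bound : ∀ e ∈ G.edgeSet, γ ≤ w e ∧ w e ≤ M

variable {G : SimpleGraph V} {w : Sym2 V → ℝ} {VC : Finset V} {d : ℕ} {γ M η : ℝ}

theorem mem_nbrs {x v : V} : v ∈ nbrs G x ↔ G.Adj x v := by simp [nbrs]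

theorem top_mem {x : V} (h : (nbrs G x).Nonempty) : top G w x ∈ nbrs G x := by
  rw [top, dif_pos h]
  exact (Classical.choose_spec
    (Finset.exists_max_image (nbrs G x) (fun v => w s(x, v)) h)).1

theorem le_top {x v : V} (h : v ∈ nbrs G x) : w s(x, v) ≤ w s(x, top G w x) := by
  have hne : (nbrs G x).Nonempty := ⟨v, h⟩
  rw [top, dif_pos hne]
  exact (Classical.choose_spec
    (Finset.exists_max_image (nbrs G x) (fun v => w s(x, v)) hne)).2 v h

theorem lowNbrs_subset (x : V) : lowNbrs G w d η x ⊆ nbrs G x := Finset.filter_subset _ _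

/-- The end v is determined by the edge s(top, v), so the sum in the definition has at most one
nonzero term. -/
theorem hatCore_some (x : V) (p : Sym2 V) :
    hatCore G w VC d η (some x, p) = 0 ∨ ∃ v ∈ lowNbrs G w d η x, x ∉ VC ∧ p = s(top G w x, v) ∧
      hatCore G w VC d η (some x, p) = w s(x, v) := by
  by_cases hx : x ∈ VC
  · left; simp [hatCore, hx]
  by_cases hp : ∃ v ∈ lowNbrs G w d η x, p = s(top G w x, v)
  · right
    obtain ⟨v, hv, rfl⟩ := hp
    refine ⟨v, hv, hx, rfl, ?_⟩
    simp only [hatCore, if_neg hx]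
    rw [Finset.sum_eq_single v, if_pos rfl]
    · intro u _ huv
      rw [if_neg]
      intro h
      exact huv (Sym2.congr_right.1 h).symm
    · exact fun h => absurd hv h
  · left
    simp only [hatCore, if_neg hx]
    refine Finset.sum_eq_zero fun v hv => if_neg fun h => hp ⟨v, hv, h⟩

theorem hatBucket_apply {i : ℕ} {x u : V} (hx : x ∈ bucketVerts G w VC γ i) (hu : u ∈ VC) :
    hatBucket G w VC d η γ i (none, s(x, u)) =
      if u ∈ nbrs G x \ lowNbrs G w d η x then w s(x, u) else 0 := by
  rw [hatBucket]
  refine if_congr ?_ rfl rfl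
  constructor
  · rintro ⟨-, y, hy, v, hv, h⟩
    rcases Sym2.eq_iff.1 h with ⟨rfl, rfl⟩ | ⟨rfl, rfl⟩
    · exact hv
    · exact absurd hu (Finset.mem_filter.1 hy).2.1
  · exact fun h => ⟨rfl, x, hx, u, h, rfl⟩

namespace Admissible

theorem nbrs_subset (hA : Admissible G w VC d γ M) {x : V} (hx : x ∉ VC) : nbrs G x ⊆ VC := by
  intro v hv
  rcases hA.cover (mem_nbrs.1 hv) with h | h
  · exact absurd h hx
  · exact h

theorem weight_bound (hA : Admissible G w VC d γ M)
    {x v : V} (h : v ∈ nbrs G x) : γ ≤ w s(x, v) ∧ w s(x, v) ≤ M :=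
  hA.bound _ ((SimpleGraph.mem_edgeSet G).2 (mem_nbrs.1 h))

theorem d_pos (hA : Admissible G w VC d γ M)
    {x : V} (hx : x ∉ VC) (h : (nbrs G x).Nonempty) : 0 < d :=
  (Finset.card_pos.2 h).trans_le (hA.deg x hx)

theorem top_notMem_lowNbrs (hA : Admissible G w VC d γ M) (hη1 : η ≤ 1) {x : V} (hx : x ∉ VC)
    (h : (nbrs G x).Nonempty) : top G w x ∉ lowNbrs G w d η x := by
  intro hl
  have h1 := (Finset.mem_filter.1 hl).2
  have h2 := hA.weight_bound (top_mem (w := w) h)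
  have h3 : (1 : ℝ) ≤ d := by exact_mod_cast hA.d_pos hx h
  have h4 : η / d ≤ 1 := (div_le_one (by linarith)).2 (hη1.trans h3)
  have := hA.pos
  nlinarith

theorem sum_lowNbrs_le (hA : Admissible G w VC d γ M)
    (hη : 0 ≤ η) {x : V} (hx : x ∉ VC) (h : (nbrs G x).Nonempty) :
    ∑ v ∈ lowNbrs G w d η x, w s(x, v) ≤ η * w s(x, top G w x) := by
  have h0 := hA.pos.trans_le (hA.weight_bound (top_mem (w := w) h)).1
  have h3 : (0 : ℝ) < d := by exact_mod_cast hA.d_pos hx h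
  calc ∑ v ∈ lowNbrs G w d η x, w s(x, v)
      ≤ ∑ v ∈ lowNbrs G w d η x, η / d * w s(x, top G w x) :=
        Finset.sum_le_sum fun v hv => (Finset.mem_filter.1 hv).2.le
    _ = (lowNbrs G w d η x).card * (η / d * w s(x, top G w x)) := by
        rw [Finset.sum_const, nsmul_eq_mul]
    _ ≤ d * (η / d * w s(x, top G w x)) := by
        have : ((lowNbrs G w d η x).card : ℝ) ≤ d := by
          exact_mod_cast (Finset.card_le_card (lowNbrs_subset x)).trans (hA.deg x hx)
        gcongr
    _ = _ := by field_simp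

theorem hatCore_cases (hA : Admissible G w VC d γ M) (hη1 : η ≤ 1) (e : LEdge V) :
    hatCore G w VC d η e = 0 ∨ ((Inside VC e.2 ∧ ¬ e.2.IsDiag) ∧ γ ≤ hatCore G w VC d η e ∧
      hatCore G w VC d η e ≤ M) := by
  obtain ⟨o, p⟩ := e
  cases o with
  | none =>
    by_cases h : p ∈ G.edgeSet ∧ Inside VC p
    · right
      simp only [hatCore, if_pos h]
      exact ⟨⟨h.2, G.not_isDiag_of_mem_edgeSet h.1⟩, hA.bound p h.1⟩
    · left
      simp only [hatCore, if_neg h]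
  | some x =>
    rcases hatCore_some (G := G) (w := w) (VC := VC) (d := d) (η := η) x p with h | ⟨v, hv, hx, rfl, h⟩
    · exact Or.inl h
    · right
      have hvn := lowNbrs_subset x hv
      have hne : (nbrs G x).Nonempty := ⟨v, hvn⟩
      rw [h]
      refine ⟨⟨inside_mk.2 ⟨hA.nbrs_subset hx (top_mem hne), hA.nbrs_subset hx hvn⟩, ?_⟩,
        hA.weight_bound hvn⟩
      rw [Sym2.mk_isDiag_iff]
      intro htv
      exact hA.top_notMem_lowNbrs hη1 hx hne (htv ▸ hv)

theorem isWeightedOn_hatCore (hA : Admissible G w VC d γ M) (hη1 : η ≤ 1) :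
    IsWeightedOn VC γ (hatCore G w VC d η) := fun e =>
  (hA.hatCore_cases hη1 e).imp id fun h => ⟨h.1, h.2.1⟩

theorem isStars_hatBucket_weights (hA : Admissible G w VC d γ M) (i : ℕ) :
    IsStars VC (bucketVerts G w VC γ i) γ M (hatBucket G w VC d η γ i) where
  disj x hx := (Finset.mem_filter.1 hx).2.1
  supp e he := by
    by_cases h : e.1 = none ∧ ∃ x ∈ bucketVerts G w VC γ i, ∃ v ∈ nbrs G x \ lowNbrs G w d η x,
      e.2 = s(x, v)
    · obtain ⟨h1, x, hx, v, hv, h2⟩ := h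
      exact ⟨h1, x, hx, v, hA.nbrs_subset (Finset.mem_filter.1 hx).2.1 (Finset.mem_sdiff.1 hv).1, h2⟩
    · exact absurd (if_neg h) he
  bound e he := by
    by_cases h : e.1 = none ∧ ∃ x ∈ bucketVerts G w VC γ i, ∃ v ∈ nbrs G x \ lowNbrs G w d η x,
      e.2 = s(x, v)
    · rw [hatBucket, if_pos h]
      obtain ⟨-, x, hx, v, hv, h2⟩ := h
      rw [h2]
      exact hA.weight_bound (Finset.mem_sdiff.1 hv).1
    · exact absurd (if_neg h) he

/-- The bounds within the bucket have ratio 2d/η, which governs t. The global bounds of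
`isStars_hatBucket_weights` are needed too, since the lower one here may fall below γ. -/
theorem isStars_hatBucket (hA : Admissible G w VC d γ M)
    (hη : 0 ≤ η) (i : ℕ) : IsStars VC (bucketVerts G w VC γ i)
    (η / d * (γ * 2 ^ i)) (γ * 2 ^ (i + 1)) (hatBucket G w VC d η γ i) where
  disj := (hA.isStars_hatBucket_weights (η := η) i).disj
  supp := (hA.isStars_hatBucket_weights i).supp
  bound e he := by
    by_cases h : e.1 = none ∧ ∃ x ∈ bucketVerts G w VC γ i, ∃ v ∈ nbrs G x \ lowNbrs G w d η x,
      e.2 = s(x, v)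
    · rw [hatBucket, if_pos h]
      obtain ⟨-, x, hx, v, hv, h2⟩ := h
      rw [h2]
      obtain ⟨hvn, hvl⟩ := Finset.mem_sdiff.1 hv
      obtain ⟨-, -, hlo, hhi⟩ := (Finset.mem_filter.1 hx).2
      constructor
      · have h3 : η / d * w s(x, top G w x) ≤ w s(x, v) := by
          by_contra hlt
          exact hvl (Finset.mem_filter.2 ⟨hvn, not_le.1 hlt⟩)
        refine le_trans ?_ h3
        gcongr
      · exact (le_top hvn).trans hhi.le
    · exact absurd (if_neg h) he

theorem weightTo_hatBucket (hA : Admissible G w VC d γ M)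
    {i : ℕ} {x : V} (hx : x ∈ bucketVerts G w VC γ i) {S : Finset V}
    (hS : S ⊆ VC) : weightTo (hatBucket G w VC d η γ i) x S =
      ∑ u ∈ (nbrs G x \ lowNbrs G w d η x) ∩ S, w s(x, u) := by
  rw [weightTo, Finset.inter_comm, ← Finset.filter_mem_eq_inter, Finset.sum_filter]
  refine Finset.sum_congr rfl fun u hu => ?_
  rw [(hA.isStars_hatBucket_weights (η := η) i).sum_option, hatBucket_apply hx (hS hu)]

theorem card_neighbors_hatBucket (hA : Admissible G w VC d γ M)
    {i : ℕ} {x : V} (hx : x ∈ bucketVerts G w VC γ i) :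
    (neighbors (hatBucket G w VC d η γ i) x).card ≤ d := by
  have hst := hA.isStars_hatBucket_weights (η := η) i
  refine (Finset.card_le_card fun u hu => ?_).trans (hA.deg x (hst.disj x hx))
  have h1 := hst.neighbor_ne_zero hu
  rw [hatBucket_apply hx (hst.neighbors_subset hx hu)] at h1
  by_contra h
  refine h1 (if_neg fun h' => h (Finset.mem_sdiff.1 h').1)

theorem bucket_unique (hA : Admissible G w VC d γ M)
    {i j : ℕ} {x : V} (hi : x ∈ bucketVerts G w VC γ i)
    (hj : x ∈ bucketVerts G w VC γ j) : i = j := by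
  have aux : ∀ i j, x ∈ bucketVerts G w VC γ i → x ∈ bucketVerts G w VC γ j → i ≤ j := by
    intro i j hi hj
    have h1 := (Finset.mem_filter.1 hi).2.2.2.1.trans_lt (Finset.mem_filter.1 hj).2.2.2.2
    have h2 : (2 : ℝ) ^ i < 2 ^ (j + 1) := lt_of_mul_lt_mul_left h1 hA.pos.le
    have := (pow_lt_pow_iff_right₀ (by norm_num : (1 : ℝ) < 2)).1 h2
    omega
  exact le_antisymm (aux i j hi hj) (aux j i hj hi)

theorem exists_bucket (hA : Admissible G w VC d γ M)
    {R : ℝ} (hM : M ≤ γ * R) {x : V} (hx : x ∉ VC) (h : (nbrs G x).Nonempty) :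
    ∃ i ∈ Finset.range (Nat.log 2 ⌊R⌋₊ + 1), x ∈ bucketVerts G w VC γ i := by
  obtain ⟨h1, h2⟩ := hA.weight_bound (top_mem (w := w) h)
  have hγ := hA.pos
  set r := w s(x, top G w x) / γ with hr
  have hr1 : 1 ≤ r := (one_le_div hγ).2 h1
  have hrw : γ * r = w s(x, top G w x) := by rw [hr]; field_simp
  have hrR : r ≤ R := le_of_mul_le_mul_left (by rw [hrw]; exact h2.trans hM) hγ
  have hf : ⌊r⌋₊ ≠ 0 := (Nat.floor_pos.2 hr1).ne'
  refine ⟨Nat.log 2 ⌊r⌋₊, ?_, ?_⟩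
  · rw [Finset.mem_range, Nat.lt_succ_iff]
    exact Nat.log_mono_right (Nat.floor_mono hrR)
  · refine Finset.mem_filter.2 ⟨Finset.mem_univ _, hx, h, ?_, ?_⟩
    · rw [← hrw]
      have : ((2 ^ Nat.log 2 ⌊r⌋₊ : ℕ) : ℝ) ≤ r :=
        (Nat.cast_le.2 (Nat.pow_log_le_self 2 hf)).trans (Nat.floor_le (by linarith))
      push_cast at this
      gcongr
    · rw [← hrw]
      have h3 := Nat.lt_pow_succ_log_self (b := 2) (by norm_num) ⌊r⌋₊
      have : r < ((2 ^ (Nat.log 2 ⌊r⌋₊ + 1) : ℕ) : ℝ) := (Nat.floor_lt (by linarith)).1 h3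
      push_cast at this
      gcongr

end Admissible

/-- The part of the cut `S` that is due to the low edges at `x`. -/
noncomputable def lowCut (G : SimpleGraph V) (w : Sym2 V → ℝ) (d : ℕ) (η : ℝ) (x : V)
    (S : Finset V) : ℝ :=
  ∑ v ∈ lowNbrs G w d η x, if Crosses S s(top G w x, v) then w s(x, v) else 0

/-- The part of the terminal cut `S` that is due to the remaining edges at `x`. -/
noncomputable def highCut (G : SimpleGraph V) (w : Sym2 V → ℝ) (VC : Finset V) (d : ℕ) (η : ℝ)
    (x : V) (S : Finset V) : ℝ :=
  min (∑ u ∈ (nbrs G x \ lowNbrs G w d η x) ∩ S, w s(x, u))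
    (∑ u ∈ (nbrs G x \ lowNbrs G w d η x) ∩ (VC \ S), w s(x, u))

theorem cutWeight_eq_sum_option (H : WGraph V) (S : Finset V) :
    cutWeight H S = (∑ p, if Crosses S p then H (none, p) else 0) +
      ∑ x, ∑ p, if Crosses S p then H (some x, p) else 0 := by
  rw [cutWeight, Finset.sum_filter, Fintype.sum_prod_type, Fintype.sum_option]

theorem cutWeight_hatCore (S : Finset V) : cutWeight (hatCore G w VC d η) S =
    cutWeight (inner VC (ofSimple G w)) S + ∑ x ∈ Finset.univ \ VC, lowCut G w d η x S := by
  rw [cutWeight_eq_sum_option, cutWeight_eq_sum_option (inner VC _)]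
  have h1 : ∀ p : Sym2 V, hatCore G w VC d η (none, p) = inner VC (ofSimple G w) (none, p) := by
    intro p
    by_cases h1 : p ∈ G.edgeSet <;> by_cases h2 : Inside VC p <;>
      simp [hatCore, inner, ofSimple, h1, h2]
  have h2 : ∀ (x : V) (p : Sym2 V), inner VC (ofSimple G w) (some x, p) = 0 := by
    intro x p
    simp [inner, ofSimple]
  simp only [h1, h2, ite_self, Finset.sum_const_zero, add_zero]
  congr 1
  refine (Finset.sum_subset (Finset.subset_univ _) fun x _ hx => ?_).symm.trans
    (Finset.sum_congr rfl fun x hx => ?_)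
  · have hx : x ∈ VC := by simpa using hx
    exact Finset.sum_eq_zero fun p _ => by simp [hatCore, hx]
  · have hx : x ∉ VC := by simpa using hx
    simp only [hatCore, if_neg hx, lowCut, ← Finset.sum_filter (Crosses S)]
    rw [Finset.sum_comm]
    refine Finset.sum_congr rfl fun v _ => ?_
    rw [Finset.sum_ite_eq']
    simp

theorem weightTo_ofSimple (x : V) (S : Finset V) :
    weightTo (ofSimple G w) x S = ∑ u ∈ nbrs G x ∩ S, w s(x, u) := by
  rw [weightTo, Finset.inter_comm, ← Finset.filter_mem_eq_inter, Finset.sum_filter]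
  refine Finset.sum_congr rfl fun u hu => ?_
  rw [Finset.sum_eq_single none (fun o _ ho => by simp [ofSimple, ho]) (by simp)]
  simp [ofSimple, mem_nbrs]

/-- Here a and b are the high weights at x on the side of its top neighbour and on the other side,
al and bl are the low weights, and the parallel edges charge exactly bl. If b and b + bl are the two
minima, both quantities equal b + bl. Otherwise both are at least a and differ by at most al + bl ≤
η a. -/
theorem min_add_comparison {a b al bl η : ℝ} (ha : 0 ≤ a) (hb : 0 ≤ b) (hal : 0 ≤ al)
    (hbl : 0 ≤ bl) (hη : 0 ≤ η) (h : al + bl ≤ η * a) :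
    min (a + al) (b + bl) ≤ (1 + η) * (bl + min a b) ∧
      bl + min a b ≤ (1 + η) * min (a + al) (b + bl) := by
  have h1 := mul_nonneg hη ha
  have h2 := mul_nonneg hη hb
  have h3 := mul_nonneg hη hal
  have h4 := mul_nonneg hη hbl
  rcases le_total a b with hab | hab <;> rcases le_total (a + al) (b + bl) with hab' | hab' <;>
    simp only [min_eq_left hab, min_eq_right hab, min_eq_left hab', min_eq_right hab'] <;>
    constructor <;> nlinarith

theorem star_comparison (hA : Admissible G w VC d γ M) (hη : 0 ≤ η) (hη1 : η ≤ 1) {x : V}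
    (hx : x ∉ VC) (S : Finset V) :
    minStar VC (ofSimple G w) x S ≤
        (1 + η) * (lowCut G w d η x S + highCut G w VC d η x S) ∧
      lowCut G w d η x S + highCut G w VC d η x S ≤
        (1 + η) * minStar VC (ofSimple G w) x S := by
  rcases (nbrs G x).eq_empty_or_nonempty with h0 | hne
  · have hl : lowNbrs G w d η x = ∅ := Finset.subset_empty.1 (h0 ▸ lowNbrs_subset x)
    simp [minStar, weightTo_ofSimple, lowCut, highCut, h0, hl]
  have hw : ∀ u ∈ nbrs G x, 0 ≤ w s(x, u) := fun u hu =>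
    hA.pos.le.trans (hA.weight_bound hu).1
  have hlow := lowNbrs_subset (G := G) (w := w) (d := d) (η := η) x
  have hsplit : ∀ A : Finset V, ∑ u ∈ nbrs G x ∩ A, w s(x, u) =
      ∑ u ∈ (nbrs G x \ lowNbrs G w d η x) ∩ A, w s(x, u) +
        ∑ u ∈ lowNbrs G w d η x ∩ A, w s(x, u) := by
    intro A
    rw [← Finset.sum_union]
    · congr 1
      ext u
      simp only [Finset.mem_inter, Finset.mem_union, Finset.mem_sdiff]
      have := @hlow u
      tauto
    · refine Finset.disjoint_left.2 fun u hu hu' => ?_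
      simp only [Finset.mem_inter, Finset.mem_sdiff] at hu hu'
      tauto
  have hnn : ∀ B ⊆ nbrs G x, 0 ≤ ∑ u ∈ B, w s(x, u) := fun B hB =>
    Finset.sum_nonneg fun u hu => hw u (hB hu)
  have hhi : ∀ A, (nbrs G x \ lowNbrs G w d η x) ∩ A ⊆ nbrs G x := fun A =>
    Finset.inter_subset_left.trans Finset.sdiff_subset
  have hlo : ∀ A, lowNbrs G w d η x ∩ A ⊆ nbrs G x := fun A => Finset.inter_subset_left.trans hlow
  have htop := top_mem (w := w) hne
  have htl := hA.top_notMem_lowNbrs hη1 hx hne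
  have htV := hA.nbrs_subset hx htop
  have hsum := hA.sum_lowNbrs_le hη hx hne
  have hlsplit : ∑ u ∈ lowNbrs G w d η x ∩ S, w s(x, u) +
      ∑ u ∈ lowNbrs G w d η x ∩ (VC \ S), w s(x, u) = ∑ v ∈ lowNbrs G w d η x, w s(x, v) := by
    rw [← Finset.sum_union]
    · congr 1
      ext u
      simp only [Finset.mem_inter, Finset.mem_union, Finset.mem_sdiff]
      have := fun h => hA.nbrs_subset hx (@hlow u h)
      tauto
    · refine Finset.disjoint_left.2 fun u hu hu' => ?_
      simp only [Finset.mem_inter, Finset.mem_sdiff] at hu hu'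
      tauto
  have htopA : ∀ A, top G w x ∈ A → w s(x, top G w x) ≤
      ∑ u ∈ (nbrs G x \ lowNbrs G w d η x) ∩ A, w s(x, u) := fun A hA' =>
    Finset.single_le_sum (f := fun u => w s(x, u)) (fun u hu => hw u (hhi A hu))
      (by simp [htop, htl, hA'])
  rw [minStar, weightTo_ofSimple, weightTo_ofSimple, hsplit S, hsplit (VC \ S)]
  by_cases htS : top G w x ∈ S
  · have hlc : lowCut G w d η x S = ∑ u ∈ lowNbrs G w d η x ∩ (VC \ S), w s(x, u) := by
      rw [lowCut, ← Finset.sum_filter]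
      congr 1
      ext u
      simp only [Finset.mem_filter, Finset.mem_inter, Finset.mem_sdiff, crosses_mk]
      have := fun h => hA.nbrs_subset hx (@hlow u h)
      tauto
    rw [hlc, highCut]
    exact min_add_comparison (hnn _ (hhi _)) (hnn _ (hhi _)) (hnn _ (hlo _)) (hnn _ (hlo _)) hη
      (hlsplit.trans_le (hsum.trans (mul_le_mul_of_nonneg_left (htopA S htS) hη)))
  · have hlc : lowCut G w d η x S = ∑ u ∈ lowNbrs G w d η x ∩ S, w s(x, u) := by
      rw [lowCut, ← Finset.sum_filter]
      congr 1
      ext u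
      simp only [Finset.mem_filter, Finset.mem_inter, crosses_mk]
      tauto
    rw [hlc, highCut, min_comm, min_comm (∑ u ∈ (nbrs G x \ lowNbrs G w d η x) ∩ S, w s(x, u))]
    exact min_add_comparison (hnn _ (hhi _)) (hnn _ (hhi _)) (hnn _ (hlo _)) (hnn _ (hlo _)) hη
      (((add_comm _ _).trans hlsplit).trans_le (hsum.trans (mul_le_mul_of_nonneg_left
        (htopA (VC \ S) (Finset.mem_sdiff.2 ⟨htV, htS⟩)) hη)))

theorem sum_outerCut_hatBucket (hA : Admissible G w VC d γ M) {R : ℝ} (hM : M ≤ γ * R)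
    {S : Finset V} (hS : S ⊆ VC) :
    ∑ i ∈ Finset.range (Nat.log 2 ⌊R⌋₊ + 1), outerCut VC (hatBucket G w VC d η γ i) S =
      ∑ x ∈ Finset.univ \ VC, highCut G w VC d η x S := by
  simp only [outerCut]
  rw [Finset.sum_comm]
  refine Finset.sum_congr rfl fun x hx => ?_
  have hx : x ∉ VC := by simpa using hx
  have hzero : ∀ i, x ∉ bucketVerts G w VC γ i →
      minStar VC (hatBucket G w VC d η γ i) x S = 0 := fun i hi =>
    (hA.isStars_hatBucket_weights i).minStar_eq_zero hi hS
  by_cases hne : (nbrs G x).Nonempty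
  · obtain ⟨i, hi, hxi⟩ := hA.exists_bucket hM hx hne
    rw [Finset.sum_eq_single i (fun j _ hj => hzero j fun h => hj (hA.bucket_unique h hxi))
      (fun h => absurd hi h)]
    rw [minStar, hA.weightTo_hatBucket hxi hS, hA.weightTo_hatBucket hxi Finset.sdiff_subset]
    rfl
  · rw [Finset.sum_eq_zero fun i _ => hzero i fun h => hne (Finset.mem_filter.1 h).2.2.1]
    simp [highCut, Finset.not_nonempty_iff_eq_empty.1 hne]

/-- The bucketing preserves all terminal cuts. -/
theorem bucketing_comparison (hA : Admissible G w VC d γ M) (hη : 0 ≤ η) (hη1 : η ≤ 1) {R : ℝ}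
    (hM : M ≤ γ * R) {S : Finset V} (hS : S ⊆ VC) :
    terminalCut VC (ofSimple G w) S ≤ (1 + η) * (cutWeight (hatCore G w VC d η) S +
        ∑ i ∈ Finset.range (Nat.log 2 ⌊R⌋₊ + 1), outerCut VC (hatBucket G w VC d η γ i) S) ∧
      cutWeight (hatCore G w VC d η) S +
        ∑ i ∈ Finset.range (Nat.log 2 ⌊R⌋₊ + 1), outerCut VC (hatBucket G w VC d η γ i) S ≤
        (1 + η) * terminalCut VC (ofSimple G w) S := by
  have hc : 0 ≤ cutWeight (inner VC (ofSimple G w)) S := by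
    refine cutWeight_nonneg (fun e => ?_) S
    unfold inner ofSimple
    split_ifs with h1 h2
    · exact hA.pos.le.trans (hA.bound _ h2.2).1
    · exact le_rfl
    · exact le_rfl
  rw [sum_outerCut_hatBucket hA hM hS, cutWeight_hatCore, add_assoc, ← Finset.sum_add_distrib,
    terminalCut_eq, outerCut, mul_add, mul_add, Finset.mul_sum, Finset.mul_sum]
  have hc' : cutWeight (inner VC (ofSimple G w)) S ≤
      (1 + η) * cutWeight (inner VC (ofSimple G w)) S := le_mul_of_one_le_left hc (by linarith)
  exact ⟨add_le_add hc' (Finset.sum_le_sum fun x hx =>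
      (star_comparison hA hη hη1 (by simpa using hx) S).1),
    add_le_add hc' (Finset.sum_le_sum fun x hx =>
      (star_comparison hA hη hη1 (by simpa using hx) S).2)⟩

/-- There are at most n edges at u, and each vertex outside the cover contributes at most its edge
to u. This yields the upper weight bound for the core. -/
theorem terminalCut_singleton_le (hA : Admissible G w VC d γ M) (hM : 0 ≤ M) (u : V) :
    terminalCut VC (ofSimple G w) {u} ≤ 2 * (Fintype.card V * M) := by
  have hle : ∀ e, ofSimple G w e ≤ M := by
    intro e
    unfold ofSimple
    split_ifs with h
    · exact (hA.bound _ h.2).2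
    · exact hM
  rw [terminalCut_eq, two_mul]
  refine add_le_add ?_ ?_
  · have hsub : (Finset.univ.filter fun e : LEdge V => Crosses {u} e.2 ∧ e.1 = none) ⊆
        Finset.univ.image fun v => (none, s(u, v)) := by
      rintro ⟨o, p⟩ he
      induction p using Sym2.ind with
      | _ x y =>
        simp only [Finset.mem_filter, Finset.mem_univ, true_and, crosses_mk,
          Finset.mem_singleton] at he
        obtain ⟨h1, rfl⟩ := he
        simp only [Finset.mem_image, Finset.mem_univ, true_and]
        by_cases hx : x = u
        · exact ⟨y, by rw [hx]⟩
        · have hy : y = u := by tauto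
          exact ⟨x, by rw [hy, Sym2.eq_swap]⟩
    calc cutWeight (inner VC (ofSimple G w)) {u}
        ≤ ∑ e ∈ Finset.univ.filter (fun e : LEdge V => Crosses {u} e.2),
            if e.1 = none then M else 0 := by
          refine Finset.sum_le_sum fun e _ => ?_
          unfold inner
          split_ifs with h1 h2 h2
          · exact hle e
          · simp [ofSimple, h2]
          · exact hM
          · exact le_rfl
      _ = (Finset.univ.filter fun e : LEdge V => Crosses {u} e.2 ∧ e.1 = none).card * M := by
          rw [← Finset.sum_filter, Finset.filter_filter, Finset.sum_const, nsmul_eq_mul]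
      _ ≤ Fintype.card V * M := by
          gcongr
          exact (Finset.card_le_card hsub).trans Finset.card_image_le
  · calc outerCut VC (ofSimple G w) {u} ≤ ∑ x ∈ Finset.univ \ VC, M := by
          refine Finset.sum_le_sum fun x _ => (min_le_left _ _).trans ?_
          rw [weightTo, Finset.sum_singleton,
            Finset.sum_eq_single none (fun o _ ho => by simp [ofSimple, ho]) (by simp)]
          exact hle _
      _ = (Finset.univ \ VC).card * M := by rw [Finset.sum_const, nsmul_eq_mul]
      _ ≤ Fintype.card V * M := by
          gcongr
          exact Finset.card_le_univ _

end Bucketing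

/-! ### Combination of the parts -/

section Combination

variable {V : Type*}

theorem isStars_zero (VC : Finset V) (lo hi : ℝ) : IsStars VC ∅ lo hi (0 : WGraph V) where
  disj := by simp
  supp e he := absurd rfl he
  bound e he := absurd rfl he

theorem eq_zero_or_of_isWeightedOn {VC X : Finset V} {lo lo' hi : ℝ} {C B : WGraph V}
    (hC : IsWeightedOn VC lo' C) (hB : IsStars VC X lo hi B) (e : LEdge V) : C e = 0 ∨ B e = 0 := by
  by_contra! h
  obtain ⟨⟨hin, -⟩, -⟩ := (hC e).resolve_left h.1
  obtain ⟨-, x, hx, v, -, h2⟩ := hB.supp e h.2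
  exact hB.disj x hx (hin x (by rw [h2]; exact Sym2.mem_mk_left x v))

variable [Fintype V]

theorem outerCut_zero (VC S : Finset V) : outerCut VC (0 : WGraph V) S = 0 := by
  simp [outerCut, minStar, weightTo]

/-- The union of approximations of graphs with disjoint stars. -/
theorem isStars_sum {VC : Finset V} {lo hi a b : ℝ} (B : ℕ → Finset V)
    (hB : ∀ i j, i ≠ j → Disjoint (B i) (B j)) (o : ℕ → Finset V → ℝ) {l : List ℕ}
    (hl : l.Nodup) {Hs : List (WGraph V)}
    (h : List.Forall₂ (fun i H => IsStars VC (B i) lo hi H ∧ ∀ S ⊆ VC,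
      a * o i S ≤ outerCut VC H S ∧ outerCut VC H S ≤ b * o i S) l Hs) :
    IsStars VC (l.toFinset.biUnion B) lo hi Hs.sum ∧ ∀ S ⊆ VC,
      a * ∑ i ∈ l.toFinset, o i S ≤ outerCut VC Hs.sum S ∧
        outerCut VC Hs.sum S ≤ b * ∑ i ∈ l.toFinset, o i S := by
  induction h with
  | nil => simpa [outerCut_zero] using isStars_zero VC lo hi
  | @cons i H l Hs hH _ ih =>
    obtain ⟨hi, hl⟩ := List.nodup_cons.1 hl
    obtain ⟨ih1, ih2⟩ := ih hl
    have hil : i ∉ l.toFinset := by simpa using hi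
    have hd : Disjoint (B i) (l.toFinset.biUnion B) :=
      (Finset.disjoint_biUnion_right _ _ _).2 fun j hj => hB i j fun h => hil (h ▸ hj)
    rw [List.toFinset_cons, Finset.biUnion_insert, List.sum_cons]
    refine ⟨hH.1.add ih1 hd, fun S hS => ?_⟩
    rw [hH.1.outerCut_add ih1 hd hS, Finset.sum_insert hil, mul_add, mul_add]
    exact ⟨add_le_add (hH.2 S hS).1 (ih2 S hS).1, add_le_add (hH.2 S hS).2 (ih2 S hS).2⟩

variable {VC X : Finset V} {lo lo' hi : ℝ} {C B : WGraph V}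

theorem terminalCut_core_add_stars (hC : IsWeightedOn VC lo' C) (hB : IsStars VC X lo hi B)
    (S : Finset V) :
    terminalCut VC (C + B) S = cutWeight C S + outerCut VC B S := by
  have h1 : inner VC (C + B) = C := by
    ext e
    unfold inner
    split_ifs with h
    · rw [Pi.add_apply]
      by_cases hb : B e = 0
      · rw [hb, add_zero]
      · obtain ⟨-, x, hx, v, -, h2⟩ := hB.supp e hb
        exact absurd (h x (by rw [h2]; exact Sym2.mem_mk_left x v)) (hB.disj x hx)
    · by_contra hne
      exact h ((hC e).resolve_left fun h0 => hne h0.symm).1.1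
  have h2 : ∀ x ∉ VC, ∀ T, weightTo (C + B) x T = weightTo B x T := by
    intro x hx T
    rw [weightTo_add, add_eq_right]
    refine Finset.sum_eq_zero fun u _ => Finset.sum_eq_zero fun o _ => ?_
    by_contra hne
    exact hx (((hC _).resolve_left hne).1.1 x (Sym2.mem_mk_left x u))
  rw [terminalCut_eq, h1]
  congr 1
  refine Finset.sum_congr rfl fun x hx => ?_
  have hx : x ∉ VC := by simpa using hx
  rw [minStar, h2 x hx, h2 x hx]
  rfl

theorem le_cutWeight_singleton {H : WGraph V} (hpos : ∀ e, 0 ≤ H e) {o : Option V} {u v : V}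
    (huv : u ≠ v) : H (o, s(u, v)) ≤ cutWeight H {u} := by
  refine Finset.single_le_sum (f := fun e => H e) (fun e _ => hpos e) ?_
  simp only [Finset.mem_filter, Finset.mem_univ, true_and, crosses_mk, Finset.mem_singleton]
  simpa using huv.symm

/-- The numbers g, h' and h stand for a terminal cut of the input, of the bucketed graph and of the
output. All rests on (1 - ε)(1 + ε/4)(1 + ε/2) ≤ 1 and 1 + ε/2 ≤ (1 + ε)(1 - ε/4); the latter needs
ε ≤ 1. -/
theorem approx_arith {ε g h h' : ℝ} (hε : 0 < ε) (hε1 : ε ≤ 1) (hg : 0 ≤ g) (hh : 0 ≤ h)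
    (h1 : g ≤ (1 + ε / 2) * h') (h2 : h' ≤ (1 + ε / 2) * g) (h3 : (1 - ε / 4) * h' ≤ h)
    (h4 : h ≤ (1 + ε / 4) * h') : (1 - ε) * h ≤ g ∧ g ≤ (1 + ε) * h := by
  have e2 : 0 ≤ ε ^ 2 := sq_nonneg ε
  constructor
  · have a1 : h ≤ (1 + ε / 4) * ((1 + ε / 2) * g) :=
      h4.trans (mul_le_mul_of_nonneg_left h2 (by linarith))
    have a2 : (1 - ε) * h ≤ (1 - ε) * ((1 + ε / 4) * ((1 + ε / 2) * g)) :=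
      mul_le_mul_of_nonneg_left a1 (by linarith)
    have a3 : (1 - ε) * ((1 + ε / 4) * (1 + ε / 2)) ≤ 1 := by nlinarith
    calc (1 - ε) * h ≤ ((1 - ε) * ((1 + ε / 4) * (1 + ε / 2))) * g := by linarith
      _ ≤ 1 * g := mul_le_mul_of_nonneg_right a3 hg
      _ = g := one_mul g
  · have a1 : (1 + ε / 2) ≤ (1 + ε) * (1 - ε / 4) := by nlinarith
    have hh' : 0 ≤ h' := by
      by_contra hneg
      have : (1 + ε / 2) * h' < 0 := mul_neg_of_pos_of_neg (by linarith) (not_le.1 hneg)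
      linarith
    calc g ≤ (1 + ε / 2) * h' := h1
      _ ≤ ((1 + ε) * (1 - ε / 4)) * h' := mul_le_mul_of_nonneg_right a1 hh'
      _ = (1 + ε) * ((1 - ε / 4) * h') := by ring
      _ ≤ (1 + ε) * h := mul_le_mul_of_nonneg_left h3 (by linarith)

theorem terminalCut_nonneg {H : WGraph V} (hpos : ∀ e, 0 ≤ H e) (VC S : Finset V) :
    0 ≤ terminalCut VC H S := by
  rw [terminalCut_eq]
  refine add_nonneg (cutWeight_nonneg (fun e => ?_) S) (outerCut_nonneg hpos VC S)
  unfold inner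
  split_ifs
  exacts [hpos e, le_rfl]

/-- Approximations of the buckets combine to an approximation of the input graph. -/
theorem output_properties {G : SimpleGraph V} {w : Sym2 V → ℝ} {d : ℕ} {γ M ε R hi : ℝ}
    (hA : Admissible G w VC d γ M) (hε : 0 < ε) (hε1 : ε ≤ 1) (hM0 : 0 ≤ M) (hM : M ≤ γ * R)
    {H₀ : WGraph V} (h₀ : IsWeightedOn VC γ H₀)
    (hcut : ∀ S, (1 - ε / 4) * cutWeight (hatCore G w VC d (ε / 2)) S ≤ cutWeight H₀ S ∧
      cutWeight H₀ S ≤ (1 + ε / 4) * cutWeight (hatCore G w VC d (ε / 2)) S)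
    {Hs : List (WGraph V)}
    (hHs : List.Forall₂ (fun i H => IsStars VC (bucketVerts G w VC γ i) γ hi H ∧ ∀ S ⊆ VC,
      (1 - ε / 4) * outerCut VC (hatBucket G w VC d (ε / 2) γ i) S ≤ outerCut VC H S ∧
      outerCut VC H S ≤ (1 + ε / 4) * outerCut VC (hatBucket G w VC d (ε / 2) γ i) S)
      (List.range (Nat.log 2 ⌊R⌋₊ + 1)) Hs) :
    TerminalApprox ε VC (H₀ + Hs.sum) (ofSimple G w) ∧
      ∀ e ∈ edges (H₀ + Hs.sum), γ ≤ (H₀ + Hs.sum) e ∧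
        (H₀ + Hs.sum) e ≤ max (4 * (Fintype.card V * M)) hi := by
  have hγ := hA.pos.le
  obtain ⟨hst, hout⟩ := isStars_sum (fun i => bucketVerts G w VC γ i) (fun i j hij =>
    Finset.disjoint_left.2 fun x hx hx' => hij (hA.bucket_unique hx hx'))
    (fun i S => outerCut VC (hatBucket G w VC d (ε / 2) γ i) S) List.nodup_range hHs
  rw [List.toFinset_range] at hout
  have hwpos : ∀ e, 0 ≤ ofSimple G w e := by
    intro e
    unfold ofSimple
    split_ifs with h
    exacts [hγ.trans (hA.bound _ h.2).1, le_rfl]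
  have hcomp := fun S hS => bucketing_comparison (S := S) hA (η := ε / 2) (by linarith)
    (by linarith) hM hS
  refine ⟨fun S hS => ?_, fun e he => ?_⟩
  · rw [terminalCut_core_add_stars h₀ hst S]
    refine approx_arith hε hε1 (terminalCut_nonneg hwpos _ _)
      (add_nonneg (cutWeight_nonneg (h₀.nonneg hγ) S) (outerCut_nonneg (hst.nonneg hγ) _ _))
      (hcomp S hS).1 (hcomp S hS).2 ?_ ?_
    · rw [mul_add]
      exact add_le_add (hcut S).1 (hout S hS).1
    · rw [mul_add]
      exact add_le_add (hcut S).2 (hout S hS).2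
  · rw [mem_edges] at he
    rcases eq_zero_or_of_isWeightedOn h₀ hst e with h | h
    · rw [Pi.add_apply, h, zero_add] at he ⊢
      exact ⟨(hst.bound e he).1, (hst.bound e he).2.trans (le_max_right _ _)⟩
    · rw [Pi.add_apply, h, add_zero] at he ⊢
      obtain ⟨⟨hin, hdiag⟩, hlow⟩ := (h₀ e).resolve_left he
      refine ⟨hlow, le_trans ?_ (le_max_left _ _)⟩
      obtain ⟨o, p⟩ := e
      induction p using Sym2.ind with
      | _ u v =>
        have huv : u ≠ v := fun huv => hdiag (Sym2.mk_isDiag_iff.2 huv)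
        have hu : ({u} : Finset V) ⊆ VC := by simpa using (inside_mk.1 hin).1
        have hnM : 0 ≤ Fintype.card V * M := by positivity
        have hbuck : 0 ≤ ∑ i ∈ Finset.range (Nat.log 2 ⌊R⌋₊ + 1),
            outerCut VC (hatBucket G w VC d (ε / 2) γ i) {u} :=
          Finset.sum_nonneg fun i _ =>
            outerCut_nonneg ((hA.isStars_hatBucket_weights i).nonneg hγ) _ _
        have hle : cutWeight (hatCore G w VC d (ε / 2)) {u} ≤
            (1 + ε / 2) * (2 * (Fintype.card V * M)) := by
          have h1 := (hcomp {u} hu).2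
          have h2 := mul_le_mul_of_nonneg_left (terminalCut_singleton_le hA hM0 u)
            (by linarith : 0 ≤ 1 + ε / 2)
          linarith
        -- Following the quadrupled weights through all rounds would be too wasteful; the
        -- approximated cut around u bounds every edge at u.
        calc H₀ (o, s(u, v)) ≤ cutWeight H₀ {u} := le_cutWeight_singleton (h₀.nonneg hγ) huv
          _ ≤ (1 + ε / 4) * cutWeight (hatCore G w VC d (ε / 2)) {u} := (hcut {u}).2
          _ ≤ (1 + ε / 4) * ((1 + ε / 2) * (2 * (Fintype.card V * M))) := by
              have : 0 ≤ 1 + ε / 4 := by linarith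
              gcongr
          _ = ((1 + ε / 4) * (1 + ε / 2) * 2) * (Fintype.card V * M) := by ring
          _ ≤ 4 * (Fintype.card V * M) := by
              have : (1 + ε / 4) * (1 + ε / 2) * 2 ≤ 4 := by nlinarith
              gcongr

end Combination

/-! ### Numerical estimates -/

section Numerics

/-- Since 2 log n ≥ 1, powers of 2 log n absorb constants and may be raised to higher exponents. -/
theorem half_le_log {n : ℕ} (hn : 2 ≤ n) : 1 / 2 ≤ Real.log n := by
  have h1 : Real.log 2 ≤ Real.log n := Real.log_le_log (by norm_num) (by exact_mod_cast hn)
  linarith [Real.log_two_gt_d9]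

theorem exp_log_natCast {n : ℕ} (hn : 2 ≤ n) : Real.exp (Real.log n) = n :=
  Real.exp_log (by positivity)

theorem clog_le_mul_log {n m E : ℕ} (hn : 2 ≤ n) (hE : E ≤ n ^ m) :
    (Nat.clog 2 E : ℝ) ≤ 2 * (m + 1) * Real.log n := by
  have hx := half_le_log hn
  by_cases h1 : 1 < E
  · have h2 := Nat.pow_pred_clog_lt_self (b := 2) (by norm_num) h1
    have hk : Nat.clog 2 E ≠ 0 := (Nat.clog_pos (by norm_num) h1).ne'
    have h3 : 2 ^ Nat.clog 2 E ≤ n ^ (m + 1) := by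
      obtain ⟨k, hk'⟩ := Nat.exists_eq_succ_of_ne_zero hk
      rw [hk', Nat.pred_succ] at h2
      rw [hk', pow_succ, pow_succ]
      exact Nat.mul_le_mul (h2.le.trans hE) hn
    have h4 : (2 : ℝ) ^ Nat.clog 2 E ≤ (n : ℝ) ^ (m + 1) := by exact_mod_cast h3
    have h5 := Real.log_le_log (by positivity) h4
    rw [Real.log_pow, Real.log_pow] at h5
    push_cast at h5
    have h6 := Real.log_two_gt_d9
    have h7 : (0 : ℝ) ≤ Nat.clog 2 E := by positivity
    nlinarith
  · rw [Nat.clog_of_right_le_one (not_lt.1 h1)]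
    push_cast
    positivity

theorem two_pow_clog_le {n : ℕ} (hn : 2 ≤ n) : (2 : ℝ) ^ Nat.clog 2 n ≤ 2 * n := by
  have h2 := Nat.pow_pred_clog_lt_self (b := 2) (by norm_num) (by omega : 1 < n)
  have hk : Nat.clog 2 n ≠ 0 := (Nat.clog_pos (by norm_num) (by omega)).ne'
  obtain ⟨k, hk'⟩ := Nat.exists_eq_succ_of_ne_zero hk
  rw [hk', Nat.pred_succ] at h2
  have : (2 : ℝ) ^ k ≤ n := by exact_mod_cast h2.le
  rw [hk', pow_succ]
  linarith

/-- Error ε/(8k) per round accumulates to at most ε/4: the upper estimate loses a factor 2, the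
lower one is Bernoulli's inequality. -/
theorem pow_approx (k : ℕ) {ε : ℝ} (hε : 0 ≤ ε) (hε1 : ε ≤ 1) :
    (1 + ε / (8 * k)) ^ k ≤ 1 + ε / 4 ∧ 1 - ε / 4 ≤ (1 - ε / (8 * k)) ^ k := by
  rcases Nat.eq_zero_or_pos k with rfl | hk
  · simp only [pow_zero]
    constructor <;> linarith
  have hk' : (1 : ℝ) ≤ k := by exact_mod_cast hk
  have hkε : k * (ε / (8 * k)) = ε / 8 := by field_simp
  have h0 : 0 ≤ ε / (8 * k) := by positivity
  have h1 : ε / (8 * k) ≤ 1 := by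
    rw [div_le_one (by positivity)]
    linarith
  constructor
  · have := one_add_pow_sub_one_le h0 le_rfl (by rw [hkε]; linarith)
    rw [hkε] at this
    linarith
  · have := one_add_mul_le_pow (a := -(ε / (8 * k))) (by linarith) k
    have h2 : (k : ℝ) * -(ε / (8 * k)) = -(ε / 8) := by rw [mul_neg, hkε]
    rw [h2, ← sub_eq_add_neg, ← sub_eq_add_neg] at this
    linarith

/-- The number of elements that survive `k` rounds of sampling has an exponential tail. -/
theorem tail_le {n b s k E : ℕ} {K : ℝ} (hn : 2 ≤ n) (hb : 2 ≤ b) (hE : E ≤ b ^ k)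
    (hs : 2 * (K + 2) * Real.log n ≤ s) :
    (2⁻¹ : ℝ≥0∞) ^ s * (1 + (b : ℝ≥0∞)⁻¹ ^ k) ^ E ≤
      ENNReal.ofReal (Real.exp (-(K * Real.log n))) := by
  have hx := half_le_log hn
  have hb0 : (0 : ℝ) < b := by positivity
  have hz : (b : ℝ≥0∞)⁻¹ ^ k = ENNReal.ofReal (((b : ℝ)⁻¹) ^ k) := by
    rw [ENNReal.ofReal_pow (by positivity), ENNReal.ofReal_inv_of_pos hb0, ENNReal.ofReal_natCast]
  have h2 : (2⁻¹ : ℝ≥0∞) = ENNReal.ofReal 2⁻¹ := by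
    rw [ENNReal.ofReal_inv_of_pos (by norm_num)]; norm_num
  rw [hz, h2, ← ENNReal.ofReal_one, ← ENNReal.ofReal_add (by norm_num) (by positivity),
    ← ENNReal.ofReal_pow (by positivity), ← ENNReal.ofReal_pow (by positivity),
    ← ENNReal.ofReal_mul (by positivity)]
  apply ENNReal.ofReal_le_ofReal
  -- With b ^ k ≥ E the second factor is at most 4 ≤ n², which explains K + 2. The factor 2 in the
  -- bound for s comes from log 2 ≥ 1/2.
  have hE1 : (E : ℝ) * ((b : ℝ)⁻¹) ^ k ≤ 1 := by
    have : (E : ℝ) ≤ (b : ℝ) ^ k := by exact_mod_cast hE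
    rw [inv_pow, ← div_eq_mul_inv]
    exact (div_le_one (by positivity)).2 this
  have h4 := one_add_pow_sub_one_le (by positivity : (0 : ℝ) ≤ ((b : ℝ)⁻¹) ^ k) le_rfl hE1
  have h5 : (1 + ((b : ℝ)⁻¹) ^ k) ^ E ≤ 4 := by linarith
  have h6 : (4 : ℝ) ≤ Real.exp (2 * Real.log n) := by
    have : (2 : ℝ) ≤ n := by exact_mod_cast hn
    rw [two_mul, Real.exp_add, exp_log_natCast hn]
    nlinarith
  have h7 : (2⁻¹ : ℝ) ^ s ≤ Real.exp (-((K + 2) * Real.log n)) := by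
    have : (2⁻¹ : ℝ) = Real.exp (-Real.log 2) := by rw [Real.exp_neg, Real.exp_log (by norm_num)]
    rw [this, ← Real.exp_nat_mul]
    apply Real.exp_le_exp.2
    have h8 := Real.log_two_gt_d9
    have h9 : (0 : ℝ) ≤ s := by positivity
    nlinarith
  calc (2⁻¹ : ℝ) ^ s * (1 + ((b : ℝ)⁻¹) ^ k) ^ E
      ≤ Real.exp (-((K + 2) * Real.log n)) * Real.exp (2 * Real.log n) := by
        gcongr
        exact h5.trans h6
    _ = _ := by rw [← Real.exp_add]; congr 1; ring

/-- Polynomial factors are absorbed by the failure probability. -/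
theorem mul_pow_mul_exp_le {n i j : ℕ} {b K κ : ℝ} (hn : 2 ≤ n) (hb : b ≤ 2 ^ i)
    (hκ : (K + i + j) * Real.log n ≤ κ) :
    b * (n : ℝ) ^ j * Real.exp (-κ) ≤ Real.exp (-(K * Real.log n)) := by
  have h2 : (2 : ℝ) ≤ n := by exact_mod_cast hn
  have h3 : (n : ℝ) ^ (i + j) = Real.exp ((i + j) * Real.log n) := by
    rw [← exp_log_natCast hn, ← Real.exp_nat_mul, Real.log_exp]
    push_cast
    rfl
  calc b * (n : ℝ) ^ j * Real.exp (-κ) ≤ (n : ℝ) ^ i * (n : ℝ) ^ j * Real.exp (-κ) := by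
        have := hb.trans (pow_le_pow_left₀ (by norm_num) h2 i)
        gcongr
    _ = Real.exp ((i + j) * Real.log n) * Real.exp (-κ) := by rw [← pow_add, h3]
    _ ≤ _ := by
        rw [← Real.exp_add]
        apply Real.exp_le_exp.2
        linarith

theorem card_lEdge_le {V : Type*} [Fintype V] (hn : 2 ≤ Fintype.card V) :
    Fintype.card (LEdge V) ≤ Fintype.card V ^ 4 := by
  have h1 : Fintype.card (Sym2 V) ≤ Fintype.card V ^ 2 := by
    have := Fintype.card_le_of_surjective (fun p : V × V => s(p.1, p.2)) (fun e => by
      induction e using Sym2.ind with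
      | _ u v => exact ⟨(u, v), rfl⟩)
    rwa [Fintype.card_prod, ← sq] at this
  rw [Fintype.card_prod, Fintype.card_option]
  calc (Fintype.card V + 1) * Fintype.card (Sym2 V)
      ≤ Fintype.card V ^ 2 * Fintype.card V ^ 2 := Nat.mul_le_mul (by nlinarith) h1
    _ = _ := by ring

end Numerics

/-! ### The sampled parts -/

section Parts

variable {V : Type*} [Fintype V] {G : SimpleGraph V} {w : Sym2 V → ℝ} {VC : Finset V} {d : ℕ}
  {γ : ℝ}

theorem edges_eq_empty_of_cover_empty {lo : ℝ} {H : WGraph V} (hH : IsWeightedOn VC lo H)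
    (hVC : VC.card = 0) : edges H = ∅ := by
  rw [Finset.card_eq_zero] at hVC
  subst hVC
  refine Finset.eq_empty_of_forall_notMem fun e he => ?_
  have h := hH.inside e he
  obtain ⟨o, p⟩ := e
  induction p using Sym2.ind with
  | _ u v => exact absurd (h u (Sym2.mem_mk_left u v)) (Finset.notMem_empty u)

/-- Here ρ bounds 1 + log R, and k ≤ 10 log n because there are at most n⁴ labelled edges. The
constant is 1000 · 2 · 4² · 10² / 2⁴ = 200000, and one more pays for rounding up. -/
theorem bundleSize_bound {c ρ R ε x k : ℝ} (hρ : 1 + Real.log R ≤ ρ) (hρ1 : 1 ≤ ρ) (hc : 1 ≤ c)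
    (hε : 0 < ε) (hε1 : ε ≤ 1) (hx : 1 / 2 ≤ x) (hk0 : 0 < k) (hk : k ≤ 10 * x) :
    (⌈1000 * (c + 1) * 2 * (1 + Real.log R) * x ^ 2 / (ε / 2 / (2 * k)) ^ 2⌉₊ : ℝ) ≤
      200001 * (c + 1) * (ρ * (2 * x) ^ 4 * ε⁻¹ ^ 2) := by
  have hε2 : 1 ≤ ε⁻¹ ^ 2 := one_le_pow₀ ((one_le_inv₀ hε).2 hε1)
  have hy : 1 ≤ (2 * x) ^ 4 := one_le_pow₀ (by linarith)
  have h1 : 1 ≤ ρ * (2 * x) ^ 4 * ε⁻¹ ^ 2 :=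
    one_le_mul_of_one_le_of_one_le (one_le_mul_of_one_le_of_one_le hρ1 hy) hε2
  have h2 : 1000 * (c + 1) * 2 * (1 + Real.log R) * x ^ 2 / (ε / 2 / (2 * k)) ^ 2 ≤
      200000 * (c + 1) * (ρ * (2 * x) ^ 4 * ε⁻¹ ^ 2) := by
    calc 1000 * (c + 1) * 2 * (1 + Real.log R) * x ^ 2 / (ε / 2 / (2 * k)) ^ 2
        ≤ 1000 * (c + 1) * 2 * ρ * x ^ 2 / (ε / 2 / (2 * k)) ^ 2 := by gcongr
      _ = 32000 * (c + 1) * ρ * x ^ 2 * ε⁻¹ ^ 2 * k ^ 2 := by field_simp; norm_num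
      _ ≤ 32000 * (c + 1) * ρ * x ^ 2 * ε⁻¹ ^ 2 * (10 * x) ^ 2 := by gcongr
      _ = 200000 * (c + 1) * (ρ * (2 * x) ^ 4 * ε⁻¹ ^ 2) := by ring
  have h3 : 0 ≤ 200000 * (c + 1) * (ρ * (2 * x) ^ 4 * ε⁻¹ ^ 2) := by positivity
  have h4 := (Nat.ceil_lt_add_one h3).le
  have h5 : (⌈1000 * (c + 1) * 2 * (1 + Real.log R) * x ^ 2 / (ε / 2 / (2 * k)) ^ 2⌉₊ : ℝ) ≤
      (⌈200000 * (c + 1) * (ρ * (2 * x) ^ 4 * ε⁻¹ ^ 2)⌉₊ : ℝ) := by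
    exact_mod_cast Nat.ceil_mono h2
  nlinarith

theorem fail_core_cut_le {c R ε : ℝ} (hn : 2 ≤ Fintype.card V)
    (hA : Admissible G w VC d γ (γ * R)) (hc : 1 ≤ c) (hε : 0 < ε) (hε1 : ε ≤ 1) :
    fail (cutSparsify 1000 R c (ε / 2) (hatCore G w VC d (ε / 2))) (fun H => ∀ S,
      (1 - ε / 4) * cutWeight (hatCore G w VC d (ε / 2)) S ≤ cutWeight H S ∧
      cutWeight H S ≤ (1 + ε / 4) * cutWeight (hatCore G w VC d (ε / 2)) S) ≤
    ENNReal.ofReal (Real.exp (-((c + 2) * Real.log (Fintype.card V)))) := by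
  have hη1 : ε / 2 ≤ 1 := by linarith
  have hW := hA.isWeightedOn_hatCore hη1
  set G₀ := hatCore G w VC d (ε / 2) with hG₀
  set n := Fintype.card V with hndef
  have hE : (edges G₀).card ≤ n ^ 4 := (Finset.card_le_univ _).trans (card_lEdge_le hn)
  have hx := half_le_log hn
  have hkx := clog_le_mul_log hn hE
  have hc0 : ∀ S, 0 ≤ cutWeight G₀ S := cutWeight_nonneg (hW.nonneg hA.pos.le)
  unfold cutSparsify
  dsimp only
  rw [← hndef]
  set k := Nat.clog 2 (edges G₀).card with hk
  -- With at most one edge there is no round, and the graph is returned unchanged.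
  rcases Nat.eq_zero_or_pos k with hk0 | hkpos
  · rw [hk0, cutSparsifyLoop, fail_pure]
    · exact bot_le
    · intro S
      constructor <;> nlinarith [hc0 S]
  have hR : 1 ≤ R := by
    have h1 : 1 < (edges G₀).card := by
      by_contra h
      rw [hk, Nat.clog_of_right_le_one (not_lt.1 h)] at hkpos
      exact absurd hkpos (lt_irrefl 0)
    obtain ⟨e, he⟩ := Finset.card_pos.1 (zero_lt_one.trans h1)
    have h2 := ((hA.hatCore_cases hη1 e).resolve_left (mem_edges.1 he)).2
    have h3 := h2.1.trans h2.2
    have hγ := hA.pos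
    by_contra hlt
    nlinarith [not_le.1 hlt]
  have hlogR : 0 ≤ Real.log R := Real.log_nonneg hR
  have hk1 : (1 : ℝ) ≤ k := by exact_mod_cast hkpos
  have ht := Nat.le_ceil (1000 * (c + 1) * 2 * (1 + Real.log R) * Real.log n ^ 2 /
    (ε / 2 / (2 * k)) ^ 2)
  have htpos : 0 < cutBundleSize 1000 n R (c + 1) (ε / 2 / (2 * k)) := by
    unfold cutBundleSize
    rw [Nat.ceil_pos]
    positivity
  change _ ≤ ((cutBundleSize 1000 n R (c + 1) (ε / 2 / (2 * k)) : ℕ) : ℝ) at ht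
  set t := cutBundleSize 1000 n R (c + 1) (ε / 2 / (2 * k)) with ht'
  have hδ0 : 0 ≤ ε / (8 * k) := by positivity
  have hδ1 : ε / (8 * k) ≤ 1 := by
    rw [div_le_one (by positivity)]
    linarith
  have hloop := fail_loop_cut_le (r := (c + 2) * Real.log n) (k := k) (N := n ^ 4) hA.pos htpos
    hδ0 hδ1 hW hE
  refine (fail_mono fun H _ hH S => ?_).trans (hloop.trans ?_)
  · obtain ⟨h1, h2⟩ := pow_approx k hε.le hε1
    exact ⟨(mul_le_mul_of_nonneg_right h2 (hc0 S)).trans (hH S).1,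
      (hH S).2.trans (mul_le_mul_of_nonneg_right h1 (hc0 S))⟩
  · rw [← ENNReal.ofReal_natCast k, ← ENNReal.ofReal_mul (by positivity)]
    apply ENNReal.ofReal_le_ofReal
    have hVC : (VC.card : ℝ) ≤ n := by exact_mod_cast Finset.card_le_univ VC
    have hkn : (k : ℝ) ≤ 10 * n := by
      have := Real.log_le_self (show (0 : ℝ) ≤ n by positivity)
      push_cast at hkx
      linarith
    -- The union bound costs 40 n¹⁰ ≤ 2⁶ n¹⁰, from n⁴ squared, |VC| and k. Since (ε/8k)² / (ε/4k)² =
    -- 1/4, the exponent is 2000 / (4 · 24) = 125/6 times (c + 1) log² n, and 125/12 · (c + 1) ≥ c +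
    -- 18 for c ≥ 1.
    have hκ : (c + 2 + (6 : ℕ) + (10 : ℕ)) * Real.log n ≤ (ε / (8 * k)) ^ 2 * t / 24 := by
      have h1 : 1000 * (c + 1) * 2 * 1 * Real.log n ^ 2 / (ε / 2 / (2 * k)) ^ 2 ≤ t := by
        refine le_trans ?_ ht
        gcongr
        linarith
      have h2 : (ε / (8 * k)) ^ 2 *
          (1000 * (c + 1) * 2 * 1 * Real.log n ^ 2 / (ε / 2 / (2 * k)) ^ 2) / 24 ≤
          (ε / (8 * k)) ^ 2 * t / 24 := by gcongr
      refine le_trans ?_ h2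
      have h3 : (ε / (8 * k)) ^ 2 *
          (1000 * (c + 1) * 2 * 1 * Real.log n ^ 2 / (ε / 2 / (2 * k)) ^ 2) / 24 =
          125 / 6 * (c + 1) * Real.log n ^ 2 := by
        field_simp
        norm_num
      rw [h3]
      push_cast
      nlinarith [mul_nonneg (by linarith : 0 ≤ c + 1) (by linarith : 0 ≤ Real.log n)]
    calc (k : ℝ) * (4 * ((n ^ 4 : ℕ) : ℝ) ^ 2 * VC.card * Real.exp (-((ε / (8 * k)) ^ 2 * t / 24)))
        ≤ (10 * n) * (4 * ((n ^ 4 : ℕ) : ℝ) ^ 2 * n *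
            Real.exp (-((ε / (8 * k)) ^ 2 * t / 24))) := by gcongr
      _ = 40 * (n : ℝ) ^ 10 * Real.exp (-((ε / (8 * k)) ^ 2 * t / 24)) := by
          push_cast
          ring
      _ ≤ _ := mul_pow_mul_exp_le hn (by norm_num) hκ

theorem log_mem_Icc {R : ℝ} (hγ : 0 < γ) {v : ℝ} (h1 : γ ≤ v) (h2 : v ≤ γ * R) :
    Int.log 2 v ∈ Finset.Icc (Int.log 2 γ)
      (Int.log 2 γ + (Int.log 2 (γ * R) - Int.log 2 γ).toNat) := by
  have h3 := Int.log_mono_right (b := 2) hγ h1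
  have h4 := Int.log_mono_right (b := 2) (hγ.trans_le h1) h2
  rw [Finset.mem_Icc]
  omega

theorem toNat_log_sub_log_le {R ρ : ℝ} (hγ : 0 < γ) (hR : 0 < R) (hρ : 1 + Real.log R ≤ ρ)
    (hρ1 : 1 ≤ ρ) : ((Int.log 2 (γ * R) - Int.log 2 γ).toNat : ℝ) + 1 ≤ 2 * ρ := by
  set q := (Int.log 2 (γ * R) - Int.log 2 γ).toNat with hq
  rcases Nat.eq_zero_or_pos q with h0 | hpos
  · rw [h0]
    push_cast
    linarith
  have h1 := Int.zpow_log_le_self (b := 2) (by norm_num) (mul_pos hγ hR)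
  have h2 := Int.lt_zpow_succ_log_self (b := 2) (by norm_num) γ
  have h3 : Int.log 2 (γ * R) = (Int.log 2 γ + 1) + ((q - 1 : ℕ) : ℤ) := by omega
  rw [h3, zpow_add₀ (by norm_num), zpow_natCast] at h1
  have h4 : (2 : ℝ) ^ (q - 1) ≤ R := by
    have h5 : γ * (2 : ℝ) ^ (q - 1) ≤ γ * R := by
      refine le_trans ?_ h1
      push_cast at h2 ⊢
      gcongr
    exact le_of_mul_le_mul_left h5 hγ
  have h6 := Real.log_le_log (by positivity) h4
  rw [Real.log_pow, Nat.cast_sub hpos] at h6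
  have h7 := Real.log_two_gt_d9
  have h8 : (1 : ℝ) ≤ q := by exact_mod_cast hpos
  push_cast at h6
  nlinarith

theorem fail_core_card_le {c R ρ ε : ℝ} (hn : 2 ≤ Fintype.card V) (hR : 0 < R)
    (hA : Admissible G w VC d γ (γ * R)) (hρ : 1 + Real.log R ≤ ρ) (hρ1 : 1 ≤ ρ) (hc : 1 ≤ c)
    (hε : 0 < ε) (hε1 : ε ≤ 1) :
    fail (cutSparsify 1000 R c (ε / 2) (hatCore G w VC d (ε / 2))) (fun H =>
      IsWeightedOn VC γ H ∧ ((edges H).card : ℝ) ≤ 3000000 * (c + 1) *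
        (VC.card * (ρ ^ 2 * (2 * Real.log (Fintype.card V)) ^ 5 * ε⁻¹ ^ 2))) ≤
    ENNReal.ofReal (Real.exp (-((c + 2) * Real.log (Fintype.card V)))) := by
  have hη1 : ε / 2 ≤ 1 := by linarith
  have hW := hA.isWeightedOn_hatCore hη1
  have hq : ∀ e ∈ edges (hatCore G w VC d (ε / 2)), Int.log 2 (hatCore G w VC d (ε / 2) e) ∈
      Finset.Icc (Int.log 2 γ) (Int.log 2 γ + (Int.log 2 (γ * R) - Int.log 2 γ).toNat) := by
    intro e he
    have h2 := ((hA.hatCore_cases hη1 e).resolve_left (mem_edges.1 he)).2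
    exact log_mem_Icc hA.pos h2.1 h2.2
  have hqρ := toNat_log_sub_log_le hA.pos hR hρ hρ1
  set q := (Int.log 2 (γ * R) - Int.log 2 γ).toNat
  set G₀ := hatCore G w VC d (ε / 2) with hG₀
  set n := Fintype.card V with hndef
  have hE : (edges G₀).card ≤ n ^ 4 := (Finset.card_le_univ _).trans (card_lEdge_le hn)
  have hx := half_le_log hn
  have hkx := clog_le_mul_log hn hE
  unfold cutSparsify
  dsimp only
  rw [← hndef]
  set k := Nat.clog 2 (edges G₀).card with hk
  set t := cutBundleSize 1000 n R (c + 1) (ε / 2 / (2 * k)) with ht'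
  set x := Real.log n with hxdef
  have hr : 0 ≤ (c + 2) * x := by positivity
  have hloop := fail_loop_card_le (r := (c + 2) * x) (k := k) (t := t)
    (s := ⌈2 * (c + 2 + 2) * x⌉₊) hA.pos hr hW hq
  have htail := tail_le (b := 4) (k := k) (E := (edges G₀).card) (K := c + 2) hn (by norm_num)
    ((Nat.le_pow_clog (by norm_num) _).trans (Nat.pow_le_pow_left (by norm_num) _))
    (Nat.le_ceil (2 * (c + 2 + 2) * x))
  simp only [Nat.cast_ofNat] at htail
  refine (fail_mono fun H hH hcard => ⟨?_, ?_⟩).trans (hloop.trans htail)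
  · exact isWeightedOn_of_mem_support_loop hA.pos.le hW H hH
  -- An empty cover leaves no edges. Otherwise |VC| ≥ 1 absorbs the stopping threshold and the tail,
  -- which carry no factor |VC|.
  · rcases Nat.eq_zero_or_pos VC.card with h0 | hVC
    · rw [edges_eq_empty_of_cover_empty
        (isWeightedOn_of_mem_support_loop hA.pos.le hW H hH) h0, h0]
      simp
    have hVC1 : (1 : ℝ) ≤ VC.card := by exact_mod_cast hVC
    have hε2 : 1 ≤ ε⁻¹ ^ 2 := one_le_pow₀ ((one_le_inv₀ hε).2 hε1)
    have hy : 1 ≤ 2 * x := by linarith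
    have hkx' : (k : ℝ) ≤ 10 * x := by
      push_cast at hkx
      linarith
    have hs := (Nat.ceil_lt_add_one (by positivity : 0 ≤ 2 * (c + 2 + 2) * x)).le
    have hmain : (k : ℝ) * (t * (q + 1) * VC.card) ≤
        2000010 * (c + 1) * (VC.card * (ρ ^ 2 * (2 * x) ^ 5 * ε⁻¹ ^ 2)) := by
      rcases Nat.eq_zero_or_pos k with hk0 | hkpos
      · rw [hk0, Nat.cast_zero, zero_mul]
        positivity
      have htb := bundleSize_bound hρ hρ1 hc hε hε1 hx (k := k) (by exact_mod_cast hkpos) hkx'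
      change ((t : ℕ) : ℝ) ≤ _ at htb
      calc (k : ℝ) * (t * (q + 1) * VC.card)
          ≤ (10 * x) * ((200001 * (c + 1) * (ρ * (2 * x) ^ 4 * ε⁻¹ ^ 2)) * (2 * ρ) * VC.card) := by
            gcongr
        _ = _ := by ring
    have hrest : (c + 2) * x + ⌈2 * (c + 2 + 2) * x⌉₊ ≤
        10 * (c + 1) * (VC.card * (ρ ^ 2 * (2 * x) ^ 5 * ε⁻¹ ^ 2)) := by
      have h1 : (c + 2) * x + ⌈2 * (c + 2 + 2) * x⌉₊ ≤ 10 * (c + 1) * (2 * x) := by nlinarith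
      have h2 : 2 * x ≤ VC.card * (ρ ^ 2 * (2 * x) ^ 5 * ε⁻¹ ^ 2) := by
        calc 2 * x = 1 * (1 ^ 2 * (2 * x) * 1) := by ring
          _ ≤ VC.card * (ρ ^ 2 * (2 * x) ^ 5 * ε⁻¹ ^ 2) := by
              have : 2 * x ≤ (2 * x) ^ 5 := le_self_pow₀ hy (by norm_num)
              gcongr
      refine h1.trans ?_
      gcongr
    have hZ : 0 ≤ (c + 1) * (VC.card * (ρ ^ 2 * (2 * x) ^ 5 * ε⁻¹ ^ 2)) := by positivity
    linarith

theorem bucketVerts_eq_empty_or {M : ℝ} (hA : Admissible G w VC d γ M) (i : ℕ) :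
    bucketVerts G w VC γ i = ∅ ∨ (0 < d ∧ 0 < VC.card) := by
  rcases (bucketVerts G w VC γ i).eq_empty_or_nonempty with h | ⟨x, hx⟩
  · exact Or.inl h
  · obtain ⟨hxV, hne, -⟩ := (Finset.mem_filter.1 hx).2
    exact Or.inr ⟨hA.d_pos hxV hne, Finset.card_pos.2 (hne.mono (hA.nbrs_subset hxV))⟩

theorem fail_bucket_le {M ε K : ℝ} (hn : 2 ≤ Fintype.card V) (hM : 0 ≤ M)
    (hA : Admissible G w VC d γ M) (hε : 0 < ε) (hε1 : ε ≤ 1) (hK : 0 ≤ K) {t : ℕ}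
    (ht : 0 < d → 0 < t ∧ 16384 * (K + 7) * (d ^ 2 * Real.log (Fintype.card V) ^ 3 * ε⁻¹ ^ 3) ≤ t)
    (i : ℕ) :
    fail (boundedVertexSparsify t (Nat.clog 2 (Fintype.card V)) (hatBucket G w VC d (ε / 2) γ i)
        (bucketVerts G w VC γ i))
      (fun H => (IsStars VC (bucketVerts G w VC γ i) γ (2 * Fintype.card V * M) H ∧ ∀ S ⊆ VC,
        (1 - ε / 4) * outerCut VC (hatBucket G w VC d (ε / 2) γ i) S ≤ outerCut VC H S ∧
        outerCut VC H S ≤ (1 + ε / 4) * outerCut VC (hatBucket G w VC d (ε / 2) γ i) S) ∧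
        ((outerVerts VC H).card : ℝ) ≤
          (2 * K + 10) * (VC.card * t * Real.log (Fintype.card V))) ≤
      2 * ENNReal.ofReal (Real.exp (-(K * Real.log (Fintype.card V)))) := by
  have hst := hA.isStars_hatBucket_weights (η := ε / 2) i
  have hst' := hA.isStars_hatBucket (η := ε / 2) (by linarith) i
  have hdeg : ∀ x ∈ bucketVerts G w VC γ i,
      (neighbors (hatBucket G w VC d (ε / 2) γ i) x).card ≤ d := fun x hx =>
    hA.card_neighbors_hatBucket hx
  have hcase := bucketVerts_eq_empty_or hA i
  set X := bucketVerts G w VC γ i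
  set B := hatBucket G w VC d (ε / 2) γ i
  set n := Fintype.card V
  have hx := half_le_log hn
  have hlx := clog_le_mul_log hn (m := 1) (E := n) (by simp)
  have hl2 := two_pow_clog_le hn
  have hlE := Nat.le_pow_clog (b := 2) (by norm_num) n
  have hlpos : 0 < Nat.clog 2 n := Nat.clog_pos (by norm_num) hn
  set l := Nat.clog 2 n
  set x := Real.log n with hxdef
  have hsupp : ∀ H ∈ (boundedVertexSparsify t l B X).support, IsStars VC X γ (2 * n * M) H :=
    fun H hH => (isStars_of_mem_support hA.pos.le hM hst H hH).mono subset_rfl hst.disj le_rfl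
      (by gcongr)
  have hB0 : ∀ S, 0 ≤ outerCut VC B S := outerCut_nonneg (hst.nonneg hA.pos.le) VC
  -- For d = 0 or an empty cover the bucket is empty; nothing is required of t, which is 0 when d =
  -- 0.
  rcases hcase with hX | ⟨hd, hVC⟩
  · rw [fail_eq_zero]
    · exact bot_le
    intro H hH
    have hs := hsupp H hH
    refine ⟨⟨hs, fun S hS => ?_⟩, ?_⟩
    · rw [hs.outerCut_eq hS, hst.outerCut_eq hS, hX]
      simp
    · have h1 := hs.outerVerts_subset
      rw [hX, Finset.subset_empty] at h1
      rw [h1, Finset.card_empty, Nat.cast_zero]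
      positivity
  obtain ⟨htpos, ht⟩ := ht hd
  have hl1 : (1 : ℝ) ≤ l := by exact_mod_cast hlpos
  have hd1 : (1 : ℝ) ≤ d := by exact_mod_cast hd
  have hl4 : (l : ℝ) ≤ 4 * x := by
    push_cast at hlx
    linarith
  have hγ := hA.pos
  have hXn : X.card ≤ n := Finset.card_le_univ _
  -- With δ = ε/(8l) and lo/hi = ε/(4d) the exponent is ε³ t / (1024 d² l²), and l ≤ 4 log n gives
  -- 16384 = 1024 · 4². The summands 4 and 3 absorb the factor 16 n³ of the union bound.
  have hκ : (K + (4 : ℕ) + (3 : ℕ)) * x ≤ (ε / (8 * l)) ^ 2 *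
      (t * (ε / 2 / d * (γ * 2 ^ i))) / (4 * (d * (γ * 2 ^ (i + 1)))) := by
    have e1 : (ε / (8 * l)) ^ 2 * (t * (ε / 2 / d * (γ * 2 ^ i))) /
        (4 * (d * (γ * 2 ^ (i + 1)))) = ε ^ 3 * t / (1024 * d ^ 2 * l ^ 2) := by
      field_simp
      norm_num
      ring
    rw [e1, le_div_iff₀ (by positivity)]
    calc (K + (4 : ℕ) + (3 : ℕ)) * x * (1024 * d ^ 2 * l ^ 2)
        ≤ (K + (4 : ℕ) + (3 : ℕ)) * x * (1024 * d ^ 2 * (4 * x) ^ 2) := by gcongr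
      _ = ε ^ 3 * (16384 * (K + 7) * (d ^ 2 * x ^ 3 * ε⁻¹ ^ 3)) := by
          field_simp
          push_cast
          ring
      _ ≤ ε ^ 3 * t := by gcongr
  have hδ1 : ε / (8 * l) ≤ 1 := by
    rw [div_le_one (by positivity)]
    linarith
  have hlohi : ε / 2 / d * (γ * 2 ^ i) ≤ γ * 2 ^ (i + 1) := by
    have h1 : ε / 2 / d ≤ 1 := (div_le_one (by linarith)).2 (by linarith)
    have h2 : 0 < γ * 2 ^ i := by positivity
    rw [pow_succ]
    nlinarith
  have hcut := fail_vertex_cut_le (l := l) (N := n) (κ := (K + (4 : ℕ) + (3 : ℕ)) * x) htpos hd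
    (by positivity : 0 ≤ ε / (8 * l)) hδ1 (by positivity) hlohi hst' hdeg hXn hκ
  have hcard := fail_vertex_card_le (t := t) (s := ⌈2 * (K + 2) * x⌉₊) (l := l) hst
  have htail := tail_le (b := 2) (k := l) (E := X.card) (K := K) hn le_rfl (hXn.trans hlE)
    (Nat.le_ceil (2 * (K + 2) * x))
  simp only [Nat.cast_ofNat] at htail
  rw [two_mul (ENNReal.ofReal _)]
  refine (fail_mono fun H hH hQ => ⟨⟨hsupp H hH, fun S hS => ?_⟩, ?_⟩).trans
    ((fail_and_le _ _ _).trans (add_le_add (hcut.trans ?_) (hcard.trans htail)))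
  · rw [← ENNReal.ofReal_natCast l, ← ENNReal.ofReal_mul (by positivity)]
    apply ENNReal.ofReal_le_ofReal
    have hVC' : (VC.card : ℝ) ≤ n := by exact_mod_cast Finset.card_le_univ VC
    have hln : (l : ℝ) ≤ 4 * n := by
      have := Real.log_le_self (show (0 : ℝ) ≤ n by positivity)
      linarith
    calc (l : ℝ) * (4 * n * VC.card * Real.exp (-((K + (4 : ℕ) + (3 : ℕ)) * x)))
        ≤ (4 * n) * (4 * n * n * Real.exp (-((K + (4 : ℕ) + (3 : ℕ)) * x))) := by gcongr
      _ = 16 * (n : ℝ) ^ 3 * Real.exp (-((K + (4 : ℕ) + (3 : ℕ)) * x)) := by ring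
      _ ≤ _ := mul_pow_mul_exp_le hn (by norm_num) le_rfl
  · obtain ⟨h1, h2⟩ := pow_approx l hε.le hε1
    exact ⟨(mul_le_mul_of_nonneg_right h2 (hB0 S)).trans (hQ.1 S hS).1,
      (hQ.1 S hS).2.trans (mul_le_mul_of_nonneg_right h1 (hB0 S))⟩
  · have h1 : ((outerVerts VC H).card : ℝ) ≤ l * (t * VC.card) + ⌈2 * (K + 2) * x⌉₊ := by
      exact_mod_cast hQ.2
    have hs := (Nat.ceil_lt_add_one (by positivity : 0 ≤ 2 * (K + 2) * x)).le
    have hVC1 : (1 : ℝ) ≤ VC.card := by exact_mod_cast hVC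
    have ht1 : (1 : ℝ) ≤ t := by exact_mod_cast htpos
    have h2 : x ≤ VC.card * t * x :=
      le_mul_of_one_le_left (by linarith) (one_le_mul_of_one_le_of_one_le hVC1 ht1)
    have h3 : (l : ℝ) * (t * VC.card) ≤ 4 * x * (t * VC.card) := by gcongr
    have h4 : (2 * K + 6) * x ≤ (2 * K + 6) * (VC.card * t * x) := by gcongr
    linarith

end Parts

/-! ### The full procedure -/

section Main

theorem log_floor_add_one_le {R ρ : ℝ} (hρ : 1 + Real.log R ≤ ρ) (hρ1 : 1 ≤ ρ) :
    ((Nat.log 2 ⌊R⌋₊ + 1 : ℕ) : ℝ) ≤ 2 * ρ := by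
  rcases Nat.eq_zero_or_pos ⌊R⌋₊ with h0 | hpos
  · rw [h0, Nat.log_zero_right]
    push_cast
    linarith
  · have hR : 1 ≤ R := Nat.floor_pos.1 hpos
    have h1 : ((2 ^ Nat.log 2 ⌊R⌋₊ : ℕ) : ℝ) ≤ R :=
      (Nat.cast_le.2 (Nat.pow_log_le_self 2 hpos.ne')).trans (Nat.floor_le (by linarith))
    push_cast at h1
    have h2 := Real.log_le_log (by positivity) h1
    rw [Real.log_pow] at h2
    have h3 := Real.log_two_gt_d9
    have h4 : (0 : ℝ) ≤ Nat.log 2 ⌊R⌋₊ := by positivity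
    push_cast
    nlinarith

theorem exists_of_forall₂_mem {α β : Type*} {P : α → β → Prop} {l : List α} {l' : List β}
    (h : List.Forall₂ P l l') : ∀ b ∈ l', ∃ a, P a b := by
  induction h with
  | nil => simp
  | @cons a b l l' hab _ ih =>
    intro b' hb'
    rcases List.mem_cons.1 hb' with rfl | hb'
    · exact ⟨a, hab⟩
    · exact ih b' hb'

variable {V : Type*} [Fintype V]

theorem IsWeightedOn.isMultigraphOn {VC : Finset V} {lo : ℝ} {H : WGraph V}
    (hH : IsWeightedOn VC lo H) : IsMultigraphOn VC H := fun e he =>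
  ((hH e).resolve_left (mem_edges.1 he)).1

theorem IsStars.isBipartiteBetween {VC X : Finset V} {lo hi : ℝ} {H : WGraph V}
    (hH : IsStars VC X lo hi H) : IsBipartiteBetween VC H := by
  intro e he
  obtain ⟨-, x, hx, v, hv, h⟩ := hH.supp e (mem_edges.1 he)
  exact ⟨v, hv, x, hH.disj x hx, by rw [h, Sym2.eq_swap]⟩

/-- The core fails with probability at most 2 n^(-(c+2)), and each of the at most 2ρ ≤ n^q buckets
with at most 2 n^(-(c+2+q)). The total is at most 4 n^(-(c+2)) ≤ n^(-c). -/
theorem fail_vertexSparsify_le {G : SimpleGraph V} {w : Sym2 V → ℝ} {VC : Finset V} {d t : ℕ}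
    {γ c R ρ q ε : ℝ} (hn : 2 ≤ Fintype.card V) (hR : 0 < R)
    (hA : Admissible G w VC d γ (γ * R)) (hρ : 1 + Real.log R ≤ ρ) (hρ1 : 1 ≤ ρ) (hc : 1 ≤ c)
    (hε : 0 < ε) (hε1 : ε ≤ 1) (hq : 0 ≤ q)
    (hρq : 2 * ρ ≤ Real.exp (q * Real.log (Fintype.card V)))
    (ht : 0 < d → 0 < t ∧
      16384 * (c + 2 + q + 7) * (d ^ 2 * Real.log (Fintype.card V) ^ 3 * ε⁻¹ ^ 3) ≤ t) :
    fail (vertexSparsify 1000 c γ R t G w VC d ε) (fun H =>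
      (IsMultigraphOn VC H.core ∧ ((edges H.core).card : ℝ) ≤ 3000000 * (c + 1) *
        (VC.card * (ρ ^ 2 * (2 * Real.log (Fintype.card V)) ^ 5 * ε⁻¹ ^ 2))) ∧
      (∀ M ∈ H.buckets, IsBipartiteBetween VC M ∧ ((outerVerts VC M).card : ℝ) ≤
        (2 * (c + 2 + q) + 10) * (VC.card * t * Real.log (Fintype.card V))) ∧
      TerminalApprox ε VC H.graph (ofSimple G w) ∧
      ∀ e ∈ edges H.graph, γ ≤ H.graph e ∧ H.graph e ≤ 4 * (Fintype.card V * (γ * R))) ≤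
    ENNReal.ofReal ((Fintype.card V : ℝ) ^ (-c)) := by
  have hM0 : 0 ≤ γ * R := mul_nonneg hA.pos.le hR.le
  have hcut := fail_core_cut_le hn hA hc hε hε1
  have hcard := fail_core_card_le hn hR hA hρ hρ1 hc hε hε1
  have hbuck := fail_runAll_le (List.range (Nat.log 2 ⌊R⌋₊ + 1)) _ _ fun i _ =>
    fail_bucket_le hn hM0 hA hε hε1 (by linarith : 0 ≤ c + 2 + q) ht i
  have hcore := (fail_and_le _ _ _).trans (add_le_add hcut hcard)
  set n := Fintype.card V
  set x := Real.log n with hx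
  have hx0 : 1 / 2 ≤ x := half_le_log hn
  have htot : ENNReal.ofReal (Real.exp (-((c + 2) * x))) +
      ENNReal.ofReal (Real.exp (-((c + 2) * x))) +
      (List.range (Nat.log 2 ⌊R⌋₊ + 1)).length *
        (2 * ENNReal.ofReal (Real.exp (-((c + 2 + q) * x)))) ≤ ENNReal.ofReal ((n : ℝ) ^ (-c)) := by
    have h2 : (2 : ℝ≥0∞) = ENNReal.ofReal 2 := by norm_num
    rw [List.length_range, ← ENNReal.ofReal_natCast (Nat.log 2 ⌊R⌋₊ + 1), h2,
      ← ENNReal.ofReal_mul (by norm_num), ← ENNReal.ofReal_mul (by positivity),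
      ← ENNReal.ofReal_add (by positivity) (by positivity),
      ← ENNReal.ofReal_add (by positivity) (by positivity)]
    apply ENNReal.ofReal_le_ofReal
    have hL := (log_floor_add_one_le hρ hρ1).trans hρq
    have e1 : Real.exp (q * x) * Real.exp (-((c + 2 + q) * x)) = Real.exp (-((c + 2) * x)) := by
      rw [← Real.exp_add]; congr 1; ring
    have e2 : (n : ℝ) ^ (-c) = Real.exp (-((c + 2) * x)) * Real.exp (2 * x) := by
      rw [Real.rpow_def_of_pos (by positivity), ← Real.exp_add]
      congr 1; ring
    have e3 : (4 : ℝ) ≤ Real.exp (2 * x) := by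
      have : (2 : ℝ) ≤ n := by exact_mod_cast hn
      rw [two_mul, Real.exp_add, hx, exp_log_natCast hn]
      nlinarith
    have h5 : ((Nat.log 2 ⌊R⌋₊ + 1 : ℕ) : ℝ) * (2 * Real.exp (-((c + 2 + q) * x))) ≤
        Real.exp (q * x) * (2 * Real.exp (-((c + 2 + q) * x))) := by gcongr
    rw [e2]
    have h6 := mul_le_mul_of_nonneg_left e3 (Real.exp_pos (-((c + 2) * x))).le
    linarith
  refine le_trans ?_ htot
  unfold vertexSparsify
  refine fail_bind_le hcore fun H₀ _ hH₀ => ?_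
  rw [fail_map]
  refine (fail_mono fun Hs _ hHs => ?_).trans hbuck
  obtain ⟨hcut, hW, hcard⟩ := hH₀
  have hprop := output_properties hA hε hε1 hM0 le_rfl hW hcut
    (List.Forall₂.imp (fun _ _ h => h.1) hHs)
  refine ⟨⟨hW.isMultigraphOn, hcard⟩, fun M hM => ?_, hprop.1, fun e he => ?_⟩
  · obtain ⟨i, hi⟩ := exists_of_forall₂_mem hHs M hM
    exact ⟨hi.1.1.isBipartiteBetween, hi.2⟩
  · refine ⟨(hprop.2 e he).1, (hprop.2 e he).2.trans (max_le le_rfl ?_)⟩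
    have : 0 ≤ n * (γ * R) := by positivity
    linarith

theorem admissible_of_ncard {G : SimpleGraph V} {w : Sym2 V → ℝ} {VC : Finset V} {d : ℕ}
    {γ W a : ℝ} (hVC : G.IsVertexCover (VC : Set V))
    (hd : ∀ x ∉ VC, (G.neighborSet x).ncard ≤ d) (hγ : 0 < γ)
    (hw : ∀ e ∈ G.edgeSet, γ ≤ w e ∧ w e ≤ a * (γ * W)) :
    Admissible G w VC d γ (γ * (a * W)) where
  cover := hVC
  deg x hx := by
    have : G.neighborSet x = (nbrs G x : Set V) := by
      ext v
      simp [nbrs]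
    rw [← Set.ncard_coe_finset, ← this]
    exact hd x hx
  pos := hγ
  bound e he := ⟨(hw e he).1, (hw e he).2.trans (le_of_eq (by ring))⟩

theorem one_add_log_mul_le {a A W x : ℝ} {B : ℕ} (ha : 0 < a) (hA : 0 ≤ A) (hW : 1 ≤ W)
    (hx : 1 / 2 ≤ x) (h : Real.log W ≤ A * x ^ B) :
    1 + Real.log (a * W) ≤ (1 + |Real.log a| + A) * (2 * x) ^ B := by
  rw [Real.log_mul ha.ne' (by linarith)]
  have h1 : 1 ≤ (2 * x) ^ B := one_le_pow₀ (by linarith)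
  have h2 : x ^ B ≤ (2 * x) ^ B := pow_le_pow_left₀ (by linarith) (by linarith) B
  have h3 := mul_le_mul_of_nonneg_left h2 hA
  have h4 := mul_le_mul_of_nonneg_left h1 (by positivity : 0 ≤ 1 + |Real.log a|)
  have h5 := le_abs_self (Real.log a)
  linarith

/-- The number of buckets is polylogarithmic, hence below a fixed power of n; here 2 log n ≤ n² is
enough. -/
theorem mul_pow_le_exp {b : ℝ} {n q B : ℕ} (hn : 2 ≤ n) (hb : b ≤ 2 ^ q) :
    b * (2 * Real.log n) ^ B ≤ Real.exp ((q + 2 * B : ℝ) * Real.log n) := by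
  have hx := half_le_log hn
  have h2 : (2 : ℝ) ≤ n := by exact_mod_cast hn
  have h1 : (2 : ℝ) ^ q ≤ Real.exp (q * Real.log n) := by
    rw [Real.exp_nat_mul, exp_log_natCast hn]
    exact pow_le_pow_left₀ (by norm_num) h2 q
  have h3 : (2 * Real.log n) ^ B ≤ Real.exp (B * (2 * Real.log n)) := by
    rw [Real.exp_nat_mul]
    exact pow_le_pow_left₀ (by linarith) (by linarith [Real.add_one_le_exp (2 * Real.log n)]) B
  calc b * (2 * Real.log n) ^ B ≤ Real.exp (q * Real.log n) * Real.exp (B * (2 * Real.log n)) := by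
        have : 0 ≤ 2 * Real.log n := by linarith
        have := hb.trans h1
        gcongr
    _ = _ := by rw [← Real.exp_add]; congr 1; ring

end Main

end VertexSparsification

-- What remains is the choice of constants. The bound ρ = a₁ (2 log n)^B for 1 + log R limits weight
-- classes and buckets, q makes 2ρ at most n^(q + 2B), and K is the resulting failure exponent of
-- one bucket. Vertex sets with fewer than two elements are treated apart, since log n ≥ 1/2 fails
-- there.
open VertexSparsification in
theorem mainTheorem9 (c a A : ℝ) (B : ℕ) (hc : 1 ≤ c) (ha : 0 < a) (hA : 0 ≤ A) :
    ∃ (Cξ C : ℝ) (p : ℕ) (t : ℕ → ℕ → ℝ → ℕ), 0 < Cξ ∧ 0 < C ∧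
      (∀ (n d : ℕ) (ε : ℝ), 0 < ε → ε ≤ 1 →
        (t n d ε : ℝ) ≤ C * (d ^ 2 * Real.log n ^ 3 * (ε⁻¹) ^ 3)) ∧
      ∀ (V : Type*) [Fintype V] (G : SimpleGraph V) (w : Sym2 V → ℝ) (VC : Finset V) (d : ℕ)
        (γ W ε : ℝ), G.IsVertexCover (VC : Set V) →
        (∀ x ∉ VC, (G.neighborSet x).ncard ≤ d) →
        0 < γ → 1 ≤ W → Real.log W ≤ A * Real.log (Fintype.card V) ^ B →
        (∀ e ∈ G.edgeSet, γ ≤ w e ∧ w e ≤ a * (γ * W)) →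
        0 < ε → ε ≤ 1 →
        ENNReal.ofReal (1 - (Fintype.card V : ℝ) ^ (-c)) ≤
          (vertexSparsify Cξ c γ (a * W) (t (Fintype.card V) d ε) G w VC d ε).toOuterMeasure
            {H | (IsMultigraphOn VC H.core ∧
                ((edges H.core).card : ℝ) ≤
                  C * (VC.card * Real.log (Fintype.card V) ^ p * (ε⁻¹) ^ p)) ∧
              (∀ M ∈ H.buckets, IsBipartiteBetween VC M ∧
                ((outerVerts VC M).card : ℝ) ≤
                  C * (VC.card * t (Fintype.card V) d ε * Real.log (Fintype.card V))) ∧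
              TerminalApprox ε VC H.graph (ofSimple G w) ∧
              ∀ e ∈ edges H.graph, γ ≤ H.graph e ∧
                H.graph e ≤ C * (γ * Fintype.card V * W)} := by
  obtain ⟨q, hq⟩ := pow_unbounded_of_one_lt (2 * (1 + |Real.log a| + A)) one_lt_two
  set a₁ := 1 + |Real.log a| + A with ha₁
  have ha₁1 : 1 ≤ a₁ := by
    have := abs_nonneg (Real.log a)
    linarith
  set K : ℝ := c + 2 + (q + 2 * B) with hK
  have hK0 : 0 ≤ K := by positivity
  -- The factor 2 makes up for rounding t down, as ⌊2z⌋ ≥ z for z ≥ 1. Rounding down keeps the upper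
  -- bound on t valid even for log n = 0 or d = 0.
  set T : ℝ := 2 * (16384 * (K + 7)) with hT
  have hT0 : 0 ≤ T := by positivity
  set C₁ : ℝ := 3000000 * (c + 1) * (a₁ ^ 2 * 2 ^ (2 * B + 5)) with hC₁
  have hC₁0 : 0 ≤ C₁ := by positivity
  have hlog : ∀ n : ℕ, 0 ≤ Real.log n := Real.log_natCast_nonneg
  refine ⟨1000, T + C₁ + (2 * K + 10) + 4 * a, 2 * B + 5,
    fun n d ε => ⌊T * (d ^ 2 * Real.log n ^ 3 * ε⁻¹ ^ 3)⌋₊, by norm_num, by positivity, ?_, ?_⟩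
  · intro n d ε hε _
    have h0 : 0 ≤ d ^ 2 * Real.log n ^ 3 * ε⁻¹ ^ 3 := by
      have := hlog n
      positivity
    refine (Nat.floor_le (mul_nonneg hT0 h0)).trans (mul_le_mul_of_nonneg_right ?_ h0)
    linarith
  intro V _ G w VC d γ W ε hVC hdeg hγ hW hlogW hw hε hε1
  rcases Nat.lt_or_ge (Fintype.card V) 2 with hlt | hn
  -- For n = 0 the power 0 ^ (-c) is 0, so success must be certain, and it is for trivial reasons.
  -- For n = 1 the claimed probability is 0.
  · rcases Nat.eq_zero_or_pos (Fintype.card V) with h0 | hpos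
    · have hV : IsEmpty V := Fintype.card_eq_zero_iff.1 h0
      refine le_trans ?_ (one_sub_fail_le _ _ (fail_eq_zero fun H _ => ?_).le)
      · rw [h0, tsub_zero, ← ENNReal.ofReal_one]
        apply ENNReal.ofReal_le_ofReal
        rw [Nat.cast_zero, Real.zero_rpow (by linarith)]
        norm_num
      · have hE : ∀ M : WGraph V, edges M = ∅ := fun M => Finset.eq_empty_of_isEmpty _
        have hU : ∀ S : Finset V, S = ∅ := fun S => Finset.eq_empty_of_isEmpty _
        have hcut : ∀ (M : WGraph V) (S : Finset V), terminalCut VC M S = 0 := by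
          intro M S
          rw [terminalCut, cutWeight, Finset.sum_of_isEmpty, Finset.sum_of_isEmpty, add_zero]
        refine ⟨⟨fun e he => ?_, ?_⟩, fun M _ => ⟨fun e he => ?_, ?_⟩, fun S _ => ?_,
          fun e he => ?_⟩
        · simp [hE] at he
        · simp [hE, hU VC]
        · simp [hE] at he
        · simp [hU]
        · simp [hcut]
        · simp [hE] at he
    · have h1 : Fintype.card V = 1 := by omega
      rw [h1]
      simp
  have hx := half_le_log hn
  have hAd := admissible_of_ncard hVC hdeg hγ hw
  have haW : 0 < a * W := by positivity
  have hρ := one_add_log_mul_le ha hA hW hx hlogW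
  rw [← ha₁] at hρ
  set n := Fintype.card V
  set x := Real.log n
  set t := ⌊T * (d ^ 2 * x ^ 3 * ε⁻¹ ^ 3)⌋₊ with ht
  have hy : 1 ≤ 2 * x := by linarith
  have hρ1 : 1 ≤ a₁ * (2 * x) ^ B := one_le_mul_of_one_le_of_one_le ha₁1 (one_le_pow₀ hy)
  have hρq : 2 * (a₁ * (2 * x) ^ B) ≤ Real.exp ((q + 2 * B : ℝ) * x) := by
    rw [← mul_assoc]
    exact mul_pow_le_exp hn hq.le
  have hεinv : 1 ≤ ε⁻¹ := (one_le_inv₀ hε).2 hε1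
  have htd : 0 < d → 0 < t ∧
      16384 * (c + 2 + (q + 2 * B : ℝ) + 7) * (d ^ 2 * x ^ 3 * ε⁻¹ ^ 3) ≤ t := by
    intro hd
    have hd1 : (1 : ℝ) ≤ d := by exact_mod_cast hd
    have hZ : 1 / 8 ≤ d ^ 2 * x ^ 3 * ε⁻¹ ^ 3 := by
      calc (1 / 8 : ℝ) = 1 ^ 2 * (1 / 2) ^ 3 * 1 ^ 3 := by norm_num
        _ ≤ _ := by gcongr
    rw [← hK]
    have hz : 1 ≤ 16384 * (K + 7) * (d ^ 2 * x ^ 3 * ε⁻¹ ^ 3) := by nlinarith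
    have hTz : T * (d ^ 2 * x ^ 3 * ε⁻¹ ^ 3) =
        2 * (16384 * (K + 7) * (d ^ 2 * x ^ 3 * ε⁻¹ ^ 3)) := by rw [hT]; ring
    have hfl := Nat.lt_floor_add_one (T * (d ^ 2 * x ^ 3 * ε⁻¹ ^ 3))
    refine ⟨Nat.floor_pos.2 (by linarith), ?_⟩
    linarith
  have hmain := fail_vertexSparsify_le hn haW hAd hρ hρ1 hc hε hε1 (by positivity) hρq htd
  have hn0 : (0 : ℝ) < n := by positivity
  refine le_trans (le_of_eq ?_) (one_sub_fail_le _ _ ((fail_mono fun H _ hH => ?_).trans hmain))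
  · rw [ENNReal.ofReal_sub _ (by positivity), ENNReal.ofReal_one]
  · obtain ⟨⟨h1, h2⟩, h3, h4, h5⟩ := hH
    refine ⟨⟨h1, h2.trans ?_⟩, fun M hM => ⟨(h3 M hM).1, (h3 M hM).2.trans ?_⟩, h4,
      fun e he => ⟨(h5 e he).1, (h5 e he).2.trans ?_⟩⟩
    -- The exponent 2B + 5 collects 2B from ρ² (bundle size and number of weight classes), four
    -- logarithms from the bundle size and one from the number of rounds.
    · calc 3000000 * (c + 1) * (VC.card * ((a₁ * (2 * x) ^ B) ^ 2 * (2 * x) ^ 5 * ε⁻¹ ^ 2))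
          = C₁ * (VC.card * x ^ (2 * B + 5) * ε⁻¹ ^ 2) := by
            rw [hC₁]
            ring
        _ ≤ C₁ * (VC.card * x ^ (2 * B + 5) * ε⁻¹ ^ (2 * B + 5)) := by
            have : ε⁻¹ ^ 2 ≤ ε⁻¹ ^ (2 * B + 5) := pow_le_pow_right₀ hεinv (by omega)
            gcongr
        _ ≤ _ := by
            gcongr
            linarith
    · exact mul_le_mul_of_nonneg_right (by linarith) (mul_nonneg (by positivity) (hlog n))
    · calc 4 * (n * (γ * (a * W))) = 4 * a * (γ * n * W) := by ring
        _ ≤ _ := by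
            gcongr
            linarith
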